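/- **Setting.** Let $(\mathcal S,\mathcal A,\mathcal P,\rho,\gamma)$ be a discounted MDP with finite state and action spaces, initial distribution $\rho$ and $\gamma\in(0,1)$. For a stationary policy $\pi$ let $d^{\pi}(s)=(1-\gamma)\sum_{t\ge 0}\gamma^t\,\mathbb P_{\rho,\pi}(s_t=s)$ and $\lambda^\pi(s,a)=d^\pi(s)\pi(a|s)$. For $\theta\in\mathbb R^d$ let $\pi_\theta(a|s)=e^{\psi(s,a;\theta)}/\sum_{a'}e^{\psi(s,a';\theta)}$, where each $\psi(s,a;\cdot)$ is $C^2$ with $\|\nabla\psi\|\le l_\psi$ and $\|\nabla^2\psi\|\le L_\psi$ (so that $\pi_\theta(a|s)>0$ and the score functions $\nabla\log\pi_\theta(a|s)$ are bounded), and write $\lambda(\theta)=\lambda^{\pi_\theta}$. Let $\{p_\omega:\omega\in\Omega\}$, $\Omega\subset\mathbb R^m$, $m\ge1$, be a class of probability distributions on $\mathcal S$, put $\Lambda=\{(s,a)\mapsto p_\omega(s)\pi_\theta(a|s):\omega\in\Omega,\theta\in\mathbb R^d\}$, and let $F:\mathbb R^{\mathcal S\times\mathcal A}\to\mathbb R$.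 **Assumptions.** 1. $\Omega$ is compact with $\|\omega\|_\infty\le B_\omega$ on $\Omega$; $d^{\pi_\theta}\in\{p_\omega:\omega\in\Omega\}$ for every $\theta$; and $|p_\omega(s)-p_{\bar\omega}(s)|\le L(s)\|\omega-\bar\omega\|_\infty$ for all $\omega,\bar\omega\in\Omega$ and $s\in\mathcal S$, with $\sum_sL(s)\le B_L$. 2. $F$ is differentiable at the points of $\Lambda$, with $\|\nabla F\|_2\le l_\lambda$ on $\Lambda$ and $\|\nabla F(x)-\nabla F(y)\|_2\le L_\lambda\|x-y\|_2$ for $x,y\in\Lambda$. 3. $F$ is concave on $\Lambda$: $F(ax+by)\ge aF(x)+bF(y)$ whenever $a,b\ge0$, $a+b=1$ and $x,y,ax+by\in\Lambda$. 4. $F^\star=\max_\theta F(\lambda(\theta))$ is attained at some $\theta^*$, and there are $l,\bar\eta>0$ and a set $\Theta\subset\mathbb R^d$ such that every $\theta\in\Theta$ has sets $\mathcal U_\theta\ni\theta$ and $\mathcal V_{\lambda(\theta)}\ni\lambda(\theta)$ for which $\lambda$ is a bijection from $\mathcal U_\theta$ onto $\mathcal V_{\lambda(\theta)}$ with $l$-Lipschitz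 inverse, and $(1-\eta')\lambda(\theta)+\eta'\lambda(\theta^*)\in\mathcal V_{\lambda(\theta)}$ for all $0<\eta'\le\bar\eta$. **Algorithm.** Given $\theta_0\in\Theta$, for $t=0,\dots,T-1$: draw $n$ i.i.d. states $s_1,\dots,s_n$ from $d^{\pi_{\theta_t}}$; let $\hat d_t=p_{\hat\omega}$ for any $\hat\omega$ maximizing $\frac1n\sum_i\log p_\omega(s_i)$ over $\Omega$; set $\hat\lambda_t(s,a)=\hat d_t(s)\pi_{\theta_t}(a|s)$ and $\hat r_t=\nabla F(\hat\lambda_t)$; draw $N$ independent trajectories $\tau^{(i)}$ of length $H$ under $\pi_{\theta_t}$; set $\theta_{t+1}=\theta_t+\frac{\alpha}{N}\sum_{i=1}^Ng(\tau^{(i)},\theta_t,\hat r_t)$, where $g(\tau,\theta,r)=\sum_{t'=0}^{H-1}\big(\sum_{h=t'}^{H-1}\gamma^hr(s_h,a_h)\big)\nabla_\theta\log\pi_\theta(a_{t'}|s_{t'})$. Put $\delta_0=F^\star-F(\lambda(\theta_0))$. **Claim.** There are positive constants $c_\alpha,c_\eta,C_N,C_n,C_H,C$ depending only on $\gamma,l_\psi,L_\psi,l_\lambda,L_\lambda,l,\bar\eta,B_\omega,B_L$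 (in particular not on $|\mathcal S|$, $|\mathcal A|$, $d$, $m$, $\epsilon$) such that for every $\epsilon>0$, with $$\alpha=c_\alpha\epsilon,\quad \eta=c_\eta\epsilon^2,\quad T=\Big\lceil\tfrac1\eta\log\tfrac{\delta_0}{\epsilon}\Big\rceil\ (T=0\text{ if }\delta_0\le\epsilon),\quad N=\lceil C_N\epsilon^{-2}\rceil,\quad n=\big\lceil C_n\,m\,\epsilon^{-2}\log(2+\tfrac1\epsilon)\big\rceil$$ and any horizon $H\ge C_H\log(2+\frac1\epsilon)$: * if $\theta_0,\dots,\theta_{T-1}\in\Theta$ almost surely (in particular if $\Theta=\mathbb R^d$), then $\mathbb E[F^\star-F(\lambda(\theta_T))]\le\epsilon$; * for general $\Theta$, $\mathbb E\big[(F^\star-F(\lambda(\theta_T)))\,\mathbf 1\{\theta_0,\dots,\theta_{T-1}\in\Theta\}\big]\le\epsilon$; * the total sample complexity satisfies $T(N+n)\le C\,m\,\epsilon^{-4}\log^2(2+\frac1\epsilon)$, that is, $O(m\epsilon^{-4})$ up to logarithmic factors. -/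

import Mathlib

noncomputable section

namespace PGOMA

/-- A finite Markov decision process: transition kernel `P` and initial state distribution `ρ`.
The discount factor is a separate parameter. -/
structure MDP (S A : Type*) [Fintype S] where
  /-- `P s a s'` is the probability of moving from `s` to `s'` under action `a`. -/
  P : S → A → S → ℝ
  /-- Initial state distribution. -/
  ρ : S → ℝ
  P_mem : ∀ s a, P s a ∈ stdSimplex ℝ S
  ρ_mem : ρ ∈ stdSimplex ℝ S

/-- The policy parameter space `ℝ^d` with its Euclidean norm. -/
abbrev Param (d : ℕ) : Type := EuclideanSpace ℝ (Fin d)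

/-- Vectors indexed by state-action pairs, with the Euclidean norm. -/
abbrev SAVec (S A : Type*) : Type _ := EuclideanSpace ℝ (S × A)

section Model

variable {S A : Type*} [Fintype S] [Fintype A]

/-- The softmax policy `π_θ(a|s) = exp ψ(s,a;θ) / ∑_{a'} exp ψ(s,a';θ)`. -/
def softmaxPolicy {d : ℕ} (ψ : S → A → Param d → ℝ) (θ : Param d) (s : S) (a : A) : ℝ :=
  Real.exp (ψ s a θ) / ∑ a', Real.exp (ψ s a' θ)

/-- `stateDist M pol t s` is the probability that `s_t = s` for the chain started from `ρ`
and controlled by the stationary policy `pol`. -/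
def stateDist (M : MDP S A) (pol : S → A → ℝ) : ℕ → S → ℝ
  | 0 => M.ρ
  | t + 1 => fun s' => ∑ s, ∑ a, stateDist M pol t s * pol s a * M.P s a s'

/-- Normalized discounted state occupancy measure. -/
def stateOcc (M : MDP S A) (γ : ℝ) (pol : S → A → ℝ) (s : S) : ℝ :=
  (1 - γ) * ∑' t : ℕ, γ ^ t * stateDist M pol t s

/-- The state-action measure `(s,a) ↦ q(s) pol(a|s)`. -/
def joint (q : S → ℝ) (pol : S → A → ℝ) : SAVec S A :=
  WithLp.toLp 2 fun x => q x.1 * pol x.1 x.2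

/-- Normalized state-action occupancy measure `(s,a) ↦ d^pol(s) pol(a|s)`. -/
def occ (M : MDP S A) (γ : ℝ) (pol : S → A → ℝ) : SAVec S A :=
  joint (stateOcc M γ pol) pol

/-- Probability of the length-`H` trajectory `τ = (s_0, a_0, …, s_{H-1}, a_{H-1})`. -/
def trajProb (M : MDP S A) (pol : S → A → ℝ) {H : ℕ} (τ : Fin H → S × A) : ℝ :=
  ∏ h : Fin H,
    (if (h : ℕ) = 0 then M.ρ (τ h).1
      else
        let prev : S × A := τ ⟨(h : ℕ) - 1, lt_of_le_of_lt (Nat.sub_le _ _) h.isLt⟩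
        M.P prev.1 prev.2 (τ h).1) * pol (τ h).1 (τ h).2

/-- The truncated policy gradient estimate
`g(τ,θ,r) = ∑_{t<H} (∑_{t≤h<H} γ^h r(s_h,a_h)) ∇_θ log π_θ(a_t|s_t)`. -/
def pgEstimate {d : ℕ} (γ : ℝ) (ψ : S → A → Param d → ℝ) {H : ℕ} (τ : Fin H → S × A)
    (θ : Param d) (r : SAVec S A) : Param d :=
  ∑ t : Fin H, (∑ h ∈ Finset.Ici t, γ ^ (h : ℕ) * r (τ h)) •
    gradient (fun θ' => Real.log (softmaxPolicy ψ θ' (τ t).1 (τ t).2)) θ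

/-- `w` is a maximum likelihood parameter in `Ω` for the data `x`: it maximizes the likelihood
`∏ i, p_w(x_i)`, which is the same as maximizing the average log-likelihood when the logarithm
of zero is read as minus infinity. -/
def IsMLE {m n : ℕ} (Ω : Set (Fin m → ℝ)) (p : (Fin m → ℝ) → S → ℝ) (x : Fin n → S)
    (w : Fin m → ℝ) : Prop :=
  w ∈ Ω ∧ ∀ w' ∈ Ω, ∏ i, p w' (x i) ≤ ∏ i, p w (x i)

/-- What is sampled in one iteration: `n` states for the likelihood step, and `N` trajectories
of length `H` for the gradient step. -/
abbrev IterData (S A : Type*) (n N H : ℕ) : Type _ :=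
  (Fin n → S) × (Fin N → Fin H → S × A)

/-- Probability of the data of one iteration when the current parameter is `θ`: the states are
i.i.d. from the state occupancy measure of `π_θ`, and the trajectories are i.i.d. trajectories
of `π_θ`, independent of these states. -/
def iterProb {d n N H : ℕ} (M : MDP S A) (γ : ℝ) (ψ : S → A → Param d → ℝ) (θ : Param d)
    (z : IterData S A n N H) : ℝ :=
  (∏ i, stateOcc M γ (softmaxPolicy ψ θ) (z.1 i)) * ∏ i, trajProb M (softmaxPolicy ψ θ) (z.2 i)

/-- One iteration: with `w` the chosen maximum likelihood parameter, the occupancy estimate is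
`(s,a) ↦ p_w(s) π_θ(a|s)`, the pseudo-reward is the gradient of `F` there, and the parameter moves
by `α` times the average of the `N` gradient estimates. -/
def update {d m n N H : ℕ} (γ : ℝ) (ψ : S → A → Param d → ℝ) (F : SAVec S A → ℝ)
    (p : (Fin m → ℝ) → S → ℝ) (α : ℝ) (w : Fin m → ℝ) (θ : Param d)
    (z : IterData S A n N H) : Param d :=
  θ + (α / N) • ∑ i, pgEstimate γ ψ (z.2 i) θ (gradient F (joint (p w) (softmaxPolicy ψ θ)))

/-- The iterates `θ_0, θ_1, …, θ_T` along the sample path `ω` (constant from `T` on). The rule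
`mle t θ x` gives the maximum likelihood parameter chosen at iteration `t`. -/
def iterate {d m n N H T : ℕ} (γ : ℝ) (ψ : S → A → Param d → ℝ) (F : SAVec S A → ℝ)
    (p : (Fin m → ℝ) → S → ℝ) (mle : ℕ → Param d → (Fin n → S) → (Fin m → ℝ)) (α : ℝ)
    (θ₀ : Param d) (ω : Fin T → IterData S A n N H) : ℕ → Param d
  | 0 => θ₀
  | t + 1 =>
    let θ := iterate γ ψ F p mle α θ₀ ω t
    if h : t < T then update γ ψ F p α (mle t θ (ω ⟨t, h⟩).1) θ (ω ⟨t, h⟩) else θ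

/-- Probability of the sample path `ω` of a `T`-iteration run: given the past, the data of
iteration `t` has the law `iterProb` at the current iterate. -/
def runProb {d m n N H T : ℕ} (M : MDP S A) (γ : ℝ) (ψ : S → A → Param d → ℝ)
    (F : SAVec S A → ℝ) (p : (Fin m → ℝ) → S → ℝ)
    (mle : ℕ → Param d → (Fin n → S) → (Fin m → ℝ)) (α : ℝ) (θ₀ : Param d)
    (ω : Fin T → IterData S A n N H) : ℝ :=
  ∏ t : Fin T, iterProb M γ ψ (iterate γ ψ F p mle α θ₀ ω t) (ω t)

/-- Expectation of `f` over a `T`-iteration run (a finite sum, as the sample space is finite). -/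
def runExp {d m n N H T : ℕ} (M : MDP S A) (γ : ℝ) (ψ : S → A → Param d → ℝ)
    (F : SAVec S A → ℝ) (p : (Fin m → ℝ) → S → ℝ)
    (mle : ℕ → Param d → (Fin n → S) → (Fin m → ℝ)) (α : ℝ) (θ₀ : Param d)
    (f : (Fin T → IterData S A n N H) → ℝ) : ℝ :=
  ∑ ω, runProb M γ ψ F p mle α θ₀ ω * f ω

/-! Assumptions -/

/-- Regularity of the score functions `ψ(s,a;·)` of the softmax policy: twice continuously
differentiable, gradients bounded by `lψ`, Hessians bounded by `Lψ` in operator norm. -/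
structure SoftmaxRegular {d : ℕ} (ψ : S → A → Param d → ℝ) (lψ Lψ : ℝ) : Prop where
  contDiff : ∀ s a, ContDiff ℝ 2 (ψ s a)
  grad_le : ∀ s a θ, ‖gradient (ψ s a) θ‖ ≤ lψ
  hess_le : ∀ s a θ, ‖fderiv ℝ (fderiv ℝ (ψ s a)) θ‖ ≤ Lψ

/-- Regularity of the class `{p_w : w ∈ Ω}` of state distributions, `Ω ⊆ ℝ^m`; the norm on
`Fin m → ℝ` is the sup norm. -/
structure ClassRegular {d m : ℕ} (M : MDP S A) (γ : ℝ) (ψ : S → A → Param d → ℝ)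
    (Ω : Set (Fin m → ℝ)) (p : (Fin m → ℝ) → S → ℝ) (Bω BL : ℝ) : Prop where
  mem_simplex : ∀ w ∈ Ω, p w ∈ stdSimplex ℝ S
  isCompact : IsCompact Ω
  norm_le : ∀ w ∈ Ω, ‖w‖ ≤ Bω
  realizable : ∀ θ, ∃ w ∈ Ω, p w = stateOcc M γ (softmaxPolicy ψ θ)
  lipschitz : ∃ L : S → ℝ, (∀ w ∈ Ω, ∀ w' ∈ Ω, ∀ s, |p w s - p w' s| ≤ L s * ‖w' - w‖) ∧
    ∑ s, L s ≤ BL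

/-- The state-action distributions `(s,a) ↦ p_w(s) π_θ(a|s)` of the class. -/
def jointClass {d m : ℕ} (ψ : S → A → Param d → ℝ) (Ω : Set (Fin m → ℝ))
    (p : (Fin m → ℝ) → S → ℝ) : Set (SAVec S A) :=
  {x | ∃ w ∈ Ω, ∃ θ : Param d, x = joint (p w) (softmaxPolicy ψ θ)}

/-- `F` is differentiable at the points of `Λ`, with gradient bounded by `lF` and
`LF`-Lipschitz on `Λ`. -/
structure UtilitySmooth (F : SAVec S A → ℝ) (Λ : Set (SAVec S A)) (lF LF : ℝ) : Prop where
  diff : ∀ x ∈ Λ, DifferentiableAt ℝ F x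
  grad_le : ∀ x ∈ Λ, ‖gradient F x‖ ≤ lF
  grad_lip : ∀ x ∈ Λ, ∀ y ∈ Λ, ‖gradient F x - gradient F y‖ ≤ LF * ‖x - y‖

/-- Concavity of `F` on a set `Λ` that need not be convex: the concavity inequality holds for
every convex combination of two points of `Λ` that lies in `Λ`. For convex `Λ` this is usual
concavity, and it holds whenever `F` is concave on some convex set that contains `Λ`. -/
def ConcaveWithin (F : SAVec S A → ℝ) (Λ : Set (SAVec S A)) : Prop :=
  ∀ x ∈ Λ, ∀ y ∈ Λ, ∀ a b : ℝ, 0 ≤ a → 0 ≤ b → a + b = 1 → a • x + b • y ∈ Λ →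
    a * F x + b * F y ≤ F (a • x + b • y)

/-- Overparametrization at the parameters `θ ∈ Θ`: `lam` is a bijection from a set `U` that
contains `θ` onto a set `V` that contains `lam θ`, with `l`-Lipschitz inverse, and `V` contains
`(1-η) lam θ + η lam θs` for all `0 < η ≤ ηbar`; here `l` and `ηbar` do not depend on `θ`. -/
def Overparam {d : ℕ} (lam : Param d → SAVec S A) (Θ : Set (Param d)) (θs : Param d)
    (l : NNReal) (ηbar : ℝ) : Prop :=
  ∀ θ ∈ Θ, ∃ (U : Set (Param d)) (V : Set (SAVec S A)), θ ∈ U ∧ lam θ ∈ V ∧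
    Set.BijOn lam U V ∧ LipschitzOnWith l (Function.invFunOn lam U) V ∧
    ∀ η : ℝ, 0 < η → η ≤ ηbar → (1 - η) • lam θ + η • lam θs ∈ V

end Model

end PGOMA

end

/-! The objective `J(θ) = F(λ(θ))` need not be concave in `θ`; its concavity is hidden in `λ`. From
`θ ∈ Θ`, the point `(1-η')λ(θ) + η'λ(θ*)` has a preimage `θ'`. Occupancy measures have norm at most
1 and the local inverse is `l`-Lipschitz, so `‖θ'-θ‖ ≤ 2lη'`; concavity gives `J(θ') ≥ (1-η')J(θ) +
η'F*` (`exists_improving_param`). As `J` is smooth, a gradient step of size `a` with gradient error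
`e` does at least as well as any `θ'`, up to `‖θ'-θ‖²/a + 2a‖e‖²` (`le_of_gradient_step`). So the
suboptimality `D` satisfies `E D⁺ ≤ (1-η')D + 4l²η'²/a + 2a E‖e‖²`. With `a` of order `ε`, `η' = 2η`
of order `ε²` and `E‖e‖² ≤ κε²`, the last two terms add up to at most `η'ε/2`: a contraction towards
`ε/2`, iterated along the run by `runExp_indicator_le`.

The gradient error (`sum_iterProb_mul_sq_error_le`) has three parts: the truncation bias, geometric
in `H`; the sampling variance, of order `1/N`; and the pseudo-reward error, at most a constant times
the `ℓ¹` error of the estimated state distribution. For the last part, the class is cut into cells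
of diameter `δ`, each with an upper envelope of mass at most `1 + B_L δ`. The likelihood of the
envelope of the maximizer's cell dominates the true one, and an exponential-moment bound over the
finitely many envelopes gives a mean squared error of order `m log(1/δ)/n + B_L δ`
(`sum_prod_mul_sq_mle_error_le`); `δ` is taken of order `ε²`.

No constant sees the sizes of the spaces: policies are differentiated in `ℓ¹` over actions,
uniformly in the state, and norms of `λ` and its derivatives come from duality with rewards `r`,
which enter only through `|r(s,a)| ≤ ‖r‖`. Finally `δ₀ ≤ 2 l_λ` (`suboptimality_le`), so `ε` is
bounded whenever `T > 0`. -/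

noncomputable section

namespace PGOMA

/-! ### Policies that are smooth in `ℓ¹` over actions -/

section Policy

variable {S A : Type*} [Fintype A]
variable {E : Type*} [NormedAddCommGroup E] [NormedSpace ℝ E]

/-- A differentiable family of stochastic policies `π θ`, with derivative `π'` that is bounded by
`κ₁` and `κ₂`-Lipschitz in the `ℓ¹` norm over actions, uniformly in the state. -/
structure SmoothPolicy (π : E → S → A → ℝ) (π' : E → S → A → E →L[ℝ] ℝ) (κ₁ κ₂ : ℝ) : Prop where
  nonneg : ∀ θ s a, 0 ≤ π θ s a
  sum_eq_one : ∀ θ s, ∑ a, π θ s a = 1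
  hasFDerivAt : ∀ θ s a, HasFDerivAt (fun θ => π θ s a) (π' θ s a) θ
  sum_norm_le : ∀ θ s, ∑ a, ‖π' θ s a‖ ≤ κ₁
  sum_norm_sub_le : ∀ θ θ' s, ∑ a, ‖π' θ s a - π' θ' s a‖ ≤ κ₂ * ‖θ - θ'‖

/-- A derivative bound gives a Lipschitz bound. -/
theorem norm_sub_le_of_hasFDerivAt {G : Type*} [NormedAddCommGroup G] [NormedSpace ℝ G]
    {f : E → G} {f' : E → E →L[ℝ] G} {C : ℝ} (hf : ∀ x, HasFDerivAt f (f' x) x)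
    (hC : ∀ x, ‖f' x‖ ≤ C) (x y : E) : ‖f x - f y‖ ≤ C * ‖x - y‖ :=
  convex_univ.norm_image_sub_le_of_norm_hasFDerivWithin_le
    (fun z _ => (hf z).hasFDerivWithinAt) (fun z _ => hC z) (Set.mem_univ y) (Set.mem_univ x)

/-- An `ℓ¹` bound of the derivatives gives an `ℓ¹` Lipschitz bound. -/
theorem sum_abs_sub_le_of_hasFDerivAt {f : E → A → ℝ} {f' : E → A → E →L[ℝ] ℝ} {C : ℝ}
    (hf : ∀ x a, HasFDerivAt (fun x => f x a) (f' x a) x) (hC : ∀ x, ∑ a, ‖f' x a‖ ≤ C)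
    (x y : E) : ∑ a, |f x a - f y a| ≤ C * ‖x - y‖ := by
  -- Freezing the signs at the two endpoints turns the `ℓ¹` distance into the increment of one
  -- scalar function, so the mean value inequality costs no factor `|A|`.
  set σ : A → ℝ := fun a => SignType.sign (f x a - f y a) with hσ
  have hσ1 : ∀ a, |σ a| ≤ 1 := by
    intro a
    simp only [hσ]
    rcases lt_trichotomy (f x a - f y a) 0 with h | h | h
    · simp [sign_neg h]
    · simp [h]
    · simp [sign_pos h]
  have h1 : ∑ a, |f x a - f y a| = (∑ a, σ a * f x a) - ∑ a, σ a * f y a := by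
    rw [← Finset.sum_sub_distrib]
    refine Finset.sum_congr rfl fun a _ => ?_
    rw [← mul_sub, hσ, sign_mul_self]
  rw [h1]
  refine (le_abs_self _).trans ?_
  refine norm_sub_le_of_hasFDerivAt (f := fun z => ∑ a, σ a * f z a)
    (f' := fun z => ∑ a, σ a • f' z a)
    (fun z => HasFDerivAt.fun_sum fun a _ => (hf z a).const_mul (σ a)) (fun z => ?_) x y
  refine (norm_sum_le _ _).trans ((Finset.sum_le_sum fun a _ => ?_).trans (hC z))
  rw [norm_smul, Real.norm_eq_abs]
  exact mul_le_of_le_one_left (norm_nonneg _) (hσ1 a)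

theorem SmoothPolicy.sum_abs_sub_le {π : E → S → A → ℝ} {π' : E → S → A → E →L[ℝ] ℝ}
    {κ₁ κ₂ : ℝ} (h : SmoothPolicy π π' κ₁ κ₂) (θ θ' : E) (s : S) :
    ∑ a, |π θ s a - π θ' s a| ≤ κ₁ * ‖θ - θ'‖ :=
  sum_abs_sub_le_of_hasFDerivAt (fun x a => h.hasFDerivAt x s a) (fun x => h.sum_norm_le x s) θ θ'

theorem SmoothPolicy.mem_stdSimplex {π : E → S → A → ℝ} {π' : E → S → A → E →L[ℝ] ℝ}
    {κ₁ κ₂ : ℝ} (hπ : SmoothPolicy π π' κ₁ κ₂) (θ : E) (s : S) :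
    π θ s ∈ stdSimplex ℝ A :=
  ⟨hπ.nonneg θ s, hπ.sum_eq_one θ s⟩

end Policy

/-! ### Regularity of the functions `ψ` -/

section Regular

variable {S A : Type*} {d : ℕ}

theorem norm_gradient_eq (f : Param d → ℝ) (θ : Param d) : ‖gradient f θ‖ = ‖fderiv ℝ f θ‖ := by
  simp [gradient]

variable {ψ : S → A → Param d → ℝ} {lψ Lψ : ℝ}

theorem SoftmaxRegular.hasFDerivAt (hψ : SoftmaxRegular ψ lψ Lψ) (θ : Param d) (s : S) (a : A) :
    HasFDerivAt (ψ s a) (fderiv ℝ (ψ s a) θ) θ :=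
  ((hψ.contDiff s a).differentiable (by norm_num) θ).hasFDerivAt

theorem SoftmaxRegular.norm_fderiv_le (hψ : SoftmaxRegular ψ lψ Lψ) (θ : Param d) (s : S) (a : A) :
    ‖fderiv ℝ (ψ s a) θ‖ ≤ lψ :=
  norm_gradient_eq (ψ s a) θ ▸ hψ.grad_le s a θ

theorem SoftmaxRegular.norm_fderiv_sub_le (hψ : SoftmaxRegular ψ lψ Lψ) (θ θ' : Param d)
    (s : S) (a : A) : ‖fderiv ℝ (ψ s a) θ - fderiv ℝ (ψ s a) θ'‖ ≤ Lψ * ‖θ - θ'‖ := by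
  refine norm_sub_le_of_hasFDerivAt (f' := fun x => fderiv ℝ (fderiv ℝ (ψ s a)) x) (fun x => ?_)
    (hψ.hess_le s a) θ θ'
  have : ContDiff ℝ 1 (fderiv ℝ (ψ s a)) := (hψ.contDiff s a).fderiv_right (by norm_num)
  exact (this.differentiable (by norm_num) x).hasFDerivAt

end Regular

/-! ### Derivatives of the softmax policy -/

section Softmax

variable {S A : Type*} [Fintype A] [Nonempty A] {d : ℕ}

/-- The score `∇ log π_θ(a|s)` of the softmax policy, as a linear functional. -/
def score (ψ : S → A → Param d → ℝ) (θ : Param d) (s : S) (a : A) : Param d →L[ℝ] ℝ :=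
  fderiv ℝ (ψ s a) θ - ∑ b, softmaxPolicy ψ θ s b • fderiv ℝ (ψ s b) θ

theorem sum_exp_pos (ψ : S → A → Param d → ℝ) (θ : Param d) (s : S) :
    0 < ∑ a, Real.exp (ψ s a θ) :=
  Finset.sum_pos (fun _ _ => Real.exp_pos _) Finset.univ_nonempty

theorem softmaxPolicy_pos (ψ : S → A → Param d → ℝ) (θ : Param d) (s : S) (a : A) :
    0 < softmaxPolicy ψ θ s a :=
  div_pos (Real.exp_pos _) (sum_exp_pos ψ θ s)

theorem sum_softmaxPolicy (ψ : S → A → Param d → ℝ) (θ : Param d) (s : S) :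
    ∑ a, softmaxPolicy ψ θ s a = 1 := by
  simp only [softmaxPolicy, ← Finset.sum_div]
  exact div_self (sum_exp_pos ψ θ s).ne'

variable {ψ : S → A → Param d → ℝ} {lψ Lψ : ℝ}

theorem hasFDerivAt_log_softmaxPolicy (hψ : SoftmaxRegular ψ lψ Lψ) (θ : Param d) (s : S) (a : A) :
    HasFDerivAt (fun θ => Real.log (softmaxPolicy ψ θ s a)) (score ψ θ s a) θ := by
  have h1 : (fun θ => Real.log (softmaxPolicy ψ θ s a))
      = fun θ => ψ s a θ - Real.log (∑ b, Real.exp (ψ s b θ)) := by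
    funext θ
    rw [softmaxPolicy, Real.log_div (Real.exp_pos _).ne' (sum_exp_pos ψ θ s).ne', Real.log_exp]
  rw [h1]
  have h2 : HasFDerivAt (fun θ => ∑ b, Real.exp (ψ s b θ))
      (∑ b, Real.exp (ψ s b θ) • fderiv ℝ (ψ s b) θ) θ :=
    HasFDerivAt.fun_sum fun b _ => (hψ.hasFDerivAt θ s b).exp
  refine ((hψ.hasFDerivAt θ s a).sub (h2.log (sum_exp_pos ψ θ s).ne')).congr_fderiv ?_
  rw [score, Finset.smul_sum]
  congr 1
  refine Finset.sum_congr rfl fun b _ => ?_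
  rw [smul_smul, softmaxPolicy, div_eq_inv_mul]

theorem hasFDerivAt_softmaxPolicy (hψ : SoftmaxRegular ψ lψ Lψ) (θ : Param d) (s : S) (a : A) :
    HasFDerivAt (fun θ => softmaxPolicy ψ θ s a) (softmaxPolicy ψ θ s a • score ψ θ s a) θ := by
  have h := (hasFDerivAt_log_softmaxPolicy hψ θ s a).exp
  simpa only [Real.exp_log (softmaxPolicy_pos ψ _ s a)] using h

theorem norm_score_le (hψ : SoftmaxRegular ψ lψ Lψ) (θ : Param d) (s : S) (a : A) :
    ‖score ψ θ s a‖ ≤ 2 * lψ := by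
  refine (norm_sub_le _ _).trans ?_
  have h1 : ‖∑ b, softmaxPolicy ψ θ s b • fderiv ℝ (ψ s b) θ‖ ≤ lψ := by
    refine (norm_sum_le _ _).trans ?_
    calc ∑ b, ‖softmaxPolicy ψ θ s b • fderiv ℝ (ψ s b) θ‖
        ≤ ∑ b, softmaxPolicy ψ θ s b * lψ := by
          refine Finset.sum_le_sum fun b _ => ?_
          rw [norm_smul, Real.norm_of_nonneg (softmaxPolicy_pos ψ θ s b).le]
          exact mul_le_mul_of_nonneg_left (hψ.norm_fderiv_le θ s b) (softmaxPolicy_pos ψ θ s b).le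
      _ = lψ := by rw [← Finset.sum_mul, sum_softmaxPolicy, one_mul]
  linarith [hψ.norm_fderiv_le θ s a]

theorem sum_norm_smul_score_le (hψ : SoftmaxRegular ψ lψ Lψ) (θ : Param d) (s : S) :
    ∑ a, ‖softmaxPolicy ψ θ s a • score ψ θ s a‖ ≤ 2 * lψ := by
  calc ∑ a, ‖softmaxPolicy ψ θ s a • score ψ θ s a‖
      ≤ ∑ a, softmaxPolicy ψ θ s a * (2 * lψ) := by
        refine Finset.sum_le_sum fun a _ => ?_
        rw [norm_smul, Real.norm_of_nonneg (softmaxPolicy_pos ψ θ s a).le]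
        exact mul_le_mul_of_nonneg_left (norm_score_le hψ θ s a) (softmaxPolicy_pos ψ θ s a).le
    _ = 2 * lψ := by rw [← Finset.sum_mul, sum_softmaxPolicy, one_mul]

theorem sum_abs_softmaxPolicy_sub_le (hψ : SoftmaxRegular ψ lψ Lψ) (θ θ' : Param d) (s : S) :
    ∑ a, |softmaxPolicy ψ θ s a - softmaxPolicy ψ θ' s a| ≤ 2 * lψ * ‖θ - θ'‖ :=
  sum_abs_sub_le_of_hasFDerivAt (fun x a => hasFDerivAt_softmaxPolicy hψ x s a)
    (fun x => sum_norm_smul_score_le hψ x s) θ θ'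

/-- The own gradient and the averaged gradients each contribute `Lψ`; the change of the averaging
weights contributes `2 lψ` in `ℓ¹`, times gradients of size `lψ`. -/
theorem norm_score_sub_le (hψ : SoftmaxRegular ψ lψ Lψ) (θ θ' : Param d) (s : S) (a : A) :
    ‖score ψ θ s a - score ψ θ' s a‖ ≤ (2 * Lψ + 2 * lψ ^ 2) * ‖θ - θ'‖ := by
  have h0 : score ψ θ s a - score ψ θ' s a
      = (fderiv ℝ (ψ s a) θ - fderiv ℝ (ψ s a) θ')
        - ∑ b, ((softmaxPolicy ψ θ s b - softmaxPolicy ψ θ' s b) • fderiv ℝ (ψ s b) θ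
          + softmaxPolicy ψ θ' s b • (fderiv ℝ (ψ s b) θ - fderiv ℝ (ψ s b) θ')) := by
    have : ∀ b, (softmaxPolicy ψ θ s b - softmaxPolicy ψ θ' s b) • fderiv ℝ (ψ s b) θ
          + softmaxPolicy ψ θ' s b • (fderiv ℝ (ψ s b) θ - fderiv ℝ (ψ s b) θ')
        = softmaxPolicy ψ θ s b • fderiv ℝ (ψ s b) θ
          - softmaxPolicy ψ θ' s b • fderiv ℝ (ψ s b) θ' := fun b => by module
    simp only [this, Finset.sum_sub_distrib, score]
    abel
  have h1 : ‖∑ b, ((softmaxPolicy ψ θ s b - softmaxPolicy ψ θ' s b) • fderiv ℝ (ψ s b) θ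
          + softmaxPolicy ψ θ' s b • (fderiv ℝ (ψ s b) θ - fderiv ℝ (ψ s b) θ'))‖
      ≤ 2 * lψ * ‖θ - θ'‖ * lψ + Lψ * ‖θ - θ'‖ := by
    calc _ ≤ ∑ b, (|softmaxPolicy ψ θ s b - softmaxPolicy ψ θ' s b| * lψ
            + softmaxPolicy ψ θ' s b * (Lψ * ‖θ - θ'‖)) := by
          refine (norm_sum_le _ _).trans (Finset.sum_le_sum fun b _ => ?_)
          refine (norm_add_le _ _).trans (add_le_add ?_ ?_)
          · rw [norm_smul, Real.norm_eq_abs]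
            exact mul_le_mul_of_nonneg_left (hψ.norm_fderiv_le θ s b) (abs_nonneg _)
          · rw [norm_smul, Real.norm_of_nonneg (softmaxPolicy_pos ψ θ' s b).le]
            exact mul_le_mul_of_nonneg_left (hψ.norm_fderiv_sub_le θ θ' s b)
              (softmaxPolicy_pos ψ θ' s b).le
      _ = (∑ b, |softmaxPolicy ψ θ s b - softmaxPolicy ψ θ' s b|) * lψ + Lψ * ‖θ - θ'‖ := by
          rw [Finset.sum_add_distrib, ← Finset.sum_mul, ← Finset.sum_mul, sum_softmaxPolicy, one_mul]
      _ ≤ _ := by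
          gcongr
          · exact (norm_nonneg _).trans (hψ.norm_fderiv_le θ s a)
          · exact sum_abs_softmaxPolicy_sub_le hψ θ θ' s
  rw [h0]
  refine (norm_sub_le _ _).trans ?_
  linarith [hψ.norm_fderiv_sub_le θ θ' s a]

/-- The derivative is policy times score. Varying the policy costs `(2 lψ)²` and varying the score
`2 Lψ + 2 lψ²`, whence `κ₂ = 2 Lψ + 6 lψ²`. -/
theorem smoothPolicy_softmaxPolicy (hψ : SoftmaxRegular ψ lψ Lψ) :
    SmoothPolicy (softmaxPolicy ψ) (fun θ s a => softmaxPolicy ψ θ s a • score ψ θ s a)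
      (2 * lψ) (2 * Lψ + 6 * lψ ^ 2) where
  nonneg θ s a := (softmaxPolicy_pos ψ θ s a).le
  sum_eq_one := sum_softmaxPolicy ψ
  hasFDerivAt := hasFDerivAt_softmaxPolicy hψ
  sum_norm_le := sum_norm_smul_score_le hψ
  sum_norm_sub_le θ θ' s := by
    obtain ⟨a₀⟩ := ‹Nonempty A›
    have hl : 0 ≤ lψ := (norm_nonneg _).trans (hψ.norm_fderiv_le θ s a₀)
    calc _ ≤ ∑ a, (|softmaxPolicy ψ θ s a - softmaxPolicy ψ θ' s a| * (2 * lψ)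
            + softmaxPolicy ψ θ' s a * ((2 * Lψ + 2 * lψ ^ 2) * ‖θ - θ'‖)) := by
          refine Finset.sum_le_sum fun a _ => ?_
          have : softmaxPolicy ψ θ s a • score ψ θ s a - softmaxPolicy ψ θ' s a • score ψ θ' s a
              = (softmaxPolicy ψ θ s a - softmaxPolicy ψ θ' s a) • score ψ θ s a
                + softmaxPolicy ψ θ' s a • (score ψ θ s a - score ψ θ' s a) := by module
          rw [this]
          refine (norm_add_le _ _).trans (add_le_add ?_ ?_)
          · rw [norm_smul, Real.norm_eq_abs]
            exact mul_le_mul_of_nonneg_left (norm_score_le hψ θ s a) (abs_nonneg _)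
          · rw [norm_smul, Real.norm_of_nonneg (softmaxPolicy_pos ψ θ' s a).le]
            exact mul_le_mul_of_nonneg_left (norm_score_sub_le hψ θ θ' s a)
              (softmaxPolicy_pos ψ θ' s a).le
      _ = (∑ a, |softmaxPolicy ψ θ s a - softmaxPolicy ψ θ' s a|) * (2 * lψ)
            + (2 * Lψ + 2 * lψ ^ 2) * ‖θ - θ'‖ := by
          rw [Finset.sum_add_distrib, ← Finset.sum_mul, ← Finset.sum_mul, sum_softmaxPolicy, one_mul]
      _ ≤ 2 * lψ * ‖θ - θ'‖ * (2 * lψ) + (2 * Lψ + 2 * lψ ^ 2) * ‖θ - θ'‖ := by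
          gcongr
          exact sum_abs_softmaxPolicy_sub_le hψ θ θ' s
      _ = _ := by ring

end Softmax

/-! ### Value function and occupancy measure as functions of the parameter -/

section Value

variable {S A : Type*} [Fintype S] [Fintype A]
variable {E : Type*} [NormedAddCommGroup E] [NormedSpace ℝ E]

/-- The expected reward at time `h` when the chain starts from a given state. -/
def expReward (M : MDP S A) (pol : S → A → ℝ) (r : SAVec S A) : ℕ → S → ℝ
  | 0 => fun s => ∑ a, pol s a * r (s, a)
  | h + 1 => fun s => ∑ a, pol s a * ∑ s', M.P s a s' * expReward M pol r h s'

/-- The derivative of `expReward` in a parameter of the policy, where `pol'` is the derivative of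
the policy. -/
def expRewardDeriv (M : MDP S A) (pol : S → A → ℝ) (pol' : S → A → E →L[ℝ] ℝ) (r : SAVec S A) :
    ℕ → S → E →L[ℝ] ℝ
  | 0 => fun s => ∑ a, r (s, a) • pol' s a
  | h + 1 => fun s => ∑ a, ((∑ s', M.P s a s' * expReward M pol r h s') • pol' s a
      + pol s a • ∑ s', M.P s a s' • expRewardDeriv M pol pol' r h s')

theorem abs_apply_le_norm (r : SAVec S A) (x : S × A) : |r x| ≤ ‖r‖ :=
  PiLp.norm_apply_le r x

/-- A convex combination of vectors in a ball lies in the ball. -/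
theorem norm_sum_smul_le {ι G : Type*} [Fintype ι] [SeminormedAddCommGroup G] [NormedSpace ℝ G]
    {w : ι → ℝ} (hw : w ∈ stdSimplex ℝ ι) {f : ι → G} {C : ℝ} (hf : ∀ i, ‖f i‖ ≤ C) :
    ‖∑ i, w i • f i‖ ≤ C := by
  calc ‖∑ i, w i • f i‖ ≤ ∑ i, w i * C := by
        refine (norm_sum_le _ _).trans (Finset.sum_le_sum fun i _ => ?_)
        rw [norm_smul, Real.norm_of_nonneg (hw.1 i)]
        exact mul_le_mul_of_nonneg_left (hf i) (hw.1 i)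
    _ = C := by rw [← Finset.sum_mul, hw.2, one_mul]

theorem abs_sum_mul_le {ι : Type*} [Fintype ι] {w : ι → ℝ} (hw : w ∈ stdSimplex ℝ ι) {f : ι → ℝ}
    {C : ℝ} (hf : ∀ i, |f i| ≤ C) : |∑ i, w i * f i| ≤ C :=
  norm_sum_smul_le (G := ℝ) hw hf

theorem abs_expReward_le (M : MDP S A) {pol : S → A → ℝ} (hpol : ∀ s, pol s ∈ stdSimplex ℝ A)
    (r : SAVec S A) (h : ℕ) (s : S) : |expReward M pol r h s| ≤ ‖r‖ := by
  induction h generalizing s with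
  | zero => exact abs_sum_mul_le (hpol s) fun a => abs_apply_le_norm r (s, a)
  | succ h ih => exact abs_sum_mul_le (hpol s) fun a => abs_sum_mul_le (M.P_mem s a) ih

variable {π : E → S → A → ℝ} {π' : E → S → A → E →L[ℝ] ℝ} {κ₁ κ₂ : ℝ}

/-- The product rule in one Bellman step: differentiating the policy costs `κ₁` times the size of
the continuation, while the derivative of the continuation is only averaged. -/
theorem sum_norm_smul_add_smul_le {pol : A → ℝ} (hpol : pol ∈ stdSimplex ℝ A)
    {pol' : A → E →L[ℝ] ℝ} (h' : ∑ a, ‖pol' a‖ ≤ κ₁) {u : A → ℝ} {v : A → E →L[ℝ] ℝ} {R C : ℝ}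
    (hR : 0 ≤ R) (hu : ∀ a, |u a| ≤ R) (hv : ∀ a, ‖v a‖ ≤ C) :
    ‖∑ a, (u a • pol' a + pol a • v a)‖ ≤ κ₁ * R + C := by
  rw [Finset.sum_add_distrib]
  refine (norm_add_le _ _).trans (add_le_add ?_ (norm_sum_smul_le hpol hv))
  calc ‖∑ a, u a • pol' a‖ ≤ ∑ a, ‖pol' a‖ * R := by
        refine (norm_sum_le _ _).trans (Finset.sum_le_sum fun a _ => ?_)
        rw [norm_smul, mul_comm]
        exact mul_le_mul_of_nonneg_left (hu a) (norm_nonneg _)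
    _ ≤ κ₁ * R := by rw [← Finset.sum_mul]; exact mul_le_mul_of_nonneg_right h' hR

/-- The reward at time `h` involves `h + 1` action choices, and each Bellman step adds one term `κ₁
‖r‖`. -/
theorem norm_expRewardDeriv_le (hπ : SmoothPolicy π π' κ₁ κ₂) (M : MDP S A) (r : SAVec S A)
    (h : ℕ) (θ : E) (s : S) :
    ‖expRewardDeriv M (π θ) (π' θ) r h s‖ ≤ (h + 1) * κ₁ * ‖r‖ := by
  induction h generalizing s with
  | zero =>
    have := sum_norm_smul_add_smul_le (hπ.mem_stdSimplex θ s) (hπ.sum_norm_le θ s)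
      (norm_nonneg r) (fun a => abs_apply_le_norm r (s, a))
      (v := fun _ => 0) (C := 0) (fun a => by simp)
    simpa [expRewardDeriv] using this
  | succ h ih =>
    refine (sum_norm_smul_add_smul_le (hπ.mem_stdSimplex θ s) (hπ.sum_norm_le θ s)
      (norm_nonneg r)
      (fun a => abs_sum_mul_le (M.P_mem s a) (abs_expReward_le M (hπ.mem_stdSimplex θ) r h))
      (fun a => norm_sum_smul_le (M.P_mem s a) ih)).trans (le_of_eq ?_)
    push_cast; ring

theorem hasFDerivAt_expReward (hπ : SmoothPolicy π π' κ₁ κ₂) (M : MDP S A) (r : SAVec S A)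
    (h : ℕ) (θ : E) (s : S) :
    HasFDerivAt (fun θ => expReward M (π θ) r h s) (expRewardDeriv M (π θ) (π' θ) r h s) θ := by
  induction h generalizing s with
  | zero => exact HasFDerivAt.fun_sum fun a _ => (hπ.hasFDerivAt θ s a).mul_const _
  | succ h ih =>
    refine HasFDerivAt.fun_sum fun a _ => ?_
    refine ((hπ.hasFDerivAt θ s a).mul
      (HasFDerivAt.fun_sum fun s' _ => (ih s').const_mul (M.P s a s'))).congr_fderiv ?_
    rw [add_comm]

theorem abs_expReward_sub_le (hπ : SmoothPolicy π π' κ₁ κ₂) (M : MDP S A) (r : SAVec S A)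
    (h : ℕ) (θ θ' : E) (s : S) :
    |expReward M (π θ) r h s - expReward M (π θ') r h s| ≤ (h + 1) * κ₁ * ‖r‖ * ‖θ - θ'‖ :=
  norm_sub_le_of_hasFDerivAt (fun x => hasFDerivAt_expReward hπ M r h x s)
    (fun x => norm_expRewardDeriv_le hπ M r h x s) θ θ'

/-- Second derivatives hit pairs of action choices, hence the square. A Bellman step adds one term
`κ₂` and two cross terms `(h + 1) κ₁²`, which fit into the increment `(h + 2)² - (h + 1)²`. -/
theorem norm_expRewardDeriv_sub_le (hπ : SmoothPolicy π π' κ₁ κ₂) (hκ₂ : 0 ≤ κ₂) (M : MDP S A)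
    (r : SAVec S A) (h : ℕ) (θ θ' : E) (s : S) :
    ‖expRewardDeriv M (π θ) (π' θ) r h s - expRewardDeriv M (π θ') (π' θ') r h s‖
      ≤ (h + 1) ^ 2 * (κ₂ + κ₁ ^ 2) * ‖r‖ * ‖θ - θ'‖ := by
  have h1 : ∀ (s : S) (u : A → ℝ), (∀ a, |u a| ≤ ‖r‖) →
      ∑ a, ‖u a • (π' θ s a - π' θ' s a)‖ ≤ κ₂ * ‖r‖ * ‖θ - θ'‖ := by
    intro s u hu
    calc ∑ a, ‖u a • (π' θ s a - π' θ' s a)‖ ≤ ∑ a, ‖r‖ * ‖π' θ s a - π' θ' s a‖ := by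
          refine Finset.sum_le_sum fun a _ => ?_
          rw [norm_smul]
          exact mul_le_mul_of_nonneg_right (hu a) (norm_nonneg _)
      _ ≤ ‖r‖ * (κ₂ * ‖θ - θ'‖) := by
          rw [← Finset.mul_sum]
          exact mul_le_mul_of_nonneg_left (hπ.sum_norm_sub_le θ θ' s) (norm_nonneg r)
      _ = _ := by ring
  induction h generalizing s with
  | zero =>
    have h2 := (norm_sum_le _ _).trans
      (h1 s (fun a => r (s, a)) fun a => abs_apply_le_norm r (s, a))
    simp only [smul_sub, Finset.sum_sub_distrib] at h2
    refine h2.trans ?_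
    have : 0 ≤ κ₁ ^ 2 * ‖r‖ * ‖θ - θ'‖ := by positivity
    push_cast
    linarith
  | succ h ih =>
    set U := expReward M (π θ) r h with hU
    set U' := expReward M (π θ') r h with hU'
    set D := expRewardDeriv M (π θ) (π' θ) r h with hD
    set D' := expRewardDeriv M (π θ') (π' θ') r h with hD'
    set PU : A → ℝ := fun a => ∑ s', M.P s a s' * U s' with hPU
    set PU' : A → ℝ := fun a => ∑ s', M.P s a s' * U' s' with hPU'
    set PD : A → E →L[ℝ] ℝ := fun a => ∑ s', M.P s a s' • D s' with hPD
    set PD' : A → E →L[ℝ] ℝ := fun a => ∑ s', M.P s a s' • D' s' with hPD'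
    have e1 : expRewardDeriv M (π θ) (π' θ) r (h + 1) s
          - expRewardDeriv M (π θ') (π' θ') r (h + 1) s
        = ∑ a, (PU a • (π' θ s a - π' θ' s a)) + (∑ a, (PU a - PU' a) • π' θ' s a)
          + (∑ a, (π θ s a - π θ' s a) • PD a) + ∑ a, π θ' s a • (PD a - PD' a) := by
      simp only [← Finset.sum_add_distrib]
      change (∑ a, (PU a • π' θ s a + π θ s a • PD a))
        - (∑ a, (PU' a • π' θ' s a + π θ' s a • PD' a)) = _
      rw [← Finset.sum_sub_distrib]
      refine Finset.sum_congr rfl fun a _ => ?_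
      module
    have hδ := norm_nonneg (θ - θ')
    have b1 := (norm_sum_le _ _).trans (h1 s PU fun a => abs_sum_mul_le (M.P_mem s a)
      (abs_expReward_le M (hπ.mem_stdSimplex θ) r h))
    have hκ₁ : 0 ≤ κ₁ :=
      (Finset.sum_nonneg fun a _ => norm_nonneg (π' θ s a)).trans (hπ.sum_norm_le θ s)
    have hPUsub : ∀ a, ‖PU a - PU' a‖ ≤ (h + 1) * κ₁ * ‖r‖ * ‖θ - θ'‖ := by
      intro a
      have : PU a - PU' a = ∑ s', M.P s a s' * (U s' - U' s') := by
        simp only [hPU, hPU', mul_sub, Finset.sum_sub_distrib]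
      rw [this]
      exact abs_sum_mul_le (M.P_mem s a) (abs_expReward_sub_le hπ M r h θ θ')
    have b2 : ‖∑ a, (PU a - PU' a) • π' θ' s a‖ ≤ κ₁ * ((h + 1) * κ₁ * ‖r‖ * ‖θ - θ'‖) := by
      calc _ ≤ ∑ a, ‖π' θ' s a‖ * ((h + 1) * κ₁ * ‖r‖ * ‖θ - θ'‖) := by
            refine (norm_sum_le _ _).trans (Finset.sum_le_sum fun a _ => ?_)
            rw [norm_smul, mul_comm]
            exact mul_le_mul_of_nonneg_left (hPUsub a) (norm_nonneg _)
        _ ≤ _ := by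
            rw [← Finset.sum_mul]
            exact mul_le_mul_of_nonneg_right (hπ.sum_norm_le θ' s) (by positivity)
    have b3 : ‖∑ a, (π θ s a - π θ' s a) • PD a‖ ≤ κ₁ * ‖θ - θ'‖ * ((h + 1) * κ₁ * ‖r‖) := by
      calc _ ≤ ∑ a, |π θ s a - π θ' s a| * ((h + 1) * κ₁ * ‖r‖) := by
            refine (norm_sum_le _ _).trans (Finset.sum_le_sum fun a _ => ?_)
            rw [norm_smul, Real.norm_eq_abs]
            exact mul_le_mul_of_nonneg_left
              (norm_sum_smul_le (M.P_mem s a) (norm_expRewardDeriv_le hπ M r h θ)) (abs_nonneg _)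
        _ ≤ _ := by
            rw [← Finset.sum_mul]
            exact mul_le_mul_of_nonneg_right (hπ.sum_abs_sub_le θ θ' s) (by positivity)
    have b4 : ‖∑ a, π θ' s a • (PD a - PD' a)‖
        ≤ (h + 1) ^ 2 * (κ₂ + κ₁ ^ 2) * ‖r‖ * ‖θ - θ'‖ := by
      refine norm_sum_smul_le (hπ.mem_stdSimplex θ' s) fun a => ?_
      have : PD a - PD' a = ∑ s', M.P s a s' • (D s' - D' s') := by
        simp only [hPD, hPD', smul_sub, Finset.sum_sub_distrib]
      rw [this]
      exact norm_sum_smul_le (M.P_mem s a) ih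
    rw [e1]
    refine (norm_add_le _ _).trans ((add_le_add ((norm_add_le _ _).trans
      (add_le_add ((norm_add_le _ _).trans (add_le_add b1 b2)) b3)) b4).trans ?_)
    have hr := norm_nonneg r
    -- The exact slack between the claimed bound and the sum of the four estimates.
    have p1 : 0 ≤ (2 * (h + 1) * κ₂ + κ₁ ^ 2) * ‖r‖ * ‖θ - θ'‖ := by positivity
    push_cast
    linarith

/-- The expected reward at time `h` is also the pairing of the state distribution at time `h` with
the expected immediate reward. -/
theorem sum_mul_expReward (M : MDP S A) (pol : S → A → ℝ) (r : SAVec S A) (h k : ℕ) :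
    ∑ s, M.ρ s * expReward M pol r (h + k) s
      = ∑ s, stateDist M pol h s * expReward M pol r k s := by
  induction h generalizing k with
  | zero => simp [stateDist]
  | succ h ih =>
    rw [add_assoc, add_comm 1 k, ih]
    simp only [expReward, stateDist, Finset.mul_sum, Finset.sum_mul]
    conv_rhs => rw [Finset.sum_comm]
    refine Finset.sum_congr rfl fun s _ => ?_
    rw [Finset.sum_comm]
    refine Finset.sum_congr rfl fun s' _ => Finset.sum_congr rfl fun a _ => ?_
    ring

theorem stateDist_mem_stdSimplex (M : MDP S A) {pol : S → A → ℝ}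
    (hpol : ∀ s, pol s ∈ stdSimplex ℝ A) (t : ℕ) : stateDist M pol t ∈ stdSimplex ℝ S := by
  induction t with
  | zero => exact M.ρ_mem
  | succ t ih =>
    refine ⟨fun s' => Finset.sum_nonneg fun s _ => Finset.sum_nonneg fun a _ =>
      mul_nonneg (mul_nonneg (ih.1 s) ((hpol s).1 a)) ((M.P_mem s a).1 s'), ?_⟩
    simp only [stateDist]
    rw [Finset.sum_comm]
    have : ∀ s, ∑ s', ∑ a, stateDist M pol t s * pol s a * M.P s a s' = stateDist M pol t s := by
      intro s
      rw [Finset.sum_comm]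
      simp only [← Finset.mul_sum, (M.P_mem s _).2, mul_one, (hpol s).2]
    simp only [this, ih.2]

variable {γ : ℝ}

theorem summable_pow_mul_of_abs_le (hγ0 : 0 ≤ γ) (hγ1 : γ < 1) {f : ℕ → ℝ} {C : ℝ}
    (hf : ∀ t, |f t| ≤ C) : Summable fun t => γ ^ t * f t := by
  refine Summable.of_norm_bounded ((summable_geometric_of_lt_one hγ0 hγ1).mul_right C) fun t => ?_
  rw [norm_mul, Real.norm_of_nonneg (pow_nonneg hγ0 t)]
  exact mul_le_mul_of_nonneg_left (hf t) (pow_nonneg hγ0 t)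

theorem abs_le_one_of_mem_stdSimplex {ι : Type*} [Fintype ι] {w : ι → ℝ}
    (hw : w ∈ stdSimplex ℝ ι) (i : ι) : |w i| ≤ 1 := by
  rw [abs_of_nonneg (hw.1 i), ← hw.2]
  exact Finset.single_le_sum (fun j _ => hw.1 j) (Finset.mem_univ i)

theorem summable_stateDist (hγ0 : 0 ≤ γ) (hγ1 : γ < 1) (M : MDP S A) {pol : S → A → ℝ}
    (hpol : ∀ s, pol s ∈ stdSimplex ℝ A) (s : S) :
    Summable fun t => γ ^ t * stateDist M pol t s :=
  summable_pow_mul_of_abs_le hγ0 hγ1 fun t =>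
    abs_le_one_of_mem_stdSimplex (stateDist_mem_stdSimplex M hpol t) s

theorem stateOcc_mem_stdSimplex (hγ0 : 0 ≤ γ) (hγ1 : γ < 1) (M : MDP S A) {pol : S → A → ℝ}
    (hpol : ∀ s, pol s ∈ stdSimplex ℝ A) : stateOcc M γ pol ∈ stdSimplex ℝ S := by
  refine ⟨fun s => mul_nonneg (by linarith) (tsum_nonneg fun t =>
    mul_nonneg (pow_nonneg hγ0 t) ((stateDist_mem_stdSimplex M hpol t).1 s)), ?_⟩
  simp only [stateOcc]
  rw [← Finset.mul_sum, ← Summable.tsum_finsetSum fun s _ => summable_stateDist hγ0 hγ1 M hpol s]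
  simp only [← Finset.mul_sum, (stateDist_mem_stdSimplex M hpol _).2, mul_one]
  rw [tsum_geometric_of_lt_one hγ0 hγ1, mul_inv_cancel₀ (by linarith)]

/-- The expected discounted cumulative reward. -/
def value (M : MDP S A) (γ : ℝ) (pol : S → A → ℝ) (r : SAVec S A) : ℝ :=
  ∑' h : ℕ, γ ^ h * ∑ s, M.ρ s * expReward M pol r h s

/-- The expected discounted cumulative reward is linear in the occupancy measure. -/
theorem inner_occ (hγ0 : 0 ≤ γ) (hγ1 : γ < 1) (M : MDP S A) {pol : S → A → ℝ}
    (hpol : ∀ s, pol s ∈ stdSimplex ℝ A) (r : SAVec S A) :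
    inner ℝ r (occ M γ pol) = (1 - γ) * value M γ pol r := by
  have h1 : ∀ h, γ ^ h * ∑ s, M.ρ s * expReward M pol r h s
      = ∑ s, γ ^ h * stateDist M pol h s * expReward M pol r 0 s := by
    intro h
    have := sum_mul_expReward M pol r h 0
    rw [add_zero] at this
    rw [this, Finset.mul_sum]
    exact Finset.sum_congr rfl fun s _ => by ring
  simp only [value, h1]
  rw [Summable.tsum_finsetSum fun s _ => (summable_stateDist hγ0 hγ1 M hpol s).mul_right _]
  simp only [tsum_mul_right]
  rw [PiLp.inner_apply, Fintype.sum_prod_type, Finset.mul_sum]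
  refine Finset.sum_congr rfl fun s _ => ?_
  simp only [occ, joint, stateOcc, expReward, Finset.mul_sum, RCLike.inner_apply, conj_trivial]
  exact Finset.sum_congr rfl fun a _ => by ring

/-- The sum `∑ (h + 1)² γ^h`. -/
def quadGeom (γ : ℝ) : ℝ := ∑' h : ℕ, ((h : ℝ) + 1) ^ 2 * γ ^ h

theorem summable_quadGeom (hγ0 : 0 ≤ γ) (hγ1 : γ < 1) :
    Summable fun h : ℕ => ((h : ℝ) + 1) ^ 2 * γ ^ h := by
  have h0 : ∀ k : ℕ, Summable fun h : ℕ => (h : ℝ) ^ k * γ ^ h := fun k =>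
    summable_pow_mul_geometric_of_norm_lt_one k (by rwa [Real.norm_of_nonneg hγ0])
  refine (((h0 2).add ((h0 1).mul_left 2)).add (h0 0)).congr fun h => by ring

theorem quadGeom_nonneg (hγ0 : 0 ≤ γ) : 0 ≤ quadGeom γ :=
  tsum_nonneg fun h => by positivity

/-- The derivative of `value` in a parameter of the policy. -/
def valueDeriv (M : MDP S A) (γ : ℝ) (pol : S → A → ℝ) (pol' : S → A → E →L[ℝ] ℝ)
    (r : SAVec S A) : E →L[ℝ] ℝ :=
  ∑' h : ℕ, γ ^ h • ∑ s, M.ρ s • expRewardDeriv M pol pol' r h s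

/-- The factor `h + 1` is weakened to its square so that `quadGeom` controls first and second order
terms alike. -/
theorem norm_valueDeriv_term_le (hγ0 : 0 ≤ γ) (hπ : SmoothPolicy π π' κ₁ κ₂) (M : MDP S A)
    (r : SAVec S A) (h : ℕ) (θ : E) :
    ‖γ ^ h • ∑ s, M.ρ s • expRewardDeriv M (π θ) (π' θ) r h s‖
      ≤ ((h : ℝ) + 1) ^ 2 * γ ^ h * (κ₁ * ‖r‖) := by
  rw [norm_smul, Real.norm_of_nonneg (pow_nonneg hγ0 h)]
  have h1 := norm_sum_smul_le M.ρ_mem (norm_expRewardDeriv_le hπ M r h θ)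
  have h2 : 0 ≤ κ₁ * ‖r‖ := by
    have := (norm_nonneg _).trans (norm_sum_smul_le M.ρ_mem (norm_expRewardDeriv_le hπ M r 0 θ))
    simpa using this
  have h3 : ((h : ℝ) + 1) * (κ₁ * ‖r‖) ≤ ((h : ℝ) + 1) ^ 2 * (κ₁ * ‖r‖) := by
    have : (0 : ℝ) ≤ h := Nat.cast_nonneg h
    gcongr
    nlinarith
  calc _ ≤ γ ^ h * (((h : ℝ) + 1) ^ 2 * (κ₁ * ‖r‖)) := by
        refine mul_le_mul_of_nonneg_left (h1.trans ?_) (pow_nonneg hγ0 h)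
        linarith
    _ = _ := by ring

theorem summable_valueDeriv_term (hγ0 : 0 ≤ γ) (hγ1 : γ < 1) (hπ : SmoothPolicy π π' κ₁ κ₂)
    (M : MDP S A) (r : SAVec S A) (θ : E) :
    Summable fun h => γ ^ h • ∑ s, M.ρ s • expRewardDeriv M (π θ) (π' θ) r h s :=
  Summable.of_norm_bounded ((summable_quadGeom hγ0 hγ1).mul_right _)
    (norm_valueDeriv_term_le hγ0 hπ M r · θ)

theorem hasFDerivAt_value (hγ0 : 0 ≤ γ) (hγ1 : γ < 1) (hπ : SmoothPolicy π π' κ₁ κ₂)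
    (M : MDP S A) (r : SAVec S A) (θ : E) :
    HasFDerivAt (fun θ => value M γ (π θ) r) (valueDeriv M γ (π θ) (π' θ) r) θ := by
  refine hasFDerivAt_tsum (u := fun h : ℕ => ((h : ℝ) + 1) ^ 2 * γ ^ h * (κ₁ * ‖r‖))
    ((summable_quadGeom hγ0 hγ1).mul_right _) (fun h θ => ?_)
    (norm_valueDeriv_term_le hγ0 hπ M r) (x₀ := θ) ?_ θ
  · exact (HasFDerivAt.fun_sum fun s _ =>
      (hasFDerivAt_expReward hπ M r h θ s).const_mul (M.ρ s)).const_mul (γ ^ h)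
  · exact summable_pow_mul_of_abs_le hγ0 hγ1 fun h =>
      abs_sum_mul_le M.ρ_mem (abs_expReward_le M (hπ.mem_stdSimplex θ) r h)

theorem norm_valueDeriv_le (hγ0 : 0 ≤ γ) (hγ1 : γ < 1) (hπ : SmoothPolicy π π' κ₁ κ₂)
    (M : MDP S A) (r : SAVec S A) (θ : E) :
    ‖valueDeriv M γ (π θ) (π' θ) r‖ ≤ quadGeom γ * κ₁ * ‖r‖ := by
  refine (tsum_of_norm_bounded ((summable_quadGeom hγ0 hγ1).hasSum.mul_right _)
    (norm_valueDeriv_term_le hγ0 hπ M r · θ)).trans (le_of_eq ?_)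
  rw [quadGeom]; ring

theorem norm_valueDeriv_sub_le (hγ0 : 0 ≤ γ) (hγ1 : γ < 1) (hπ : SmoothPolicy π π' κ₁ κ₂)
    (hκ₂ : 0 ≤ κ₂) (M : MDP S A) (r : SAVec S A) (θ θ' : E) :
    ‖valueDeriv M γ (π θ) (π' θ) r - valueDeriv M γ (π θ') (π' θ') r‖
      ≤ quadGeom γ * (κ₂ + κ₁ ^ 2) * ‖r‖ * ‖θ - θ'‖ := by
  rw [valueDeriv, valueDeriv, ← (summable_valueDeriv_term hγ0 hγ1 hπ M r θ).tsum_sub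
    (summable_valueDeriv_term hγ0 hγ1 hπ M r θ')]
  refine (tsum_of_norm_bounded ((summable_quadGeom hγ0 hγ1).hasSum.mul_right
    ((κ₂ + κ₁ ^ 2) * ‖r‖ * ‖θ - θ'‖)) fun h => ?_).trans (le_of_eq ?_)
  · have e : γ ^ h • ∑ s, M.ρ s • expRewardDeriv M (π θ) (π' θ) r h s
          - γ ^ h • ∑ s, M.ρ s • expRewardDeriv M (π θ') (π' θ') r h s
        = γ ^ h • ∑ s, M.ρ s • (expRewardDeriv M (π θ) (π' θ) r h s
          - expRewardDeriv M (π θ') (π' θ') r h s) := by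
      simp only [smul_sub, Finset.sum_sub_distrib]
    rw [e, norm_smul, Real.norm_of_nonneg (pow_nonneg hγ0 h)]
    refine (mul_le_mul_of_nonneg_left (norm_sum_smul_le M.ρ_mem
      (norm_expRewardDeriv_sub_le hπ hκ₂ M r h θ θ')) (pow_nonneg hγ0 h)).trans (le_of_eq ?_)
    ring
  · rw [quadGeom]; ring

/-- The truncation error of the derivative of the value. -/
theorem norm_valueDeriv_sub_sum_le {β : ℝ} (hβ0 : 0 ≤ β) (hβ1 : β < 1)
    (hπ : SmoothPolicy π π' κ₁ κ₂) (M : MDP S A) (r : SAVec S A) (θ : E) (H : ℕ) :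
    ‖valueDeriv M (β ^ 2) (π θ) (π' θ) r
        - ∑ h ∈ Finset.range H, (β ^ 2) ^ h • ∑ s, M.ρ s • expRewardDeriv M (π θ) (π' θ) r h s‖
      ≤ β ^ H * (quadGeom β * κ₁ * ‖r‖) := by
  have hγ0 : 0 ≤ β ^ 2 := by positivity
  have hγ1 : β ^ 2 < 1 := pow_lt_one₀ hβ0 hβ1 two_ne_zero
  have hs := summable_valueDeriv_term hγ0 hγ1 hπ M r θ
  rw [valueDeriv, ← hs.sum_add_tsum_nat_add H, add_sub_cancel_left]
  have h2 : 0 ≤ κ₁ * ‖r‖ := by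
    have := (norm_nonneg _).trans (norm_sum_smul_le M.ρ_mem (norm_expRewardDeriv_le hπ M r 0 θ))
    simpa using this
  have hq := (summable_nat_add_iff H).2 (summable_quadGeom hβ0 hβ1)
  have hle : ∑' h : ℕ, (((h + H : ℕ) : ℝ) + 1) ^ 2 * β ^ (h + H) ≤ quadGeom β := by
    rw [quadGeom, ← (summable_quadGeom hβ0 hβ1).sum_add_tsum_nat_add H]
    exact le_add_of_nonneg_left (Finset.sum_nonneg fun h _ => by positivity)
  refine (tsum_of_norm_bounded (hq.hasSum.mul_right (β ^ H * (κ₁ * ‖r‖))) fun h => ?_).trans ?_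
  · refine (norm_valueDeriv_term_le hγ0 hπ M r (h + H) θ).trans ?_
    -- The discount is split in two halves: one factor `β` keeps the tail series summable, the other
    -- yields the decay `β ^ H`.
    have h3 : (β ^ 2) ^ (h + H) ≤ β ^ (h + H) * β ^ H := by
      rw [← pow_mul, ← pow_add]
      exact pow_le_pow_of_le_one hβ0 hβ1.le (by omega)
    calc _ ≤ (((h + H : ℕ) : ℝ) + 1) ^ 2 * (β ^ (h + H) * β ^ H) * (κ₁ * ‖r‖) := by gcongr
      _ = _ := by ring
  · calc _ ≤ quadGeom β * (β ^ H * (κ₁ * ‖r‖)) := by gcongr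
      _ = _ := by ring

/-- Each coordinate of the occupancy measure is, up to `1 - γ`, the value for an indicator reward.
-/
theorem differentiable_occ (hγ0 : 0 ≤ γ) (hγ1 : γ < 1) (hπ : SmoothPolicy π π' κ₁ κ₂)
    (M : MDP S A) : Differentiable ℝ fun θ => occ M γ (π θ) := by
  classical
  rw [differentiable_euclidean]
  intro x
  have h1 : (fun θ => occ M γ (π θ) x)
      = fun θ => (1 - γ) * value M γ (π θ) (EuclideanSpace.single x 1) := by
    funext θ
    rw [← inner_occ hγ0 hγ1 M (hπ.mem_stdSimplex θ), EuclideanSpace.inner_single_left]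
    simp
  rw [h1]
  exact fun θ => ((hasFDerivAt_value hγ0 hγ1 hπ M _ θ).const_mul _).differentiableAt

/-- This carries bounds from scalar values to the vector `λ`: testing against all rewards `r`
recovers the Euclidean norm without summing over coordinates. -/
theorem inner_fderiv_occ (hγ0 : 0 ≤ γ) (hγ1 : γ < 1) (hπ : SmoothPolicy π π' κ₁ κ₂)
    (M : MDP S A) (r : SAVec S A) (θ v : E) :
    inner ℝ r (fderiv ℝ (fun θ => occ M γ (π θ)) θ v)
      = (1 - γ) * valueDeriv M γ (π θ) (π' θ) r v := by
  have h1 := ((innerSL ℝ r).hasFDerivAt).comp θ (differentiable_occ hγ0 hγ1 hπ M θ).hasFDerivAt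
  have h2 := (hasFDerivAt_value hγ0 hγ1 hπ M r θ).const_mul (1 - γ)
  have h3 : (innerSL ℝ r ∘ fun θ => occ M γ (π θ)) = fun θ => (1 - γ) * value M γ (π θ) r := by
    funext θ
    exact inner_occ hγ0 hγ1 M (hπ.mem_stdSimplex θ) r
  rw [h3] at h1
  simpa using DFunLike.congr_fun (h1.unique h2) v

theorem norm_le_of_forall_inner_le {G : Type*} [NormedAddCommGroup G] [InnerProductSpace ℝ G]
    {v : G} {C : ℝ} (hC : 0 ≤ C) (h : ∀ r : G, inner ℝ r v ≤ C * ‖r‖) : ‖v‖ ≤ C := by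
  rcases (norm_nonneg v).eq_or_lt with h0 | h0
  · rwa [← h0]
  · have := h v
    rw [real_inner_self_eq_norm_sq, sq] at this
    exact le_of_mul_le_mul_right this h0

theorem norm_fderiv_occ_le (hγ0 : 0 ≤ γ) (hγ1 : γ < 1) (hπ : SmoothPolicy π π' κ₁ κ₂)
    (hκ₁ : 0 ≤ κ₁) (M : MDP S A) (θ : E) :
    ‖fderiv ℝ (fun θ => occ M γ (π θ)) θ‖ ≤ quadGeom γ * κ₁ := by
  have hq := quadGeom_nonneg hγ0
  refine ContinuousLinearMap.opNorm_le_bound _ (by positivity) fun v =>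
    norm_le_of_forall_inner_le (by positivity) fun r => ?_
  rw [inner_fderiv_occ hγ0 hγ1 hπ]
  have h1 := (le_abs_self _).trans ((valueDeriv M γ (π θ) (π' θ) r).le_of_opNorm_le
    (norm_valueDeriv_le hγ0 hγ1 hπ M r θ) v)
  calc _ ≤ (1 - γ) * (quadGeom γ * κ₁ * ‖r‖ * ‖v‖) :=
        mul_le_mul_of_nonneg_left h1 (by linarith)
    _ ≤ 1 * (quadGeom γ * κ₁ * ‖r‖ * ‖v‖) :=
        mul_le_mul_of_nonneg_right (by linarith) (by positivity)
    _ = _ := by ring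

theorem norm_fderiv_occ_sub_le (hγ0 : 0 ≤ γ) (hγ1 : γ < 1) (hπ : SmoothPolicy π π' κ₁ κ₂)
    (hκ₂ : 0 ≤ κ₂) (M : MDP S A) (θ θ' : E) :
    ‖fderiv ℝ (fun θ => occ M γ (π θ)) θ - fderiv ℝ (fun θ => occ M γ (π θ)) θ'‖
      ≤ quadGeom γ * (κ₂ + κ₁ ^ 2) * ‖θ - θ'‖ := by
  have hq := quadGeom_nonneg hγ0
  refine ContinuousLinearMap.opNorm_le_bound _ (by positivity) fun v =>
    norm_le_of_forall_inner_le (by positivity) fun r => ?_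
  rw [sub_apply, inner_sub_right, inner_fderiv_occ hγ0 hγ1 hπ,
    inner_fderiv_occ hγ0 hγ1 hπ, ← mul_sub, ← sub_apply]
  have h1 := (le_abs_self _).trans
    ((valueDeriv M γ (π θ) (π' θ) r - valueDeriv M γ (π θ') (π' θ') r).le_of_opNorm_le
    (norm_valueDeriv_sub_le hγ0 hγ1 hπ hκ₂ M r θ θ') v)
  calc _ ≤ (1 - γ) * (quadGeom γ * (κ₂ + κ₁ ^ 2) * ‖r‖ * ‖θ - θ'‖ * ‖v‖) :=
        mul_le_mul_of_nonneg_left h1 (by linarith)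
    _ ≤ 1 * (quadGeom γ * (κ₂ + κ₁ ^ 2) * ‖r‖ * ‖θ - θ'‖ * ‖v‖) :=
        mul_le_mul_of_nonneg_right (by linarith) (by positivity)
    _ = _ := by ring

end Value

/-! ### Finite trajectories and the policy gradient identity -/

section Trajectories

/-- Summation over tuples, first component first. -/
theorem sum_tuple_succ {X G : Type*} [Fintype X] [AddCommMonoid G] {n : ℕ}
    (f : (Fin (n + 1) → X) → G) :
    ∑ τ, f τ = ∑ x, ∑ τ : Fin n → X, f (Fin.cons x τ) := by
  rw [← (Fin.consEquiv fun _ => X).sum_comp, Fintype.sum_prod_type]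
  rfl

section Returns

variable {S A : Type*}

/-- The discounted return of a trajectory. -/
def discReturn (γ : ℝ) (r : SAVec S A) {H : ℕ} (τ : Fin H → S × A) : ℝ :=
  ∑ h : Fin H, γ ^ (h : ℕ) * r (τ h)

/-- The rewards-to-go, weighted by the scores `w`. -/
def rewardToGo {G : Type*} [AddCommGroup G] [Module ℝ G] (γ : ℝ) (w : S × A → G) (r : SAVec S A)
    {H : ℕ} (τ : Fin H → S × A) : G :=
  ∑ t : Fin H, (∑ h ∈ Finset.Ici t, γ ^ (h : ℕ) * r (τ h)) • w (τ t)

theorem discReturn_cons (γ : ℝ) (r : SAVec S A) {H : ℕ} (x : S × A) (τ : Fin H → S × A) :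
    discReturn γ r (Fin.cons x τ : Fin (H + 1) → S × A) = r x + γ * discReturn γ r τ := by
  rw [discReturn, Fin.sum_univ_succ, discReturn, Finset.mul_sum]
  congr 1
  · simp
  · refine Finset.sum_congr rfl fun h _ => ?_
    simp only [Fin.cons_succ, Fin.val_succ]
    ring

/-- Because the weights `γ ^ h` use absolute time, removing the first pair leaves a common factor
`γ` on the tail. -/
theorem rewardToGo_cons {G : Type*} [AddCommGroup G] [Module ℝ G] (γ : ℝ) (w : S × A → G)
    (r : SAVec S A) {H : ℕ} (x : S × A) (τ : Fin H → S × A) :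
    rewardToGo γ w r (Fin.cons x τ : Fin (H + 1) → S × A)
      = (r x + γ * discReturn γ r τ) • w x + γ • rewardToGo γ w r τ := by
  rw [rewardToGo, Fin.sum_univ_succ, ← discReturn_cons, rewardToGo, Finset.smul_sum]
  congr 1
  · rw [← bot_eq_zero, Finset.Ici_bot, discReturn]
    rfl
  · refine Finset.sum_congr rfl fun t _ => ?_
    rw [← Fin.map_succEmb_Ici, Finset.sum_map, smul_smul, Finset.mul_sum]
    simp only [Fin.coe_succEmb, Fin.cons_succ, Fin.val_succ]
    congr 1
    exact Finset.sum_congr rfl fun h _ => by ring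

end Returns

variable {S A : Type*} [Fintype S]

/-- The same transition kernel, started from the successor distribution of `x`. -/
def MDP.restart (M : MDP S A) (x : S × A) : MDP S A where
  P := M.P
  ρ := M.P x.1 x.2
  P_mem := M.P_mem
  ρ_mem := M.P_mem x.1 x.2

/-- The tail is again a trajectory of the same kernel, only with another initial law; this is why
the inductions on `H` below generalize over the MDP. -/
theorem trajProb_cons (M : MDP S A) (pol : S → A → ℝ) {H : ℕ} (x : S × A) (τ : Fin H → S × A) :
    trajProb M pol (Fin.cons x τ : Fin (H + 1) → S × A)
      = M.ρ x.1 * pol x.1 x.2 * trajProb (M.restart x) pol τ := by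
  rw [trajProb, Fin.prod_univ_succ]
  congr 1
  refine Finset.prod_congr rfl fun i _ => ?_
  obtain ⟨i, hi⟩ := i
  rcases i with _ | i
  · simp [MDP.restart]
    rfl
  · simp only [Fin.cons_succ, MDP.restart]
    rfl

variable [Fintype A]

theorem trajProb_nonneg (M : MDP S A) {pol : S → A → ℝ} (hpol : ∀ s, pol s ∈ stdSimplex ℝ A)
    {H : ℕ} (τ : Fin H → S × A) : 0 ≤ trajProb M pol τ := by
  refine Finset.prod_nonneg fun h _ => mul_nonneg ?_ ((hpol _).1 _)
  split_ifs
  · exact M.ρ_mem.1 _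
  · exact (M.P_mem _ _).1 _

theorem sum_mul_pol (M : MDP S A) {pol : S → A → ℝ} (hpol : ∀ s, pol s ∈ stdSimplex ℝ A) :
    ∑ x : S × A, M.ρ x.1 * pol x.1 x.2 = 1 := by
  rw [Fintype.sum_prod_type]
  simp only [← Finset.mul_sum, (hpol _).2, mul_one, M.ρ_mem.2]

theorem sum_trajProb (M : MDP S A) {pol : S → A → ℝ} (hpol : ∀ s, pol s ∈ stdSimplex ℝ A)
    (H : ℕ) : ∑ τ : Fin H → S × A, trajProb M pol τ = 1 := by
  induction H generalizing M with
  | zero => simp [trajProb]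
  | succ H ih =>
    rw [sum_tuple_succ]
    simp only [trajProb_cons, ← Finset.mul_sum, ih, mul_one, sum_mul_pol M hpol]

theorem abs_discReturn_le {γ : ℝ} (hγ0 : 0 ≤ γ) (hγ1 : γ < 1) (r : SAVec S A) {H : ℕ}
    (τ : Fin H → S × A) : |discReturn γ r τ| ≤ ‖r‖ * (1 - γ)⁻¹ := by
  have hq : γ * (1 - γ)⁻¹ = (1 - γ)⁻¹ - 1 := by
    have : 1 - γ ≠ 0 := by linarith
    field_simp; ring
  have hq0 : 0 ≤ (1 - γ)⁻¹ := inv_nonneg.2 (by linarith)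
  induction H with
  | zero => simpa [discReturn] using by positivity
  | succ H ih =>
    rw [← Fin.cons_self_tail τ, discReturn_cons]
    calc _ ≤ |r (τ 0)| + γ * |discReturn γ r (Fin.tail τ)| := by
          refine (abs_add_le _ _).trans_eq ?_
          rw [abs_mul, abs_of_nonneg hγ0]
      _ ≤ ‖r‖ + γ * (‖r‖ * (1 - γ)⁻¹) := by
          gcongr
          · exact abs_apply_le_norm r _
          · exact ih _
      _ = _ := by linear_combination ‖r‖ * hq

/-- The bound is the fixed point of `b = C ‖r‖ / (1 - γ) + γ b`, obtained by peeling off the first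
pair; it is therefore uniform in the horizon. -/
theorem norm_rewardToGo_le {G : Type*} [NormedAddCommGroup G] [NormedSpace ℝ G] {γ : ℝ}
    (hγ0 : 0 ≤ γ) (hγ1 : γ < 1) {w : S × A → G} {C : ℝ} (hC : 0 ≤ C) (hw : ∀ x, ‖w x‖ ≤ C)
    (r : SAVec S A) {H : ℕ} (τ : Fin H → S × A) :
    ‖rewardToGo γ w r τ‖ ≤ C * (1 - γ)⁻¹ ^ 2 * ‖r‖ := by
  have hq : γ * (1 - γ)⁻¹ = (1 - γ)⁻¹ - 1 := by
    have : 1 - γ ≠ 0 := by linarith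
    field_simp; ring
  have hq0 : 0 ≤ (1 - γ)⁻¹ := inv_nonneg.2 (by linarith)
  induction H with
  | zero => simpa [rewardToGo] using by positivity
  | succ H ih =>
    rw [← Fin.cons_self_tail τ, rewardToGo_cons, ← discReturn_cons]
    calc _ ≤ ‖r‖ * (1 - γ)⁻¹ * C + γ * (C * (1 - γ)⁻¹ ^ 2 * ‖r‖) := by
          refine (norm_add_le _ _).trans (add_le_add ?_ ?_)
          · rw [norm_smul, Real.norm_eq_abs]
            exact mul_le_mul (abs_discReturn_le hγ0 hγ1 r _) (hw _) (norm_nonneg _) (by positivity)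
          · rw [norm_smul, Real.norm_of_nonneg hγ0]
            exact mul_le_mul_of_nonneg_left (ih _) hγ0
      _ = _ := by linear_combination (‖r‖ * C * (1 - γ)⁻¹) * hq

theorem expReward_restart (M : MDP S A) (x : S × A) (pol : S → A → ℝ) (r : SAVec S A) (h : ℕ) :
    expReward (M.restart x) pol r h = expReward M pol r h := by
  induction h with
  | zero => rfl
  | succ h ih => simp only [expReward, ih]; rfl

theorem sum_expReward_succ (M : MDP S A) (γ : ℝ) (pol : S → A → ℝ) (r : SAVec S A) (H : ℕ)
    (s : S) : ∑ h ∈ Finset.range (H + 1), γ ^ h * expReward M pol r h s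
      = ∑ a, pol s a * (r (s, a)
        + γ * ∑ s', M.P s a s' * ∑ h ∈ Finset.range H, γ ^ h * expReward M pol r h s') := by
  rw [Finset.sum_range_succ']
  simp only [mul_add, Finset.sum_add_distrib]
  rw [add_comm]
  congr 1
  · simp [expReward]
  · simp only [expReward, Finset.mul_sum]
    rw [Finset.sum_comm]
    refine Finset.sum_congr rfl fun a _ => ?_
    rw [Finset.sum_comm]
    exact Finset.sum_congr rfl fun s' _ => Finset.sum_congr rfl fun h _ => by ring

theorem sum_trajProb_mul_discReturn (M : MDP S A) {pol : S → A → ℝ}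
    (hpol : ∀ s, pol s ∈ stdSimplex ℝ A) (γ : ℝ) (r : SAVec S A) (H : ℕ) :
    ∑ τ : Fin H → S × A, trajProb M pol τ * discReturn γ r τ
      = ∑ s, M.ρ s * ∑ h ∈ Finset.range H, γ ^ h * expReward M pol r h s := by
  induction H generalizing M with
  | zero => simp [discReturn]
  | succ H ih =>
    rw [sum_tuple_succ, Fintype.sum_prod_type]
    refine Finset.sum_congr rfl fun s _ => ?_
    rw [sum_expReward_succ, Finset.mul_sum]
    refine Finset.sum_congr rfl fun a _ => ?_
    have h1 := ih (M.restart (s, a))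
    have h2 := sum_trajProb (M.restart (s, a)) hpol H
    simp only [expReward_restart] at h1
    calc _ = M.ρ s * pol s a * (r (s, a) * (∑ τ : Fin H → S × A, trajProb (M.restart (s, a)) pol τ)
          + γ * ∑ τ : Fin H → S × A, trajProb (M.restart (s, a)) pol τ * discReturn γ r τ) := by
          rw [Finset.mul_sum, Finset.mul_sum, ← Finset.sum_add_distrib, Finset.mul_sum]
          refine Finset.sum_congr rfl fun τ _ => ?_
          rw [trajProb_cons, discReturn_cons]
          ring
      _ = _ := by
          rw [h1, h2, mul_one, mul_assoc]
          rfl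

variable {E : Type*} [NormedAddCommGroup E] [NormedSpace ℝ E]

theorem expRewardDeriv_restart (M : MDP S A) (x : S × A) (pol : S → A → ℝ)
    (pol' : S → A → E →L[ℝ] ℝ) (r : SAVec S A) (h : ℕ) :
    expRewardDeriv (M.restart x) pol pol' r h = expRewardDeriv M pol pol' r h := by
  induction h with
  | zero => rfl
  | succ h ih => simp only [expRewardDeriv, ih, expReward_restart]; rfl

/-- The derivative of the truncated Bellman equation, arranged to match the recursion of
`rewardToGo_cons`. -/
theorem sum_expRewardDeriv_succ (M : MDP S A) (γ : ℝ) (pol : S → A → ℝ)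
    (pol' : S → A → E →L[ℝ] ℝ) (r : SAVec S A) (H : ℕ) (s : S) :
    ∑ h ∈ Finset.range (H + 1), γ ^ h • expRewardDeriv M pol pol' r h s
      = ∑ a, ((r (s, a) + γ * ∑ s', M.P s a s' * ∑ h ∈ Finset.range H, γ ^ h * expReward M pol r h s')
          • pol' s a + pol s a • γ • ∑ s', M.P s a s' •
            ∑ h ∈ Finset.range H, γ ^ h • expRewardDeriv M pol pol' r h s') := by
  rw [Finset.sum_range_succ']
  simp only [add_smul, Finset.sum_add_distrib]
  rw [add_comm, add_assoc]
  congr 1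
  · simp [expRewardDeriv]
  · simp only [expRewardDeriv, Finset.mul_sum, Finset.smul_sum, smul_add, Finset.sum_smul,
      Finset.sum_add_distrib, smul_smul]
    congr 1
    · rw [Finset.sum_comm]
      refine Finset.sum_congr rfl fun a _ => ?_
      rw [Finset.sum_comm]
      exact Finset.sum_congr rfl fun s' _ => Finset.sum_congr rfl fun h _ => by
        congr 1; ring
    · rw [Finset.sum_comm]
      refine Finset.sum_congr rfl fun a _ => ?_
      rw [Finset.sum_comm]
      exact Finset.sum_congr rfl fun s' _ => Finset.sum_congr rfl fun h _ => by
        congr 1; ring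

/-- The policy gradient theorem for a finite horizon: the score-weighted rewards-to-go are an
unbiased estimate of the derivative of the truncated value. -/
theorem sum_trajProb_smul_rewardToGo (M : MDP S A) {pol : S → A → ℝ}
    (hpol : ∀ s, pol s ∈ stdSimplex ℝ A) (γ : ℝ) (w : S × A → E →L[ℝ] ℝ) (r : SAVec S A) (H : ℕ) :
    ∑ τ : Fin H → S × A, trajProb M pol τ • rewardToGo γ w r τ
      = ∑ s, M.ρ s • ∑ h ∈ Finset.range H,
          γ ^ h • expRewardDeriv M pol (fun s a => pol s a • w (s, a)) r h s := by
  induction H generalizing M with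
  | zero => simp [rewardToGo]
  | succ H ih =>
    rw [sum_tuple_succ, Fintype.sum_prod_type]
    refine Finset.sum_congr rfl fun s _ => ?_
    rw [sum_expRewardDeriv_succ, Finset.smul_sum]
    refine Finset.sum_congr rfl fun a _ => ?_
    have h1 := ih (M.restart (s, a))
    have h2 := sum_trajProb (M.restart (s, a)) hpol H
    have h3 := sum_trajProb_mul_discReturn (M.restart (s, a)) hpol γ r H
    simp only [expReward_restart] at h3
    simp only [expRewardDeriv_restart] at h1
    calc _ = (M.ρ s * pol s a) • ((r (s, a) * (∑ τ : Fin H → S × A, trajProb (M.restart (s, a)) pol τ)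
            + γ * ∑ τ : Fin H → S × A, trajProb (M.restart (s, a)) pol τ * discReturn γ r τ)
              • w (s, a)
            + γ • ∑ τ : Fin H → S × A, trajProb (M.restart (s, a)) pol τ • rewardToGo γ w r τ) := by
          rw [Finset.mul_sum, Finset.mul_sum, ← Finset.sum_add_distrib, Finset.sum_smul,
            Finset.smul_sum, ← Finset.sum_add_distrib, Finset.smul_sum]
          refine Finset.sum_congr rfl fun τ _ => ?_
          rw [trajProb_cons, rewardToGo_cons]
          module
      _ = _ := by
          rw [h1, h2, h3, mul_one]
          simp only [MDP.restart]
          module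

end Trajectories

/-! ### Hellinger bound for maximum likelihood estimation -/

section MaximumLikelihood

variable {S : Type*} [Fintype S]

/-- The affinity is controlled by the squared Hellinger distance. -/
theorem sum_sqrt_mul_eq {u q : S → ℝ} (hu : ∀ s, 0 ≤ u s) (hq : ∀ s, 0 ≤ q s) :
    ∑ s, √(u s * q s) = (∑ s, u s + ∑ s, q s) / 2 - (∑ s, (√(u s) - √(q s)) ^ 2) / 2 := by
  rw [← Finset.sum_add_distrib, Finset.sum_div, Finset.sum_div, ← Finset.sum_sub_distrib]
  refine Finset.sum_congr rfl fun s _ => ?_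
  rw [Real.sqrt_mul (hu s), sub_sq, Real.sq_sqrt (hu s), Real.sq_sqrt (hq s)]
  ring

/-- The `ℓ¹` distance is controlled by the Hellinger distance. -/
theorem sq_sum_abs_sub_le {u q : S → ℝ} (hu : ∀ s, 0 ≤ u s) (hq : ∀ s, 0 ≤ q s) :
    (∑ s, |u s - q s|) ^ 2 ≤ 2 * (∑ s, u s + ∑ s, q s) * ∑ s, (√(u s) - √(q s)) ^ 2 := by
  have h1 : ∀ s, |u s - q s| = (√(u s) + √(q s)) * |√(u s) - √(q s)| := by
    intro s
    rw [← abs_of_nonneg (add_nonneg (Real.sqrt_nonneg (u s)) (Real.sqrt_nonneg (q s))), ← abs_mul]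
    congr 1
    have := Real.sq_sqrt (hu s)
    have := Real.sq_sqrt (hq s)
    linarith [show (√(u s) + √(q s)) * (√(u s) - √(q s)) = √(u s) ^ 2 - √(q s) ^ 2 by ring]
  simp only [h1]
  refine (Finset.sum_mul_sq_le_sq_mul_sq _ _ _).trans ?_
  simp only [sq_abs]
  refine mul_le_mul_of_nonneg_right ?_ (Finset.sum_nonneg fun s _ => sq_nonneg _)
  rw [← Finset.sum_add_distrib, Finset.mul_sum]
  refine Finset.sum_le_sum fun s _ => ?_
  have := Real.sq_sqrt (hu s)
  have := Real.sq_sqrt (hq s)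
  nlinarith [sq_nonneg (√(u s) - √(q s))]

theorem sum_prod_eq_one {X : Type*} [Fintype X] {q : X → ℝ} (hq : q ∈ stdSimplex ℝ X) (n : ℕ) :
    ∑ x : Fin n → X, ∏ i, q (x i) = 1 := by
  have := (Finset.prod_univ_sum (fun _ : Fin n => (Finset.univ : Finset X)) fun _ x => q x).symm
  rw [Fintype.piFinset_univ] at this
  rw [this]
  simp [hq.2]

/-- Expected log-bound: if a finite family of envelopes `u` dominates the likelihood of `q`, the
expected Hellinger distance of the selected envelope is of order `log K / n`. -/
theorem sum_prod_mul_hellinger_le {J : Type*} [Fintype J] {q : S → ℝ} (hq : q ∈ stdSimplex ℝ S)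
    {u : J → S → ℝ} (hu : ∀ j s, 0 ≤ u j s) {b : ℝ} (hub : ∀ j, ∑ s, u j s ≤ 1 + b) {n : ℕ}
    (sel : (Fin n → S) → J) (hsel : ∀ x, ∏ i, q (x i) ≤ ∏ i, u (sel x) (x i)) :
    ∑ x : Fin n → S, (∏ i, q (x i)) *
      (n * ∑ s, (√(u (sel x) s) - √(q s)) ^ 2) ≤ 2 * Real.log (Fintype.card J) + n * b := by
  set Hd : J → ℝ := fun j => ∑ s, (√(u j s) - √(q s)) ^ 2 with hHd
  -- The exponent is tuned so that `exp (e j)` exactly offsets the bound on the `n`-th power of the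
  -- affinity of `u j` and `q`, making each exponential moment at most 1.
  set e : J → ℝ := fun j => n * (Hd j / 2 - b / 2) with he
  have haff : ∀ j, ∑ s, √(u j s * q s) ≤ Real.exp (-(Hd j / 2 - b / 2)) := by
    intro j
    rw [sum_sqrt_mul_eq (hu j) hq.1, hq.2]
    have h1 := Real.add_one_le_exp (-(Hd j / 2 - b / 2))
    have h2 := hub j
    linarith
  -- Domination gives `∏ q ≤ √(∏ u · ∏ q)`; the data-dependent choice is then removed by summing
  -- over all `j`.
  have hpt : ∀ x : Fin n → S, (∏ i, q (x i)) * Real.exp (e (sel x))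
      ≤ ∑ j, Real.exp (e j) * ∏ i, √(u j (x i) * q (x i)) := by
    intro x
    have hq0 : 0 ≤ ∏ i, q (x i) := Finset.prod_nonneg fun i _ => hq.1 _
    have h1 : ∏ i, q (x i) ≤ ∏ i, √(u (sel x) (x i) * q (x i)) := by
      rw [← Real.sqrt_prod _ fun i _ => mul_nonneg (hu _ _) (hq.1 _), Finset.prod_mul_distrib]
      exact Real.le_sqrt_of_sq_le (by rw [sq]; exact mul_le_mul_of_nonneg_right (hsel x) hq0)
    calc _ ≤ (∏ i, √(u (sel x) (x i) * q (x i))) * Real.exp (e (sel x)) :=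
          mul_le_mul_of_nonneg_right h1 (Real.exp_pos _).le
      _ = Real.exp (e (sel x)) * ∏ i, √(u (sel x) (x i) * q (x i)) := mul_comm _ _
      _ ≤ _ := Finset.single_le_sum (f := fun j => Real.exp (e j) * ∏ i, √(u j (x i) * q (x i)))
          (fun j _ => mul_nonneg (Real.exp_pos _).le
            (Finset.prod_nonneg fun i _ => Real.sqrt_nonneg _)) (Finset.mem_univ _)
  have hexp : ∑ x : Fin n → S, (∏ i, q (x i)) * Real.exp (e (sel x)) ≤ Fintype.card J := by
    calc _ ≤ ∑ x : Fin n → S, ∑ j, Real.exp (e j) * ∏ i, √(u j (x i) * q (x i)) :=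
          Finset.sum_le_sum fun x _ => hpt x
      _ = ∑ j, Real.exp (e j) * (∑ s, √(u j s * q s)) ^ n := by
          rw [Finset.sum_comm]
          refine Finset.sum_congr rfl fun j _ => ?_
          rw [← Finset.mul_sum]
          congr 1
          have := (Finset.prod_univ_sum (fun _ : Fin n => (Finset.univ : Finset S))
            fun _ s => √(u j s * q s)).symm
          rw [Fintype.piFinset_univ] at this
          rw [this]
          simp
      _ ≤ ∑ _j : J, (1 : ℝ) := by
          refine Finset.sum_le_sum fun j _ => ?_
          calc _ ≤ Real.exp (e j) * Real.exp (-(Hd j / 2 - b / 2)) ^ n := by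
                gcongr
                exact haff j
            _ = 1 := by
                rw [← Real.exp_nat_mul, ← Real.exp_add, Real.exp_eq_one_iff, he]
                ring
      _ = _ := by simp
  have hne : Nonempty S := by
    by_contra hS
    rw [not_nonempty_iff] at hS
    simpa using hq.2
  have hK : (0 : ℝ) < Fintype.card J := by
    obtain ⟨s⟩ := hne
    exact_mod_cast Fintype.card_pos_iff.2 ⟨sel fun _ => s⟩
  have h1 := sum_prod_eq_one hq n
  have hlog : ∑ x : Fin n → S, (∏ i, q (x i)) * e (sel x) ≤ Real.log (Fintype.card J) := by
    calc _ ≤ ∑ x : Fin n → S, ((∏ i, q (x i)) * Real.exp (e (sel x)) / Fintype.card J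
            + (∏ i, q (x i)) * (Real.log (Fintype.card J) - 1)) := by
          refine Finset.sum_le_sum fun x _ => ?_
          -- Jensen's inequality for the logarithm, through the tangent to `exp` at `log K`.
          have h2 := Real.add_one_le_exp (e (sel x) - Real.log (Fintype.card J))
          rw [Real.exp_sub, Real.exp_log hK] at h2
          rw [mul_div_assoc, ← mul_add]
          exact mul_le_mul_of_nonneg_left (by linarith) (Finset.prod_nonneg fun i _ => hq.1 _)
      _ = (∑ x : Fin n → S, (∏ i, q (x i)) * Real.exp (e (sel x))) / Fintype.card J
            + (Real.log (Fintype.card J) - 1) := by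
          rw [Finset.sum_add_distrib, ← Finset.sum_div, ← Finset.sum_mul, h1, one_mul]
      _ ≤ 1 + (Real.log (Fintype.card J) - 1) := by
          gcongr
          exact (div_le_one hK).2 hexp
      _ = _ := by ring
  have h2 : ∑ x : Fin n → S, (∏ i, q (x i)) * (n * Hd (sel x))
      = 2 * (∑ x : Fin n → S, (∏ i, q (x i)) * e (sel x)) + n * b := by
    rw [← one_mul (n * b : ℝ), ← h1, Finset.sum_mul, Finset.mul_sum, ← Finset.sum_add_distrib]
    refine Finset.sum_congr rfl fun x _ => ?_
    rw [he]; ring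
  rw [h2]
  linarith

/-- A set in the sup-norm ball of radius `B` of `ℝ^m` is covered by `(⌊2B/δ⌋ + 1)^m` cells of
diameter at most `δ`. -/
theorem exists_cell {m : ℕ} {Ω : Set (Fin m → ℝ)} {B δ : ℝ} (hδ : 0 < δ)
    (hΩ : ∀ w ∈ Ω, ‖w‖ ≤ B) :
    ∃ cell : (Fin m → ℝ) → (Fin m → Fin (⌊2 * B / δ⌋₊ + 1)),
      ∀ w ∈ Ω, ∀ w' ∈ Ω, cell w = cell w' → ‖w - w'‖ ≤ δ := by
  -- `Fin.ofNat` reduces modulo the number of cells; on `Ω` the floors are in range, so nothing is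
  -- wrapped around.
  refine ⟨fun w i => Fin.ofNat _ ⌊(w i + B) / δ⌋₊, fun w hw w' hw' hc => ?_⟩
  have hb : ∀ v ∈ Ω, ∀ i, 0 ≤ (v i + B) / δ ∧ ⌊(v i + B) / δ⌋₊ < ⌊2 * B / δ⌋₊ + 1 := by
    intro v hv i
    have h1 := abs_le.1 ((norm_le_pi_norm v i).trans (hΩ v hv))
    refine ⟨div_nonneg (by linarith) hδ.le, Nat.lt_succ_of_le (Nat.floor_le_floor ?_)⟩
    exact div_le_div_of_nonneg_right (by linarith) hδ.le
  rw [pi_norm_le_iff_of_nonneg hδ.le]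
  intro i
  have h1 : ⌊(w i + B) / δ⌋₊ = ⌊(w' i + B) / δ⌋₊ := by
    have := congrArg Fin.val (congrFun hc i)
    simpa only [Fin.ofNat, Nat.mod_eq_of_lt (hb w hw i).2, Nat.mod_eq_of_lt (hb w' hw' i).2]
      using this
  have a1 := Nat.floor_le (hb w hw i).1
  have a2 := Nat.lt_floor_add_one ((w i + B) / δ)
  have a3 := Nat.floor_le (hb w' hw' i).1
  have a4 := Nat.lt_floor_add_one ((w' i + B) / δ)
  rw [h1] at a1 a2
  rw [le_div_iff₀ hδ] at a1 a3
  rw [div_lt_iff₀ hδ] at a2 a4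
  rw [Pi.sub_apply, Real.norm_eq_abs, abs_le]
  constructor <;> nlinarith

/-- Expected squared `ℓ¹` error of maximum likelihood estimation over a class of distributions
that is Lipschitz in a bounded parameter in `ℝ^m` and contains the true distribution `q`. -/
theorem sum_prod_mul_sq_mle_error_le {m : ℕ} {Ω : Set (Fin m → ℝ)} {p : (Fin m → ℝ) → S → ℝ}
    (hp : ∀ w ∈ Ω, p w ∈ stdSimplex ℝ S) {B δ BL : ℝ} (hB : 0 ≤ B) (hδ : 0 < δ)
    (hΩ : ∀ w ∈ Ω, ‖w‖ ≤ B) {L : S → ℝ} (hL : ∀ s, 0 ≤ L s) (hLB : ∑ s, L s ≤ BL)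
    (hlip : ∀ w ∈ Ω, ∀ w' ∈ Ω, ∀ s, |p w s - p w' s| ≤ L s * ‖w' - w‖) (hδB : BL * δ ≤ 1)
    {q : S → ℝ} (hq : ∃ w ∈ Ω, p w = q) {n : ℕ} (hn : 0 < n) (mle : (Fin n → S) → Fin m → ℝ)
    (hmle : ∀ x, IsMLE Ω p x (mle x)) :
    ∑ x : Fin n → S, (∏ i, q (x i)) * (∑ s, |p (mle x) s - q s|) ^ 2
      ≤ 48 * (m * Real.log (2 * B / δ + 1)) / n + 32 * (BL * δ) := by
  classical
  obtain ⟨w₀, hw₀, rfl⟩ := hq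
  have hqm := hp w₀ hw₀
  have hBL : 0 ≤ BL := (Finset.sum_nonneg fun s _ => hL s).trans hLB
  obtain ⟨cell, hcell⟩ := exists_cell hδ hΩ
  -- A cell that misses `Ω` gets `w₀` as a dummy representative, with a vacuous distance condition.
  have hrep : ∀ j, ∃ w ∈ Ω, ∀ w' ∈ Ω, cell w' = j → ‖w' - w‖ ≤ δ := by
    intro j
    by_cases h : ∃ w ∈ Ω, cell w = j
    · obtain ⟨w, hw, hj⟩ := h
      exact ⟨w, hw, fun w' hw' hj' => hcell w' hw' w hw (hj'.trans hj.symm)⟩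
    · exact ⟨w₀, hw₀, fun w' hw' hj' => (h ⟨w', hw', hj'⟩).elim⟩
  choose rep hrepΩ hrep using hrep
  -- Upper envelope of a cell: it dominates every density with parameter in that cell, at the price
  -- of extra mass at most `BL * δ`.
  set u : (Fin m → Fin (⌊2 * B / δ⌋₊ + 1)) → S → ℝ := fun j s => p (rep j) s + L s * δ with hu_def
  have hu : ∀ j s, 0 ≤ u j s := fun j s =>
    add_nonneg ((hp _ (hrepΩ j)).1 s) (mul_nonneg (hL s) hδ.le)
  have hub : ∀ j, ∑ s, u j s ≤ 1 + BL * δ := by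
    intro j
    simp only [hu_def]
    rw [Finset.sum_add_distrib, (hp _ (hrepΩ j)).2, ← Finset.sum_mul]
    gcongr
  set sel : (Fin n → S) → (Fin m → Fin (⌊2 * B / δ⌋₊ + 1)) := fun x => cell (mle x) with hsel
  have hclose : ∀ x s, |p (mle x) s - p (rep (sel x)) s| ≤ L s * δ := by
    intro x s
    refine (hlip _ (hmle x).1 _ (hrepΩ _) s).trans ?_
    rw [norm_sub_rev]
    exact mul_le_mul_of_nonneg_left (hrep _ _ (hmle x).1 rfl) (hL s)
  have hdom : ∀ x, ∏ i, p w₀ (x i) ≤ ∏ i, u (sel x) (x i) := by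
    intro x
    -- The only use of maximality: the truth `w₀` competes, so its likelihood is below that of the
    -- maximizer, hence below that of the envelope.
    refine ((hmle x).2 w₀ hw₀).trans (Finset.prod_le_prod (fun i _ => (hp _ (hmle x).1).1 _)
      fun i _ => ?_)
    have := (abs_le.1 (hclose x (x i))).2
    simp only [hu_def]
    linarith
  have hmain := sum_prod_mul_hellinger_le hqm hu hub sel hdom
  have hcard : Real.log (Fintype.card (Fin m → Fin (⌊2 * B / δ⌋₊ + 1)))
      ≤ m * Real.log (2 * B / δ + 1) := by
    rw [Fintype.card_fun, Fintype.card_fin, Fintype.card_fin, Nat.cast_pow, Real.log_pow]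
    gcongr
    push_cast
    gcongr
    exact Nat.floor_le (by positivity)
  have hn' : (0 : ℝ) < n := by exact_mod_cast hn
  have hpt : ∀ x, (∑ s, |p (mle x) s - p w₀ s|) ^ 2
      ≤ 24 / n * (n * ∑ s, (√(u (sel x) s) - √(p w₀ s)) ^ 2) + 8 * (BL * δ) := by
    intro x
    have h1 : ∑ s, |p (mle x) s - p w₀ s| ≤ ∑ s, |u (sel x) s - p w₀ s| + 2 * (BL * δ) := by
      calc _ ≤ ∑ s, (|u (sel x) s - p w₀ s| + 2 * (L s * δ)) := by
            refine Finset.sum_le_sum fun s _ => ?_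
            have h2 := hclose x s
            have h3 : |p (mle x) s - u (sel x) s| ≤ 2 * (L s * δ) := by
              have := mul_nonneg (hL s) hδ.le
              rw [abs_le] at h2 ⊢
              simp only [hu_def]
              constructor <;> linarith
            linarith [abs_sub_le (p (mle x) s) (u (sel x) s) (p w₀ s)]
        _ = ∑ s, |u (sel x) s - p w₀ s| + 2 * ((∑ s, L s) * δ) := by
            rw [Finset.sum_add_distrib, ← Finset.mul_sum, ← Finset.sum_mul]
        _ ≤ _ := by gcongr
    have h2 := sq_sum_abs_sub_le (hu (sel x)) hqm.1
    rw [hqm.2] at h2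
    have h3 : 0 ≤ ∑ s, (√(u (sel x) s) - √(p w₀ s)) ^ 2 := Finset.sum_nonneg fun s _ => sq_nonneg _
    have h4 : 2 * (∑ s, u (sel x) s + 1) * ∑ s, (√(u (sel x) s) - √(p w₀ s)) ^ 2
        ≤ 6 * ∑ s, (√(u (sel x) s) - √(p w₀ s)) ^ 2 :=
      mul_le_mul_of_nonneg_right (by linarith [hub (sel x)]) h3
    have h0 : 0 ≤ ∑ s, |p (mle x) s - p w₀ s| := Finset.sum_nonneg fun s _ => abs_nonneg _
    have h0' : 0 ≤ BL * δ := by positivity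
    have h5 : 24 / n * (n * ∑ s, (√(u (sel x) s) - √(p w₀ s)) ^ 2)
        = 24 * ∑ s, (√(u (sel x) s) - √(p w₀ s)) ^ 2 := by field_simp
    rw [h5]
    -- With `y = BL * δ ≤ 1`, `(x + 2y)² ≤ 2x² + 8y²` and `y² ≤ y`; moreover `x²` is at most 6 times
    -- the squared Hellinger distance. The constant 24 leaves room.
    have h6 := pow_le_pow_left₀ h0 h1 2
    nlinarith [sq_nonneg (∑ s, |u (sel x) s - p w₀ s| - 2 * (BL * δ))]
  have h1 := sum_prod_eq_one hqm n
  calc _ ≤ ∑ x : Fin n → S, (24 / n * ((∏ i, p w₀ (x i)) *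
          (n * ∑ s, (√(u (sel x) s) - √(p w₀ s)) ^ 2)) + (∏ i, p w₀ (x i)) * (8 * (BL * δ))) := by
        refine Finset.sum_le_sum fun x _ => ?_
        refine (mul_le_mul_of_nonneg_left (hpt x)
          (Finset.prod_nonneg fun i _ => hqm.1 _)).trans_eq ?_
        ring
    _ ≤ 24 / n * (2 * (m * Real.log (2 * B / δ + 1)) + n * (BL * δ)) + 8 * (BL * δ) := by
        rw [Finset.sum_add_distrib, ← Finset.mul_sum, ← Finset.sum_mul, h1, one_mul]
        gcongr
        linarith
    _ = _ := by field_simp; ring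

end MaximumLikelihood

/-! ### Second moments of averages of independent vectors -/

section Variance

/-- The second moment of a sum of i.i.d. centred vectors. -/
theorem sum_prod_mul_sq_norm_sum {X G : Type*} [Fintype X] [NormedAddCommGroup G]
    [InnerProductSpace ℝ G] {q : X → ℝ} (hq : q ∈ stdSimplex ℝ X) {Y : X → G}
    (hY : ∑ x, q x • Y x = 0) (N : ℕ) :
    ∑ τ : Fin N → X, (∏ i, q (τ i)) * ‖∑ i, Y (τ i)‖ ^ 2 = N * ∑ x, q x * ‖Y x‖ ^ 2 := by
  induction N with
  | zero => simp
  | succ N ih =>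
    rw [sum_tuple_succ]
    have h1 : ∀ x, ∑ τ : Fin N → X, (∏ i, q ((Fin.cons x τ : Fin (N + 1) → X) i))
          * ‖∑ i, Y ((Fin.cons x τ : Fin (N + 1) → X) i)‖ ^ 2
        = q x * ‖Y x‖ ^ 2 + inner ℝ (q x • Y x)
            (∑ τ : Fin N → X, (2 * ∏ i, q (τ i)) • ∑ i, Y (τ i))
          + q x * (N * ∑ x, q x * ‖Y x‖ ^ 2) := by
      intro x
      have h2 : q x * ‖Y x‖ ^ 2 = ∑ τ : Fin N → X, (∏ i, q (τ i)) * (q x * ‖Y x‖ ^ 2) := by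
        rw [← Finset.sum_mul, sum_prod_eq_one hq, one_mul]
      rw [h2, inner_sum, ← ih, Finset.mul_sum, ← Finset.sum_add_distrib, ← Finset.sum_add_distrib]
      refine Finset.sum_congr rfl fun τ _ => ?_
      simp only [Fin.prod_univ_succ, Fin.sum_univ_succ, Fin.cons_zero, Fin.cons_succ]
      rw [norm_add_sq_real, inner_smul_left, inner_smul_right, conj_trivial]
      ring
    -- Summing the cross term over the first sample vanishes by centring.
    simp only [h1, Finset.sum_add_distrib, ← sum_inner, hY, inner_zero_left, ← Finset.sum_mul, hq.2]
    push_cast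
    ring

/-- Centring does not increase the second moment. -/
theorem sum_mul_sq_norm_sub_le {X G : Type*} [Fintype X] [NormedAddCommGroup G]
    [InnerProductSpace ℝ G] {q : X → ℝ} (hq : q ∈ stdSimplex ℝ X) (Y : X → G) :
    ∑ x, q x * ‖Y x - ∑ x, q x • Y x‖ ^ 2 ≤ ∑ x, q x * ‖Y x‖ ^ 2 := by
  set μ := ∑ x, q x • Y x with hμ
  have h1 : ∑ x, q x * ‖Y x - μ‖ ^ 2 = ∑ x, q x * ‖Y x‖ ^ 2 - ‖μ‖ ^ 2 := by
    have h2 : ∑ x, q x * inner ℝ (Y x) μ = ‖μ‖ ^ 2 := by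
      rw [← real_inner_self_eq_norm_sq, hμ, sum_inner]
      exact Finset.sum_congr rfl fun x _ => by rw [inner_smul_left, conj_trivial]
    have h3 : ∀ x, q x * ‖Y x - μ‖ ^ 2
        = q x * ‖Y x‖ ^ 2 - 2 * (q x * inner ℝ (Y x) μ) + q x * ‖μ‖ ^ 2 := by
      intro x
      rw [norm_sub_sq_real]; ring
    simp only [h3, Finset.sum_add_distrib, Finset.sum_sub_distrib, ← Finset.mul_sum,
      ← Finset.sum_mul, h2, hq.2]
    ring
  rw [h1]
  linarith [sq_nonneg ‖μ‖]

theorem sum_prod_mul_sq_norm_mean_sub_le {X G : Type*} [Fintype X] [NormedAddCommGroup G]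
    [InnerProductSpace ℝ G] {q : X → ℝ} (hq : q ∈ stdSimplex ℝ X) {Y : X → G} {C : ℝ}
    (hY : ∀ x, ‖Y x‖ ≤ C) {N : ℕ} (hN : 0 < N) :
    ∑ τ : Fin N → X, (∏ i, q (τ i)) * ‖∑ x, q x • Y x - (N : ℝ)⁻¹ • ∑ i, Y (τ i)‖ ^ 2
      ≤ C ^ 2 / N := by
  set μ := ∑ x, q x • Y x with hμ
  have hN' : (0 : ℝ) < N := by exact_mod_cast hN
  have h0 : ∑ x, q x • (Y x - μ) = 0 := by
    simp only [smul_sub, Finset.sum_sub_distrib, ← Finset.sum_smul, hq.2, one_smul, ← hμ, sub_self]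
  have h1 : ∀ τ : Fin N → X, ‖μ - (N : ℝ)⁻¹ • ∑ i, Y (τ i)‖ ^ 2
      = (N : ℝ)⁻¹ ^ 2 * ‖∑ i, (Y (τ i) - μ)‖ ^ 2 := by
    intro τ
    have : μ - (N : ℝ)⁻¹ • ∑ i, Y (τ i) = -((N : ℝ)⁻¹ • ∑ i, (Y (τ i) - μ)) := by
      rw [Finset.sum_sub_distrib, smul_sub]
      simp only [Finset.sum_const, Finset.card_univ, Fintype.card_fin, ← Nat.cast_smul_eq_nsmul ℝ,
        smul_smul, inv_mul_cancel₀ hN'.ne', one_smul]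
      abel
    rw [this, norm_neg, norm_smul, mul_pow, Real.norm_of_nonneg (by positivity)]
  have h2 : ∑ x, q x * ‖Y x‖ ^ 2 ≤ C ^ 2 := by
    calc _ ≤ ∑ x, q x * C ^ 2 := Finset.sum_le_sum fun x _ =>
          mul_le_mul_of_nonneg_left (pow_le_pow_left₀ (norm_nonneg _) (hY x) 2) (hq.1 x)
      _ = C ^ 2 := by rw [← Finset.sum_mul, hq.2, one_mul]
  simp only [h1]
  calc _ = (N : ℝ)⁻¹ ^ 2 * ∑ τ : Fin N → X, (∏ i, q (τ i)) * ‖∑ i, (Y (τ i) - μ)‖ ^ 2 := by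
        rw [Finset.mul_sum]
        exact Finset.sum_congr rfl fun τ _ => by ring
    _ = (N : ℝ)⁻¹ * ∑ x, q x * ‖Y x - μ‖ ^ 2 := by
        rw [sum_prod_mul_sq_norm_sum hq h0]
        field_simp
    _ ≤ (N : ℝ)⁻¹ * C ^ 2 := by
        gcongr
        exact (sum_mul_sq_norm_sub_le hq Y).trans h2
    _ = _ := by rw [div_eq_inv_mul]

theorem sq_norm_add_add_le {G : Type*} [SeminormedAddCommGroup G] (a b c : G) :
    ‖a + b + c‖ ^ 2 ≤ 3 * (‖a‖ ^ 2 + ‖b‖ ^ 2 + ‖c‖ ^ 2) := by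
  have h := pow_le_pow_left₀ (norm_nonneg _) (norm_add₃_le (a := a) (b := b) (c := c)) 2
  nlinarith [sq_nonneg (‖a‖ - ‖b‖), sq_nonneg (‖b‖ - ‖c‖), sq_nonneg (‖a‖ - ‖c‖)]

end Variance

/-! ### State-action measures -/

section Joint

variable {S A : Type*}

theorem joint_sub (q q' : S → ℝ) (pol : S → A → ℝ) :
    joint q pol - joint q' pol = joint (q - q') pol := by
  ext x
  simp [joint, sub_mul]

variable [Fintype S] [Fintype A]

theorem norm_le_sum_abs (v : SAVec S A) : ‖v‖ ≤ ∑ x, |v x| := by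
  rw [EuclideanSpace.norm_eq]
  refine Real.sqrt_le_iff.2 ⟨Finset.sum_nonneg fun x _ => abs_nonneg _, ?_⟩
  exact Finset.sum_sq_le_sq_sum_of_nonneg fun x _ => norm_nonneg _

/-- Passing from `ℓ²` to `ℓ¹` first lets the policy sum to one, so an error in the state
distribution transfers without a factor `|A|`. -/
theorem norm_joint_le {pol : S → A → ℝ} (hpol : ∀ s, pol s ∈ stdSimplex ℝ A) (q : S → ℝ) :
    ‖joint q pol‖ ≤ ∑ s, |q s| := by
  refine (norm_le_sum_abs _).trans (le_of_eq ?_)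
  rw [Fintype.sum_prod_type]
  refine Finset.sum_congr rfl fun s _ => ?_
  simp only [joint, abs_mul, ← Finset.mul_sum]
  rw [Finset.sum_congr rfl fun a _ => abs_of_nonneg ((hpol s).1 a), (hpol s).2, mul_one]

theorem norm_occ_le {γ : ℝ} (hγ0 : 0 ≤ γ) (hγ1 : γ < 1) (M : MDP S A) {pol : S → A → ℝ}
    (hpol : ∀ s, pol s ∈ stdSimplex ℝ A) : ‖occ M γ pol‖ ≤ 1 := by
  have h := stateOcc_mem_stdSimplex hγ0 hγ1 M hpol
  refine (norm_joint_le hpol _).trans_eq ?_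
  rw [Finset.sum_congr rfl fun s _ => abs_of_nonneg (h.1 s), h.2]

theorem trajProb_mem_stdSimplex (M : MDP S A) {pol : S → A → ℝ} (hpol : ∀ s, pol s ∈ stdSimplex ℝ A)
    (H : ℕ) : (trajProb M pol : (Fin H → S × A) → ℝ) ∈ stdSimplex ℝ (Fin H → S × A) :=
  ⟨trajProb_nonneg M hpol, sum_trajProb M hpol H⟩

end Joint

/-! ### Mean square error of the gradient estimate -/

section Estimator

variable {S A : Type*} [Fintype A] {d : ℕ} {ψ : S → A → Param d → ℝ} {lψ Lψ : ℝ}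

/-- Linearity in the reward separates the pseudo-reward error from the sampling noise. -/
theorem pgEstimate_sub (γ : ℝ) {H : ℕ} (τ : Fin H → S × A) (θ : Param d) (r r' : SAVec S A) :
    pgEstimate γ ψ τ θ (r - r') = pgEstimate γ ψ τ θ r - pgEstimate γ ψ τ θ r' := by
  simp only [pgEstimate, PiLp.sub_apply, mul_sub, Finset.sum_sub_distrib, sub_smul]

variable [Nonempty A]

theorem softmaxPolicy_mem_stdSimplex (ψ : S → A → Param d → ℝ) (θ : Param d) (s : S) :
    softmaxPolicy ψ θ s ∈ stdSimplex ℝ A :=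
  ⟨fun a => (softmaxPolicy_pos ψ θ s a).le, sum_softmaxPolicy ψ θ s⟩

/-- Gradients are vectors while the policy gradient identity concerns functionals; the Riesz
isometry moves between them without changing norms. -/
theorem toDual_pgEstimate (hψ : SoftmaxRegular ψ lψ Lψ) (γ : ℝ) {H : ℕ} (τ : Fin H → S × A)
    (θ : Param d) (r : SAVec S A) :
    InnerProductSpace.toDual ℝ (Param d) (pgEstimate γ ψ τ θ r)
      = rewardToGo γ (fun x => score ψ θ x.1 x.2) r τ := by
  rw [pgEstimate, rewardToGo, map_sum]
  refine Finset.sum_congr rfl fun t _ => ?_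
  rw [map_smul, gradient, LinearIsometryEquiv.apply_symm_apply,
    (hasFDerivAt_log_softmaxPolicy hψ θ _ _).fderiv]

variable [Fintype S]

/-- The derivative in `θ` of the value of the softmax policy for the reward `r`, as a vector. -/
def valueGrad (M : MDP S A) (γ : ℝ) (ψ : S → A → Param d → ℝ) (θ : Param d) (r : SAVec S A) :
    Param d :=
  (InnerProductSpace.toDual ℝ (Param d)).symm (valueDeriv M γ (softmaxPolicy ψ θ)
    (fun s a => softmaxPolicy ψ θ s a • score ψ θ s a) r)

theorem norm_pgEstimate_le {γ : ℝ} (hγ0 : 0 ≤ γ) (hγ1 : γ < 1) (hlψ : 0 ≤ lψ)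
    (hψ : SoftmaxRegular ψ lψ Lψ) {H : ℕ} (τ : Fin H → S × A) (θ : Param d) (r : SAVec S A) :
    ‖pgEstimate γ ψ τ θ r‖ ≤ 2 * lψ * (1 - γ)⁻¹ ^ 2 * ‖r‖ := by
  rw [← (InnerProductSpace.toDual ℝ (Param d)).norm_map, toDual_pgEstimate hψ]
  exact norm_rewardToGo_le hγ0 hγ1 (by positivity) (fun x => norm_score_le hψ θ x.1 x.2) r τ

/-- The bias of the truncated policy gradient estimate. -/
theorem norm_valueGrad_sub_le (hψ : SoftmaxRegular ψ lψ Lψ) (M : MDP S A) {β : ℝ} (hβ0 : 0 ≤ β)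
    (hβ1 : β < 1) (θ : Param d) (r : SAVec S A) (H : ℕ) :
    ‖valueGrad M (β ^ 2) ψ θ r - ∑ τ : Fin H → S × A,
        trajProb M (softmaxPolicy ψ θ) τ • pgEstimate (β ^ 2) ψ τ θ r‖
      ≤ β ^ H * (quadGeom β * (2 * lψ) * ‖r‖) := by
  rw [← (InnerProductSpace.toDual ℝ (Param d)).norm_map, map_sub, map_sum, valueGrad,
    LinearIsometryEquiv.apply_symm_apply]
  simp only [map_smul, toDual_pgEstimate hψ]
  rw [sum_trajProb_smul_rewardToGo M (softmaxPolicy_mem_stdSimplex ψ θ)]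
  have h := norm_valueDeriv_sub_sum_le hβ0 hβ1 (smoothPolicy_softmaxPolicy hψ) M r θ H
  rwa [Finset.sum_congr rfl fun h _ => Finset.smul_sum, Finset.sum_comm,
    Finset.sum_congr rfl fun s _ => (Finset.sum_congr rfl fun h _ => smul_comm _ _ _).trans
      Finset.smul_sum.symm] at h

/-- Mean square error of the gradient estimate of one iteration, when the pseudo-reward `rhat` is
computed from the sampled states. -/
theorem sum_iterProb_mul_sq_error_le (hψ : SoftmaxRegular ψ lψ Lψ) (hlψ : 0 ≤ lψ) (M : MDP S A)
    {β : ℝ} (hβ0 : 0 ≤ β) (hβ1 : β < 1) (θ : Param d) {r : SAVec S A} {R V : ℝ} (hr : ‖r‖ ≤ R)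
    {n N H : ℕ} (hN : 0 < N) (rhat : (Fin n → S) → SAVec S A)
    (hV : ∑ x : Fin n → S, (∏ i, stateOcc M (β ^ 2) (softmaxPolicy ψ θ) (x i)) * ‖rhat x - r‖ ^ 2
      ≤ V) :
    ∑ z : IterData S A n N H, iterProb M (β ^ 2) ψ θ z *
        ‖valueGrad M (β ^ 2) ψ θ r
          - (N : ℝ)⁻¹ • ∑ i, pgEstimate (β ^ 2) ψ (z.2 i) θ (rhat z.1)‖ ^ 2
      ≤ 3 * ((β ^ H * (quadGeom β * (2 * lψ) * R)) ^ 2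
        + (2 * lψ * (1 - β ^ 2)⁻¹ ^ 2 * R) ^ 2 / N + (2 * lψ * (1 - β ^ 2)⁻¹ ^ 2) ^ 2 * V) := by
  have hγ0 : 0 ≤ β ^ 2 := by positivity
  have hγ1 : β ^ 2 < 1 := pow_lt_one₀ hβ0 hβ1 two_ne_zero
  have hR : 0 ≤ R := (norm_nonneg r).trans hr
  set K := 2 * lψ * (1 - β ^ 2)⁻¹ ^ 2 with hK
  have hK0 : 0 ≤ K := by positivity
  have hN' : (0 : ℝ) < N := by exact_mod_cast hN
  set pol := softmaxPolicy ψ θ with hpol_def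
  have hpol := softmaxPolicy_mem_stdSimplex ψ θ
  have hocc := stateOcc_mem_stdSimplex hγ0 hγ1 M hpol
  have htraj := trajProb_mem_stdSimplex M hpol H
  set μ : Param d := ∑ τ : Fin H → S × A, trajProb M pol τ • pgEstimate (β ^ 2) ψ τ θ r with hμ
  set b := β ^ H * (quadGeom β * (2 * lψ) * R) with hb
  have hbias : ‖valueGrad M (β ^ 2) ψ θ r - μ‖ ≤ b := by
    refine (norm_valueGrad_sub_le hψ M hβ0 hβ1 θ r H).trans ?_
    have := quadGeom_nonneg hβ0
    rw [hb]
    gcongr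
  have hpt : ∀ z : IterData S A n N H, ‖valueGrad M (β ^ 2) ψ θ r
          - (N : ℝ)⁻¹ • ∑ i, pgEstimate (β ^ 2) ψ (z.2 i) θ (rhat z.1)‖ ^ 2
      ≤ 3 * (b ^ 2 + ‖μ - (N : ℝ)⁻¹ • ∑ i, pgEstimate (β ^ 2) ψ (z.2 i) θ r‖ ^ 2
        + K ^ 2 * ‖rhat z.1 - r‖ ^ 2) := by
    intro z
    -- Truncation bias, fluctuation for the true pseudo-reward, and reward error. The middle term
    -- does not involve the sampled states and the last is bounded for every trajectory, so the
    -- expectation factors.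
    have e1 : valueGrad M (β ^ 2) ψ θ r
          - (N : ℝ)⁻¹ • ∑ i, pgEstimate (β ^ 2) ψ (z.2 i) θ (rhat z.1)
        = (valueGrad M (β ^ 2) ψ θ r - μ)
          + (μ - (N : ℝ)⁻¹ • ∑ i, pgEstimate (β ^ 2) ψ (z.2 i) θ r)
          + -((N : ℝ)⁻¹ • ∑ i, pgEstimate (β ^ 2) ψ (z.2 i) θ (rhat z.1 - r)) := by
      simp only [pgEstimate_sub, Finset.sum_sub_distrib, smul_sub]
      abel
    have e2 : ‖-((N : ℝ)⁻¹ • ∑ i, pgEstimate (β ^ 2) ψ (z.2 i) θ (rhat z.1 - r))‖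
        ≤ K * ‖rhat z.1 - r‖ := by
      rw [norm_neg, norm_smul, Real.norm_of_nonneg (by positivity)]
      have : ‖∑ i, pgEstimate (β ^ 2) ψ (z.2 i) θ (rhat z.1 - r)‖
          ≤ N * (K * ‖rhat z.1 - r‖) := by
        refine (norm_sum_le_of_le _ fun i _ =>
          norm_pgEstimate_le hγ0 hγ1 hlψ hψ (z.2 i) θ (rhat z.1 - r)).trans_eq ?_
        simp [hK]
      calc _ ≤ (N : ℝ)⁻¹ * (N * (K * ‖rhat z.1 - r‖)) := by gcongr
        _ = _ := by field_simp
    rw [e1]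
    refine (sq_norm_add_add_le _ _ _).trans ?_
    have h1 := pow_le_pow_left₀ (norm_nonneg _) hbias 2
    have h2 := pow_le_pow_left₀ (norm_nonneg _) e2 2
    rw [mul_pow] at h2
    linarith
  have hvar : ∑ τ : Fin N → Fin H → S × A, (∏ i, trajProb M pol (τ i))
      * ‖μ - (N : ℝ)⁻¹ • ∑ i, pgEstimate (β ^ 2) ψ (τ i) θ r‖ ^ 2 ≤ (K * R) ^ 2 / N := by
    refine sum_prod_mul_sq_norm_mean_sub_le htraj (fun τ => ?_) hN
    exact (norm_pgEstimate_le hγ0 hγ1 hlψ hψ τ θ r).trans (mul_le_mul_of_nonneg_left hr hK0)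
  have hs1 := sum_prod_eq_one hocc n
  have hs2 := sum_prod_eq_one htraj N
  calc _ ≤ ∑ z : IterData S A n N H, iterProb M (β ^ 2) ψ θ z *
          (3 * (b ^ 2 + ‖μ - (N : ℝ)⁻¹ • ∑ i, pgEstimate (β ^ 2) ψ (z.2 i) θ r‖ ^ 2
            + K ^ 2 * ‖rhat z.1 - r‖ ^ 2)) := by
        refine Finset.sum_le_sum fun z _ => mul_le_mul_of_nonneg_left (hpt z) (mul_nonneg ?_ ?_)
        · exact Finset.prod_nonneg fun i _ => hocc.1 _
        · exact Finset.prod_nonneg fun i _ => htraj.1 _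
    _ = ∑ x : Fin n → S, ∑ τ : Fin N → Fin H → S × A,
          ((∏ i, stateOcc M (β ^ 2) pol (x i)) * (∏ i, trajProb M pol (τ i))) *
          (3 * (b ^ 2 + ‖μ - (N : ℝ)⁻¹ • ∑ i, pgEstimate (β ^ 2) ψ (τ i) θ r‖ ^ 2
            + K ^ 2 * ‖rhat x - r‖ ^ 2)) := Fintype.sum_prod_type _
    _ = ∑ x : Fin n → S, (∏ i, stateOcc M (β ^ 2) pol (x i)) * (3 * (b ^ 2
          + (∑ τ : Fin N → Fin H → S × A, (∏ i, trajProb M pol (τ i))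
            * ‖μ - (N : ℝ)⁻¹ • ∑ i, pgEstimate (β ^ 2) ψ (τ i) θ r‖ ^ 2)
          + K ^ 2 * ‖rhat x - r‖ ^ 2)) := by
        refine Finset.sum_congr rfl fun x _ => ?_
        have e3 : b ^ 2 + K ^ 2 * ‖rhat x - r‖ ^ 2 = ∑ τ : Fin N → Fin H → S × A,
            (∏ i, trajProb M pol (τ i)) * (b ^ 2 + K ^ 2 * ‖rhat x - r‖ ^ 2) := by
          rw [← Finset.sum_mul, hs2, one_mul]
        rw [add_right_comm, e3, ← Finset.sum_add_distrib, Finset.mul_sum, Finset.mul_sum]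
        exact Finset.sum_congr rfl fun τ _ => by ring
    _ = 3 * (b ^ 2 + (∑ τ : Fin N → Fin H → S × A, (∏ i, trajProb M pol (τ i))
            * ‖μ - (N : ℝ)⁻¹ • ∑ i, pgEstimate (β ^ 2) ψ (τ i) θ r‖ ^ 2)
          + K ^ 2 * ∑ x : Fin n → S, (∏ i, stateOcc M (β ^ 2) pol (x i)) * ‖rhat x - r‖ ^ 2) := by
        generalize (∑ τ : Fin N → Fin H → S × A, (∏ i, trajProb M pol (τ i))
            * ‖μ - (N : ℝ)⁻¹ • ∑ i, pgEstimate (β ^ 2) ψ (τ i) θ r‖ ^ 2) = v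
        have e4 : b ^ 2 + v = ∑ x : Fin n → S,
            (∏ i, stateOcc M (β ^ 2) pol (x i)) * (b ^ 2 + v) := by
          rw [← Finset.sum_mul, hs1, one_mul]
        conv_rhs => rw [e4, Finset.mul_sum, ← Finset.sum_add_distrib, Finset.mul_sum]
        exact Finset.sum_congr rfl fun x _ => by ring
    _ ≤ _ := by gcongr

end Estimator

/-! ### Inexact gradient ascent -/

section Ascent

variable {E : Type*} [NormedAddCommGroup E] [InnerProductSpace ℝ E]

/-- One inexact gradient ascent step compared with an arbitrary nearby point. -/
theorem le_of_gradient_step {J : E → ℝ} {g : E → E} {L : ℝ}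
    (hJ : ∀ x y, |J y - J x - inner ℝ (g x) (y - x)| ≤ L * ‖y - x‖ ^ 2) {a : ℝ} (ha : 0 < a)
    (haL : a * L ≤ 1 / 4) (x y v : E) :
    J y - ‖y - x‖ ^ 2 / a - 2 * a * ‖g x - v‖ ^ 2 ≤ J (x + a • v) := by
  set w := y - x with hw
  set e := g x - v with he
  have hg : g x = v + e := by rw [he]; abel
  have h1 := (abs_le.1 (hJ x (x + a • v))).1
  have h2 := (abs_le.1 (hJ x y)).2
  rw [add_sub_cancel_left, inner_smul_right, hg, inner_add_left, real_inner_self_eq_norm_sq,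
    norm_smul, Real.norm_of_nonneg ha.le] at h1
  rw [← hw, hg, inner_add_left] at h2
  have h3 := real_inner_le_norm v w
  have h4 := real_inner_le_norm e w
  have h5 := (abs_le.1 (abs_real_inner_le_norm e v)).1
  have hd : ‖w‖ ^ 2 / a * a = ‖w‖ ^ 2 := div_mul_cancel₀ _ ha.ne'
  set D := ‖w‖ ^ 2 / a with hD
  have hD0 : 0 ≤ D := by positivity
  have hLw : L * ‖w‖ ^ 2 ≤ D / 4 := by
    have := mul_le_mul_of_nonneg_right haL hD0
    nlinarith
  have hLv : L * (a * ‖v‖) ^ 2 ≤ a * ‖v‖ ^ 2 / 4 := by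
    have := mul_le_mul_of_nonneg_right haL (show 0 ≤ a * ‖v‖ ^ 2 by positivity)
    nlinarith
  -- Young's inequalities with a balanced budget. The gain `a‖v‖²` is spent as 1/4 on `hLv`, 1/2 on
  -- `c1`, 1/4 on `c3`; the allowance `D` as 1/4 on `hLw`, 1/2 on `c1`, 1/4 on `c2`; and `2a‖e‖²`
  -- equally on `c2` and `c3`.
  have c1 : ‖v‖ * ‖w‖ ≤ a * ‖v‖ ^ 2 / 2 + D / 2 := by
    have : 0 ≤ (a * ‖v‖ - ‖w‖) ^ 2 / a := by positivity
    have e : (a * ‖v‖ - ‖w‖) ^ 2 / a = a * ‖v‖ ^ 2 - 2 * (‖v‖ * ‖w‖) + D := by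
      rw [hD]; field_simp; ring
    linarith
  have c2 : ‖e‖ * ‖w‖ ≤ a * ‖e‖ ^ 2 + D / 4 := by
    have : 0 ≤ (2 * a * ‖e‖ - ‖w‖) ^ 2 / a := by positivity
    have e : (2 * a * ‖e‖ - ‖w‖) ^ 2 / a = 4 * (a * ‖e‖ ^ 2) - 4 * (‖e‖ * ‖w‖) + D := by
      rw [hD]; field_simp; ring
    linarith
  have c3 : a * (‖e‖ * ‖v‖) ≤ a * ‖e‖ ^ 2 + a * ‖v‖ ^ 2 / 4 := by
    have : 0 ≤ a * (2 * ‖e‖ - ‖v‖) ^ 2 := by positivity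
    nlinarith
  have h6 := mul_le_mul_of_nonneg_left h5 ha.le
  linarith

end Ascent

/-! ### Smoothness and hidden concavity of the objective -/

section Objective

variable {S A : Type*} [Fintype S] [Fintype A] {d m : ℕ}
variable {ψ : S → A → Param d → ℝ} {lψ Lψ lF LF γ Bω BL : ℝ} {M : MDP S A}
variable {Ω : Set (Fin m → ℝ)} {p : (Fin m → ℝ) → S → ℝ} {F : SAVec S A → ℝ}

theorem ClassRegular.occ_mem (hclass : ClassRegular M γ ψ Ω p Bω BL) (θ : Param d) :
    occ M γ (softmaxPolicy ψ θ) ∈ jointClass ψ Ω p := by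
  obtain ⟨w, hw, h⟩ := hclass.realizable θ
  exact ⟨w, hw, θ, by rw [h, occ]⟩

variable [Nonempty A]

/-- The smoothness constant of the objective in the policy parameter. -/
def smoothConst (γ lψ Lψ lF LF : ℝ) : ℝ :=
  LF * (quadGeom γ * (2 * lψ)) ^ 2 + lF * (quadGeom γ * (2 * Lψ + 6 * lψ ^ 2 + (2 * lψ) ^ 2))

theorem smoothConst_nonneg (hγ0 : 0 ≤ γ) (hLψ : 0 ≤ Lψ) (hlF : 0 ≤ lF) (hLF : 0 ≤ LF) :
    0 ≤ smoothConst γ lψ Lψ lF LF := by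
  have := quadGeom_nonneg hγ0
  unfold smoothConst
  positivity

/-- The gradient of the objective `θ ↦ F (λ(θ))`. -/
def objGrad (M : MDP S A) (γ : ℝ) (ψ : S → A → Param d → ℝ) (F : SAVec S A → ℝ) (θ : Param d) :
    Param d :=
  (1 - γ) • valueGrad M γ ψ θ (gradient F (occ M γ (softmaxPolicy ψ θ)))

theorem innerSL_objGrad (hγ0 : 0 ≤ γ) (hγ1 : γ < 1) (hψ : SoftmaxRegular ψ lψ Lψ) (M : MDP S A)
    (F : SAVec S A → ℝ) (θ : Param d) :
    innerSL ℝ (objGrad M γ ψ F θ) = (innerSL ℝ (gradient F (occ M γ (softmaxPolicy ψ θ)))).comp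
      (fderiv ℝ (fun θ => occ M γ (softmaxPolicy ψ θ)) θ) := by
  ext v
  rw [ContinuousLinearMap.comp_apply, innerSL_apply_apply, innerSL_apply_apply,
    inner_fderiv_occ hγ0 hγ1 (smoothPolicy_softmaxPolicy hψ), objGrad, inner_smul_left, valueGrad,
    InnerProductSpace.toDual_symm_apply, conj_trivial]

theorem hasFDerivAt_objective (hγ0 : 0 ≤ γ) (hγ1 : γ < 1) (hψ : SoftmaxRegular ψ lψ Lψ)
    (hclass : ClassRegular M γ ψ Ω p Bω BL) (hF : UtilitySmooth F (jointClass ψ Ω p) lF LF)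
    (θ : Param d) :
    HasFDerivAt (fun θ => F (occ M γ (softmaxPolicy ψ θ))) (innerSL ℝ (objGrad M γ ψ F θ)) θ := by
  have h1 := (hF.diff _ (hclass.occ_mem θ)).hasFDerivAt.comp θ
    (differentiable_occ hγ0 hγ1 (smoothPolicy_softmaxPolicy hψ) M θ).hasFDerivAt
  refine h1.congr_fderiv ?_
  rw [innerSL_objGrad hγ0 hγ1 hψ]
  ext v
  simp only [ContinuousLinearMap.comp_apply, innerSL_apply_apply, gradient,
    InnerProductSpace.toDual_symm_apply]

/-- The chain rule, varying one factor at a time. The gradient of `F` is controlled only on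
`jointClass`, which suffices since realizability puts every `λ(θ)` there. -/
theorem norm_innerSL_objGrad_sub_le (hγ0 : 0 ≤ γ) (hγ1 : γ < 1) (hψ : SoftmaxRegular ψ lψ Lψ)
    (hlψ : 0 ≤ lψ) (hLψ : 0 ≤ Lψ) (hlF : 0 ≤ lF) (hLF : 0 ≤ LF)
    (hclass : ClassRegular M γ ψ Ω p Bω BL) (hF : UtilitySmooth F (jointClass ψ Ω p) lF LF)
    (θ θ' : Param d) :
    ‖innerSL ℝ (objGrad M γ ψ F θ) - innerSL ℝ (objGrad M γ ψ F θ')‖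
      ≤ smoothConst γ lψ Lψ lF LF * ‖θ - θ'‖ := by
  have hπ := smoothPolicy_softmaxPolicy hψ
  have hq := quadGeom_nonneg hγ0
  set lam : Param d → SAVec S A := fun θ => occ M γ (softmaxPolicy ψ θ) with hlam
  have hD1 : ∀ θ, ‖fderiv ℝ lam θ‖ ≤ quadGeom γ * (2 * lψ) :=
    norm_fderiv_occ_le hγ0 hγ1 hπ (by positivity) M
  have hlip : ‖lam θ - lam θ'‖ ≤ quadGeom γ * (2 * lψ) * ‖θ - θ'‖ :=
    norm_sub_le_of_hasFDerivAt (fun x => (differentiable_occ hγ0 hγ1 hπ M x).hasFDerivAt) hD1 θ θ'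
  have e : innerSL ℝ (objGrad M γ ψ F θ) - innerSL ℝ (objGrad M γ ψ F θ')
      = (innerSL ℝ (gradient F (lam θ) - gradient F (lam θ'))).comp (fderiv ℝ lam θ)
        + (innerSL ℝ (gradient F (lam θ'))).comp (fderiv ℝ lam θ - fderiv ℝ lam θ') := by
    rw [innerSL_objGrad hγ0 hγ1 hψ, innerSL_objGrad hγ0 hγ1 hψ, map_sub,
      ContinuousLinearMap.sub_comp, ContinuousLinearMap.comp_sub]
    abel
  rw [e]
  refine (norm_add_le _ _).trans ((add_le_add (ContinuousLinearMap.opNorm_comp_le _ _)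
    (ContinuousLinearMap.opNorm_comp_le _ _)).trans ?_)
  rw [innerSL_apply_norm, innerSL_apply_norm]
  have h1 := hF.grad_lip _ (hclass.occ_mem θ) _ (hclass.occ_mem θ')
  have h2 := hF.grad_le _ (hclass.occ_mem θ')
  have h3 := norm_fderiv_occ_sub_le hγ0 hγ1 hπ (by positivity) M θ θ'
  calc _ ≤ (LF * (quadGeom γ * (2 * lψ) * ‖θ - θ'‖)) * (quadGeom γ * (2 * lψ))
        + lF * (quadGeom γ * (2 * Lψ + 6 * lψ ^ 2 + (2 * lψ) ^ 2) * ‖θ - θ'‖) := by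
        gcongr
        · exact h1.trans (mul_le_mul_of_nonneg_left hlip hLF)
        · exact hD1 θ
    _ = _ := by rw [smoothConst]; ring

/-- The mean value inequality is applied on a segment of the parameter space, whose image stays in
`jointClass`; no convexity of that class is needed. -/
theorem abs_objective_sub_le (hγ0 : 0 ≤ γ) (hγ1 : γ < 1) (hψ : SoftmaxRegular ψ lψ Lψ)
    (hlψ : 0 ≤ lψ) (hLψ : 0 ≤ Lψ) (hlF : 0 ≤ lF) (hLF : 0 ≤ LF)
    (hclass : ClassRegular M γ ψ Ω p Bω BL) (hF : UtilitySmooth F (jointClass ψ Ω p) lF LF)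
    (x y : Param d) :
    |F (occ M γ (softmaxPolicy ψ y)) - F (occ M γ (softmaxPolicy ψ x))
      - inner ℝ (objGrad M γ ψ F x) (y - x)| ≤ smoothConst γ lψ Lψ lF LF * ‖y - x‖ ^ 2 := by
  have hC := smoothConst_nonneg (lψ := lψ) hγ0 hLψ hlF hLF
  have h := (convex_segment x y).norm_image_sub_le_of_norm_hasFDerivWithin_le'
    (f := fun θ => F (occ M γ (softmaxPolicy ψ θ)))
    (φ := innerSL ℝ (objGrad M γ ψ F x)) (C := smoothConst γ lψ Lψ lF LF * ‖y - x‖)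
    (fun z _ => (hasFDerivAt_objective hγ0 hγ1 hψ hclass hF z).hasFDerivWithinAt)
    (fun z hz => ?_) (left_mem_segment ℝ x y) (right_mem_segment ℝ x y)
  · rw [Real.norm_eq_abs, innerSL_apply_apply] at h
    refine h.trans_eq (by ring)
  · refine (norm_innerSL_objGrad_sub_le hγ0 hγ1 hψ hlψ hLψ hlF hLF hclass hF z x).trans ?_
    refine mul_le_mul_of_nonneg_left ?_ hC
    have := norm_sub_le_of_mem_segment hz
    simpa [norm_sub_rev] using this

/-- Hidden convexity: near a parameter in the overparametrized set there is one whose occupancy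
measure makes progress towards the optimum. -/
theorem exists_improving_param (hγ0 : 0 ≤ γ) (hγ1 : γ < 1)
    (hclass : ClassRegular M γ ψ Ω p Bω BL) (hconc : ConcaveWithin F (jointClass ψ Ω p))
    {lam : Param d → SAVec S A} (hlam : ∀ θ, lam θ = occ M γ (softmaxPolicy ψ θ)) {θs : Param d}
    {Θ : Set (Param d)} {l : NNReal} {ηbar : ℝ} (hover : Overparam lam Θ θs l ηbar) {θ : Param d}
    (hθ : θ ∈ Θ) {η : ℝ} (hη0 : 0 < η) (hη : η ≤ ηbar) (hη1 : η ≤ 1) :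
    ∃ θ', lam θ' = (1 - η) • lam θ + η • lam θs ∧
      (1 - η) * F (lam θ) + η * F (lam θs) ≤ F (lam θ') ∧ ‖θ' - θ‖ ≤ 2 * l * η := by
  obtain ⟨U, V, hU, hV, hbij, hlip, hmem⟩ := hover θ hθ
  have hy := hmem η hη0 hη
  obtain ⟨θ₁, hθ₁, h₁⟩ := hbij.surjOn hy
  have hinv := hbij.injOn.leftInvOn_invFunOn
  have hd := hlip.dist_le_mul _ hy _ hV
  rw [← h₁, hinv hθ₁, hinv hU, h₁, dist_eq_norm, dist_eq_norm] at hd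
  have hnorm : ∀ θ, ‖lam θ‖ ≤ 1 := fun θ => by
    rw [hlam]; exact norm_occ_le hγ0 hγ1 M (softmaxPolicy_mem_stdSimplex ψ θ)
  have hΛ : ∀ θ, lam θ ∈ jointClass ψ Ω p := fun θ => by rw [hlam]; exact hclass.occ_mem θ
  refine ⟨θ₁, h₁, ?_, hd.trans ?_⟩
  · rw [h₁]
    -- The convex combination lies in the possibly nonconvex class because it is itself the
    -- occupancy measure of `θ₁`.
    exact hconc _ (hΛ θ) _ (hΛ θs) _ _ (by linarith) hη0.le (by ring) (h₁ ▸ hΛ θ₁)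
  · have e : (1 - η) • lam θ + η • lam θs - lam θ = η • (lam θs - lam θ) := by module
    rw [e, norm_smul, Real.norm_of_nonneg hη0.le]
    have h2 : ‖lam θs - lam θ‖ ≤ 2 := (norm_sub_le _ _).trans (by linarith [hnorm θ, hnorm θs])
    calc (l : ℝ) * (η * ‖lam θs - lam θ‖) ≤ l * (η * 2) := by gcongr
      _ = _ := by ring

/-- The suboptimality at a parameter in the overparametrized set is bounded. -/
theorem suboptimality_le (hγ0 : 0 ≤ γ) (hγ1 : γ < 1) (hlF : 0 ≤ lF)
    (hclass : ClassRegular M γ ψ Ω p Bω BL) (hF : UtilitySmooth F (jointClass ψ Ω p) lF LF)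
    (hconc : ConcaveWithin F (jointClass ψ Ω p))
    {lam : Param d → SAVec S A} (hlam : ∀ θ, lam θ = occ M γ (softmaxPolicy ψ θ)) {θs : Param d}
    {Θ : Set (Param d)} {l : NNReal} {ηbar : ℝ} (hηbar : 0 < ηbar)
    (hover : Overparam lam Θ θs l ηbar) {θ : Param d} (hθ : θ ∈ Θ) :
    F (lam θs) - F (lam θ) ≤ 2 * lF := by
  have hΛ : ∀ θ, lam θ ∈ jointClass ψ Ω p := fun θ => by rw [hlam]; exact hclass.occ_mem θ
  have hnorm : ∀ θ, ‖lam θ‖ ≤ 1 := fun θ => by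
    rw [hlam]; exact norm_occ_le hγ0 hγ1 M (softmaxPolicy_mem_stdSimplex ψ θ)
  set v := lam θs - lam θ with hv
  have hv2 : ‖v‖ ≤ 2 := (norm_sub_le _ _).trans (by linarith [hnorm θ, hnorm θs])
  -- The segment may leave the class, where the gradient of `F` is not bounded; only the derivative
  -- at its endpoint `lam θ` is used.
  have hder : HasDerivAt (fun η : ℝ => F (lam θ + η • v)) (fderiv ℝ F (lam θ) v) 0 := by
    have h1 : HasDerivAt (fun η : ℝ => lam θ + η • v) v 0 := by
      simpa using ((hasDerivAt_id (0 : ℝ)).smul_const v).const_add (lam θ)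
    have h2 : HasFDerivAt F (fderiv ℝ F (lam θ)) (lam θ + (0 : ℝ) • v) := by
      simpa using (hF.diff _ (hΛ θ)).hasFDerivAt
    exact h2.comp_hasDerivAt 0 h1
  have hbound : fderiv ℝ F (lam θ) v ≤ 2 * lF := by
    have h1 : ‖fderiv ℝ F (lam θ)‖ ≤ lF := by
      have := hF.grad_le _ (hΛ θ)
      simpa [gradient] using this
    calc _ ≤ ‖fderiv ℝ F (lam θ) v‖ := le_abs_self _
      _ ≤ lF * ‖v‖ := (fderiv ℝ F (lam θ)).le_of_opNorm_le h1 v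
      _ ≤ lF * 2 := by gcongr
      _ = _ := mul_comm _ _
  refine le_trans ?_ hbound
  have hslope := hder.tendsto_slope_zero_right
  refine ge_of_tendsto hslope ?_
  have hpos : 0 < min ηbar 1 := lt_min hηbar one_pos
  -- For small `η` the segment points are occupancy measures, and concavity there bounds each
  -- difference quotient below by the suboptimality.
  filter_upwards [Ioc_mem_nhdsGT hpos] with η hη
  obtain ⟨θ', h1, h2, -⟩ := exists_improving_param hγ0 hγ1 hclass hconc hlam hover hθ hη.1
    (hη.2.trans (min_le_left _ _)) (hη.2.trans (min_le_right _ _))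
  have e : lam θ + (0 + η) • v = lam θ' := by rw [h1, hv]; module
  rw [e, zero_smul, add_zero, smul_eq_mul, ← div_eq_inv_mul, le_div_iff₀ hη.1]
  linarith

end Objective

/-! ### Expectations along a run of the algorithm -/

section Run

variable {S A : Type*} [Fintype S] [Fintype A] {d m n N H : ℕ}
variable {ψ : S → A → Param d → ℝ} {γ α : ℝ} {M : MDP S A}
variable {Ω : Set (Fin m → ℝ)} {p : (Fin m → ℝ) → S → ℝ} {F : SAVec S A → ℝ}

/-- After the first iteration the rest is a run from the updated parameter with the selection rule
shifted in time, so inductions on `T` generalize over both. -/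
theorem iterate_cons {T : ℕ} (mle : ℕ → Param d → (Fin n → S) → (Fin m → ℝ)) (θ₀ : Param d)
    (z : IterData S A n N H) (ω : Fin T → IterData S A n N H) (t : ℕ) :
    iterate γ ψ F p mle α θ₀ (Fin.cons z ω : Fin (T + 1) → IterData S A n N H) (t + 1)
      = iterate γ ψ F p (fun t => mle (t + 1)) α (update γ ψ F p α (mle 0 θ₀ z.1) θ₀ z) ω t := by
  induction t with
  | zero => simp [iterate]
  | succ t ih =>
    rw [iterate, ih, iterate]
    by_cases h : t < T
    · have h' : t + 1 < T + 1 := by omega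
      have e : (Fin.cons z ω : Fin (T + 1) → IterData S A n N H) ⟨t + 1, h'⟩ = ω ⟨t, h⟩ := rfl
      simp only [h, h', dite_true, e]
    · have h' : ¬ t + 1 < T + 1 := by omega
      simp only [h, h', dite_false]

theorem runExp_zero (mle : ℕ → Param d → (Fin n → S) → (Fin m → ℝ)) (θ₀ : Param d)
    (f : (Fin 0 → IterData S A n N H) → ℝ) :
    runExp M γ ψ F p mle α θ₀ f = f default := by
  simp [runExp, runProb]

/-- The tower property: conditioning on the data of the first iteration. -/
theorem runExp_succ {T : ℕ} (mle : ℕ → Param d → (Fin n → S) → (Fin m → ℝ)) (θ₀ : Param d)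
    (f : (Fin (T + 1) → IterData S A n N H) → ℝ) :
    runExp M γ ψ F p mle α θ₀ f = ∑ z, iterProb M γ ψ θ₀ z *
      runExp M γ ψ F p (fun t => mle (t + 1)) α (update γ ψ F p α (mle 0 θ₀ z.1) θ₀ z)
        (fun ω => f (Fin.cons z ω)) := by
  rw [runExp, sum_tuple_succ]
  refine Finset.sum_congr rfl fun z _ => ?_
  rw [runExp, Finset.mul_sum]
  refine Finset.sum_congr rfl fun ω _ => ?_
  rw [runProb, Fin.prod_univ_succ, runProb, ← mul_assoc]
  congr 2
  refine Finset.prod_congr rfl fun t _ => ?_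
  rw [Fin.val_succ, iterate_cons, Fin.cons_succ]

/-- Almost surely staying in `Θ`, the expectation is the one on that event. -/
theorem runExp_eq_indicator {T : ℕ} {mle : ℕ → Param d → (Fin n → S) → (Fin m → ℝ)}
    {θ₀ : Param d} {s : Set (Fin T → IterData S A n N H)}
    (hs : ∀ ω, runProb M γ ψ F p mle α θ₀ ω ≠ 0 → ω ∈ s) (f : (Fin T → IterData S A n N H) → ℝ) :
    runExp M γ ψ F p mle α θ₀ f = runExp M γ ψ F p mle α θ₀ (s.indicator f) := by
  refine Finset.sum_congr rfl fun ω _ => ?_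
  by_cases h : runProb M γ ψ F p mle α θ₀ ω = 0
  · rw [h, zero_mul, zero_mul]
  · rw [Set.indicator_of_mem (hs ω h)]

/-- The Lipschitz weights of the class can be taken nonnegative. -/
theorem ClassRegular.exists_nonneg_lipschitz {Bω BL : ℝ}
    (hclass : ClassRegular M γ ψ Ω p Bω BL)
    (hBL : 0 ≤ BL) : ∃ L : S → ℝ, (∀ s, 0 ≤ L s) ∧
      (∀ w ∈ Ω, ∀ w' ∈ Ω, ∀ s, |p w s - p w' s| ≤ L s * ‖w' - w‖) ∧ ∑ s, L s ≤ BL := by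
  obtain ⟨L, hL, hsum⟩ := hclass.lipschitz
  -- Two distinct parameters force `L s ≥ 0`; otherwise the Lipschitz condition says nothing about
  -- the sign of `L`, and zero weights work.
  by_cases h : Ω.Subsingleton
  · refine ⟨fun _ => 0, fun _ => le_rfl, fun w hw w' hw' s => ?_, by simpa using hBL⟩
    rw [h hw hw']
    simp
  · rw [Set.not_subsingleton_iff] at h
    obtain ⟨w, hw, w', hw', hne⟩ := h
    refine ⟨L, fun s => ?_, hL, hsum⟩
    exact nonneg_of_mul_nonneg_left ((abs_nonneg _).trans (hL w hw w' hw' s))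
      (norm_pos_iff.2 (sub_ne_zero.2 hne.symm))

variable [Nonempty A]

theorem iterProb_mem_stdSimplex (hγ0 : 0 ≤ γ) (hγ1 : γ < 1) (M : MDP S A) (θ : Param d) :
    (iterProb M γ ψ θ : IterData S A n N H → ℝ) ∈ stdSimplex ℝ (IterData S A n N H) := by
  have hpol := softmaxPolicy_mem_stdSimplex ψ θ
  have hocc := stateOcc_mem_stdSimplex hγ0 hγ1 M hpol
  have htraj := trajProb_mem_stdSimplex M hpol H
  refine ⟨fun z => mul_nonneg (Finset.prod_nonneg fun i _ => hocc.1 _)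
    (Finset.prod_nonneg fun i _ => htraj.1 _), ?_⟩
  rw [Fintype.sum_prod_type]
  simp only [iterProb, ← Finset.mul_sum, sum_prod_eq_one htraj, mul_one, sum_prod_eq_one hocc]

/-- A one-step contraction in expectation on `Θ` gives a bound of the final expectation, on the
event that the iterates stay in `Θ`. -/
theorem runExp_indicator_le (hγ0 : 0 ≤ γ) (hγ1 : γ < 1) {Θ : Set (Param d)} {D : Param d → ℝ}
    (hD : ∀ θ, 0 ≤ D θ) {c b : ℝ} (hc0 : 0 ≤ c) (hc1 : c ≤ 1) (hb : 0 ≤ b)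
    (hstep : ∀ θ ∈ Θ, ∀ sel : (Fin n → S) → (Fin m → ℝ), (∀ x, IsMLE Ω p x (sel x)) →
      ∑ z : IterData S A n N H, iterProb M γ ψ θ z * D (update γ ψ F p α (sel z.1) θ z)
        ≤ (1 - c) * D θ + c * b)
    (T : ℕ) (mle : ℕ → Param d → (Fin n → S) → (Fin m → ℝ))
    (hmle : ∀ t θ x, IsMLE Ω p x (mle t θ x)) (θ₀ : Param d) :
    runExp M γ ψ F p mle α θ₀ (Set.indicator {ω : Fin T → IterData S A n N H |
        ∀ t < T, iterate γ ψ F p mle α θ₀ ω t ∈ Θ}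
      (fun ω => D (iterate γ ψ F p mle α θ₀ ω T)))
      ≤ (1 - c) ^ T * D θ₀ + (1 - (1 - c) ^ T) * b := by
  induction T generalizing mle θ₀ with
  | zero =>
    rw [runExp_zero]
    simp [iterate]
  | succ T ih =>
    have hq0 : 0 ≤ (1 - c) ^ T := pow_nonneg (by linarith) T
    have hq1 : (1 - c) ^ T ≤ 1 := pow_le_one₀ (by linarith) (by linarith)
    have hq1' : (1 - c) ^ (T + 1) ≤ 1 := pow_le_one₀ (by linarith) (by linarith)
    have hprob := iterProb_mem_stdSimplex (ψ := ψ) (n := n) (N := N) (H := H) hγ0 hγ1 M θ₀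
    rw [runExp_succ]
    by_cases hθ : θ₀ ∈ Θ
    · have hind : ∀ z : IterData S A n N H, (fun ω : Fin T → IterData S A n N H =>
          Set.indicator {ω : Fin (T + 1) → IterData S A n N H |
            ∀ t < T + 1, iterate γ ψ F p mle α θ₀ ω t ∈ Θ}
            (fun ω => D (iterate γ ψ F p mle α θ₀ ω (T + 1))) (Fin.cons z ω))
          = Set.indicator {ω : Fin T → IterData S A n N H | ∀ t < T,
              iterate γ ψ F p (fun t => mle (t + 1)) α
                (update γ ψ F p α (mle 0 θ₀ z.1) θ₀ z) ω t ∈ Θ}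
            (fun ω => D (iterate γ ψ F p (fun t => mle (t + 1)) α
              (update γ ψ F p α (mle 0 θ₀ z.1) θ₀ z) ω T)) := by
        intro z
        funext ω
        simp only [Set.indicator, Set.mem_ofPred_eq, iterate_cons]
        congr 1
        refine propext ⟨fun h t ht => ?_, fun h t ht => ?_⟩
        · rw [← iterate_cons]
          exact h (t + 1) (by omega)
        · rcases t with _ | t
          · exact hθ
          · rw [iterate_cons]
            exact h t (by omega)
      simp only [hind]
      calc _ ≤ ∑ z : IterData S A n N H, iterProb M γ ψ θ₀ z *
            ((1 - c) ^ T * D (update γ ψ F p α (mle 0 θ₀ z.1) θ₀ z) + (1 - (1 - c) ^ T) * b) :=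
            Finset.sum_le_sum fun z _ => mul_le_mul_of_nonneg_left
              (ih (fun t => mle (t + 1)) (fun t => hmle (t + 1)) _) (hprob.1 z)
        _ = (1 - c) ^ T * (∑ z : IterData S A n N H, iterProb M γ ψ θ₀ z *
              D (update γ ψ F p α (mle 0 θ₀ z.1) θ₀ z)) + (1 - (1 - c) ^ T) * b := by
            have e : (1 - (1 - c) ^ T) * b = ∑ z : IterData S A n N H,
                iterProb M γ ψ θ₀ z * ((1 - (1 - c) ^ T) * b) := by
              rw [← Finset.sum_mul, hprob.2, one_mul]
            conv_rhs => rw [e, Finset.mul_sum, ← Finset.sum_add_distrib]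
            exact Finset.sum_congr rfl fun z _ => by ring
        _ ≤ (1 - c) ^ T * ((1 - c) * D θ₀ + c * b) + (1 - (1 - c) ^ T) * b := by
            gcongr
            exact hstep θ₀ hθ (mle 0 θ₀) (hmle 0 θ₀)
        _ = _ := by ring
    -- Starting outside `Θ` the event is empty, and the claimed bound is nonnegative.
    · have hind : ∀ z : IterData S A n N H, (fun ω : Fin T → IterData S A n N H =>
          Set.indicator {ω : Fin (T + 1) → IterData S A n N H |
            ∀ t < T + 1, iterate γ ψ F p mle α θ₀ ω t ∈ Θ}
            (fun ω => D (iterate γ ψ F p mle α θ₀ ω (T + 1))) (Fin.cons z ω)) = fun _ => 0 := by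
        intro z
        funext ω
        refine Set.indicator_of_notMem ?_ _
        rw [Set.mem_ofPred_eq]
        exact fun h => hθ (h 0 (Nat.succ_pos T))
      simp only [hind]
      have : 0 ≤ (1 - c) ^ (T + 1) * D θ₀ + (1 - (1 - c) ^ (T + 1)) * b :=
        add_nonneg (mul_nonneg (pow_nonneg (by linarith) _) (hD θ₀))
          (mul_nonneg (by linarith) hb)
      simpa [runExp] using this

variable {lψ Lψ lF LF Bω BL : ℝ}

/-- Expected suboptimality after one iteration from a parameter in the overparametrized set. -/
theorem sum_iterProb_mul_suboptimality_le (hγ0 : 0 ≤ γ) (hγ1 : γ < 1)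
    (hψ : SoftmaxRegular ψ lψ Lψ) (hlψ : 0 ≤ lψ) (hLψ : 0 ≤ Lψ) (hlF : 0 ≤ lF) (hLF : 0 ≤ LF)
    (hclass : ClassRegular M γ ψ Ω p Bω BL) (hF : UtilitySmooth F (jointClass ψ Ω p) lF LF)
    (hconc : ConcaveWithin F (jointClass ψ Ω p))
    {lam : Param d → SAVec S A} (hlam : ∀ θ, lam θ = occ M γ (softmaxPolicy ψ θ)) {θs : Param d}
    {Θ : Set (Param d)} {l : NNReal} {ηbar : ℝ} (hover : Overparam lam Θ θs l ηbar) {θ : Param d}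
    (hθ : θ ∈ Θ) {η : ℝ} (hη0 : 0 < η) (hη : η ≤ ηbar) (hη1 : η ≤ 1) {a : ℝ} (ha : 0 < a)
    (haL : a * smoothConst γ lψ Lψ lF LF ≤ 1 / 4) (sel : (Fin n → S) → (Fin m → ℝ)) {V : ℝ}
    (hV : ∑ z : IterData S A n N H, iterProb M γ ψ θ z *
      ‖valueGrad M γ ψ θ (gradient F (lam θ)) - (N : ℝ)⁻¹ • ∑ i, pgEstimate γ ψ (z.2 i) θ
        (gradient F (joint (p (sel z.1)) (softmaxPolicy ψ θ)))‖ ^ 2 ≤ V) :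
    ∑ z : IterData S A n N H, iterProb M γ ψ θ z *
        (F (lam θs) - F (lam (update γ ψ F p ((1 - γ) * a) (sel z.1) θ z)))
      ≤ (1 - η) * (F (lam θs) - F (lam θ)) + (2 * l * η) ^ 2 / a + 2 * a * V := by
  obtain ⟨θ', -, h1, h2⟩ := exists_improving_param hγ0 hγ1 hclass hconc hlam hover hθ hη0 hη hη1
  have hprob := iterProb_mem_stdSimplex (ψ := ψ) (n := n) (N := N) (H := H) hγ0 hγ1 M θ
  set err : IterData S A n N H → ℝ := fun z => ‖valueGrad M γ ψ θ (gradient F (lam θ))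
    - (N : ℝ)⁻¹ • ∑ i, pgEstimate γ ψ (z.2 i) θ
        (gradient F (joint (p (sel z.1)) (softmaxPolicy ψ θ)))‖ ^ 2 with herr
  have hpt : ∀ z : IterData S A n N H,
      F (lam θs) - F (lam (update γ ψ F p ((1 - γ) * a) (sel z.1) θ z))
        ≤ (1 - η) * (F (lam θs) - F (lam θ)) + (2 * l * η) ^ 2 / a + 2 * a * err z := by
    intro z
    set v := (N : ℝ)⁻¹ • ∑ i, pgEstimate γ ψ (z.2 i) θ
      (gradient F (joint (p (sel z.1)) (softmaxPolicy ψ θ))) with hv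
    -- The estimate targets the gradient of the unnormalized value, which is `1 / (1 - γ)` times
    -- that of the objective; the step size `(1 - γ) * a` is thus an ascent step of size `a`.
    have hupd : update γ ψ F p ((1 - γ) * a) (sel z.1) θ z = θ + a • ((1 - γ) • v) := by
      rw [update, hv]
      simp only [smul_smul]
      congr 2
      ring
    have h3 := le_of_gradient_step (abs_objective_sub_le hγ0 hγ1 hψ hlψ hLψ hlF hLF hclass hF) ha
      haL θ θ' ((1 - γ) • v)
    simp only [← hlam] at h3
    have h4 : ‖objGrad M γ ψ F θ - (1 - γ) • v‖ ^ 2 ≤ err z := by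
      rw [objGrad, ← hlam, ← smul_sub, norm_smul, Real.norm_of_nonneg (by linarith), mul_pow]
      exact mul_le_of_le_one_left (sq_nonneg _) (pow_le_one₀ (by linarith) (by linarith))
    have h5 : ‖θ' - θ‖ ^ 2 / a ≤ (2 * l * η) ^ 2 / a := by gcongr
    have h6 := mul_le_mul_of_nonneg_left h4 (show 0 ≤ 2 * a by positivity)
    rw [hupd]
    linarith
  calc _ ≤ ∑ z, iterProb M γ ψ θ z *
          ((1 - η) * (F (lam θs) - F (lam θ)) + (2 * l * η) ^ 2 / a + 2 * a * err z) :=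
        Finset.sum_le_sum fun z _ => mul_le_mul_of_nonneg_left (hpt z) (hprob.1 z)
    _ = (1 - η) * (F (lam θs) - F (lam θ)) + (2 * l * η) ^ 2 / a
          + 2 * a * ∑ z, iterProb M γ ψ θ z * err z := by
        simp only [mul_add (iterProb M γ ψ θ _), Finset.sum_add_distrib, ← Finset.sum_mul, hprob.2,
          one_mul]
        congr 1
        rw [Finset.mul_sum]
        exact Finset.sum_congr rfl fun z _ => by ring
    _ ≤ _ := by gcongr

/-- Mean square error of the gradient estimate of one iteration with maximum likelihood
estimation of the occupancy measure. -/
theorem sum_iterProb_mul_sq_mle_error_le {β : ℝ} (hβ0 : 0 ≤ β) (hβ1 : β < 1)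
    (hψ : SoftmaxRegular ψ lψ Lψ) (hlψ : 0 ≤ lψ) (hLF : 0 ≤ LF) (hBω : 0 ≤ Bω) (hBL : 0 ≤ BL)
    (hclass : ClassRegular M (β ^ 2) ψ Ω p Bω BL)
    (hF : UtilitySmooth F (jointClass ψ Ω p) lF LF) (hN : 0 < N) (hn : 0 < n) {δ : ℝ} (hδ : 0 < δ)
    (hδB : BL * δ ≤ 1) (θ : Param d) (sel : (Fin n → S) → (Fin m → ℝ))
    (hsel : ∀ x, IsMLE Ω p x (sel x)) :
    ∑ z : IterData S A n N H, iterProb M (β ^ 2) ψ θ z *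
      ‖valueGrad M (β ^ 2) ψ θ (gradient F (occ M (β ^ 2) (softmaxPolicy ψ θ)))
        - (N : ℝ)⁻¹ • ∑ i, pgEstimate (β ^ 2) ψ (z.2 i) θ
          (gradient F (joint (p (sel z.1)) (softmaxPolicy ψ θ)))‖ ^ 2
      ≤ 3 * ((β ^ H * (quadGeom β * (2 * lψ) * lF)) ^ 2
        + (2 * lψ * (1 - β ^ 2)⁻¹ ^ 2 * lF) ^ 2 / N + (2 * lψ * (1 - β ^ 2)⁻¹ ^ 2) ^ 2 *
          (LF ^ 2 * (48 * (m * Real.log (2 * Bω / δ + 1)) / n + 32 * (BL * δ)))) := by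
  have hγ0 : 0 ≤ β ^ 2 := by positivity
  have hγ1 : β ^ 2 < 1 := pow_lt_one₀ hβ0 hβ1 two_ne_zero
  have hpol := softmaxPolicy_mem_stdSimplex ψ θ
  have hocc := stateOcc_mem_stdSimplex hγ0 hγ1 M hpol
  obtain ⟨L, hL0, hL, hLB⟩ := hclass.exists_nonneg_lipschitz hBL
  refine sum_iterProb_mul_sq_error_le hψ hlψ M hβ0 hβ1 θ (hF.grad_le _ (hclass.occ_mem θ)) hN
    (fun x => gradient F (joint (p (sel x)) (softmaxPolicy ψ θ))) ?_
  have hmle := sum_prod_mul_sq_mle_error_le hclass.mem_simplex hBω hδ hclass.norm_le hL0 hLB hL hδB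
    (hclass.realizable θ) hn sel hsel
  refine le_trans ?_ (mul_le_mul_of_nonneg_left hmle (sq_nonneg LF))
  rw [Finset.mul_sum]
  refine Finset.sum_le_sum fun x _ => ?_
  have h1 : ‖gradient F (joint (p (sel x)) (softmaxPolicy ψ θ))
      - gradient F (occ M (β ^ 2) (softmaxPolicy ψ θ))‖
      ≤ LF * ∑ s, |p (sel x) s - stateOcc M (β ^ 2) (softmaxPolicy ψ θ) s| := by
    refine (hF.grad_lip _ ⟨_, (hsel x).1, θ, rfl⟩ _ (hclass.occ_mem θ)).trans ?_
    refine mul_le_mul_of_nonneg_left ?_ hLF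
    rw [occ, joint_sub]
    exact norm_joint_le hpol _
  have h2 := pow_le_pow_left₀ (norm_nonneg _) h1 2
  rw [mul_pow] at h2
  calc _ ≤ (∏ i, stateOcc M (β ^ 2) (softmaxPolicy ψ θ) (x i)) *
        (LF ^ 2 * (∑ s, |p (sel x) s - stateOcc M (β ^ 2) (softmaxPolicy ψ θ) s|) ^ 2) :=
        mul_le_mul_of_nonneg_left h2 (Finset.prod_nonneg fun i _ => hocc.1 _)
    _ = _ := by ring

end Run

/-! ### Choice of constants -/

section Constants

theorem log_two_le_log {ε : ℝ} (hε : 0 < ε) : Real.log 2 ≤ Real.log (2 + 1 / ε) :=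
  Real.log_le_log two_pos (by have : 0 < 1 / ε := by positivity
                              linarith)

/-- A horizon of order `log (2 + 1/ε)` makes a geometric tail of order `ε`. -/
theorem exists_horizon_const {β c : ℝ} (hβ0 : 0 < β) (hβ1 : β < 1) (hc : 0 < c) :
    ∃ CH : ℝ, 0 < CH ∧ ∀ ε : ℝ, 0 < ε → ∀ H : ℕ, CH * Real.log (2 + 1 / ε) ≤ H →
      β ^ H ≤ c * ε := by
  have hl2 : 0 < Real.log 2 := Real.log_pos one_lt_two
  have hb : 0 < -Real.log β := neg_pos.2 (Real.log_neg hβ0 hβ1)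
  -- The summand 1 produces `exp (-Λ) ≤ ε`; the other produces `exp (-(1/c)) ≤ c`, using `Λ ≥ log
  -- 2`.
  set k : ℝ := 1 + 1 / (c * Real.log 2) with hk
  have hk0 : 0 < k := by positivity
  refine ⟨k / (-Real.log β), by positivity, fun ε hε H hH => ?_⟩
  have hL := log_two_le_log hε
  set Λ := Real.log (2 + 1 / ε) with hΛ
  have hε' : 0 < 1 / ε := by positivity
  have h1 : k * Λ ≤ H * (-Real.log β) := by
    rwa [div_mul_eq_mul_div, div_le_iff₀ hb] at hH
  have h2 : β ^ H = Real.exp (-(H * (-Real.log β))) := by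
    rw [← Real.rpow_natCast, Real.rpow_def_of_pos hβ0]
    congr 1; ring
  have h3 : 1 / c ≤ 1 / (c * Real.log 2) * Λ := by
    rw [div_mul_eq_mul_div, one_mul, div_le_div_iff₀ hc (by positivity)]
    nlinarith
  have h4 : Real.exp (-Λ) ≤ ε := by
    rw [Real.exp_neg, hΛ, Real.exp_log (by positivity)]
    refine (inv_anti₀ hε' (by linarith)).trans_eq ?_
    simp
  have h5 : Real.exp (-(1 / c)) ≤ c := by
    rw [Real.exp_neg]
    refine (inv_anti₀ (by positivity) ((le_add_of_nonneg_right zero_le_one).trans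
      (Real.add_one_le_exp (1 / c)))).trans_eq ?_
    simp
  calc β ^ H ≤ Real.exp (-(1 / c) + -Λ) := by
        rw [h2, Real.exp_le_exp]
        rw [hk, add_mul, one_mul] at h1
        linarith
    _ = Real.exp (-(1 / c)) * Real.exp (-Λ) := Real.exp_add _ _
    _ ≤ c * ε := by gcongr

/-- A sample of size `m ε⁻² log (2 + 1/ε)` makes the bound of the maximum likelihood error of
order `ε²`. -/
theorem exists_sample_const {B BL R c : ℝ} (hB : 0 ≤ B) (hBL : 0 ≤ BL) (hR : 0 < R) (hc : 0 < c) :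
    ∃ Cn : ℝ, 0 < Cn ∧ ∀ ε : ℝ, 0 < ε → ε ≤ R → ∀ m n : ℕ, 1 ≤ m →
      Cn * m / ε ^ 2 * Real.log (2 + 1 / ε) ≤ n →
      0 < n ∧ ∃ δ : ℝ, 0 < δ ∧ BL * δ ≤ 1 ∧
        48 * (m * Real.log (2 * B / δ + 1)) / n + 32 * (BL * δ) ≤ c * ε ^ 2 := by
  have hl2 : 0 < Real.log 2 := Real.log_pos one_lt_two
  -- The cell size is `δ = k ε²`. The first bound gives the discretization error half of `c ε²`; the
  -- second ensures `BL * δ ≤ 1` since `ε ≤ R`.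
  set k : ℝ := min (c / (64 * (BL + 1))) (1 / (R ^ 2 * (BL + 1))) with hk
  have hk0 : 0 < k := lt_min (by positivity) (by positivity)
  have hk1 : BL * k ≤ c / 64 := by
    calc BL * k ≤ (BL + 1) * (c / (64 * (BL + 1))) := by
          gcongr
          · linarith
          · exact min_le_left _ _
      _ = c / 64 := by field_simp
  have hk2 : BL * k * R ^ 2 ≤ 1 := by
    calc BL * k * R ^ 2 ≤ (BL + 1) * (1 / (R ^ 2 * (BL + 1))) * R ^ 2 := by
          gcongr
          · linarith
          · exact min_le_right _ _
      _ = 1 := by field_simp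
  have hlogk : 0 ≤ Real.log (2 * B / k + 1) :=
    Real.log_nonneg (le_add_of_nonneg_left (by positivity))
  set C₂ : ℝ := Real.log (2 * B / k + 1) / Real.log 2 + 2 with hC₂
  have hC₂0 : 0 < C₂ := by positivity
  refine ⟨96 * C₂ / c, by positivity, fun ε hε hεR m n hm hn => ?_⟩
  have hL := log_two_le_log hε
  set Λ := Real.log (2 + 1 / ε) with hΛ
  have hΛ0 : 0 < Λ := hl2.trans_le hL
  have hm' : (0 : ℝ) < m := by exact_mod_cast hm
  have hn' : (0 : ℝ) < n := lt_of_lt_of_le (by positivity) hn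
  refine ⟨by exact_mod_cast hn', k * ε ^ 2, by positivity, ?_, ?_⟩
  · calc BL * (k * ε ^ 2) ≤ BL * k * R ^ 2 := by
          rw [← mul_assoc]
          gcongr
      _ ≤ 1 := hk2
  · have h1 : Real.log (2 * B / (k * ε ^ 2) + 1) ≤ C₂ * Λ := by
      have h2 : 2 * B / (k * ε ^ 2) + 1 ≤ (2 * B / k + 1) * (2 + 1 / ε) ^ 2 := by
        have e : 2 * B / (k * ε ^ 2) = 2 * B / k * (1 / ε) ^ 2 := by field_simp
        rw [e]
        have : 0 < 1 / ε := by positivity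
        have : 0 ≤ 2 * B / k := by positivity
        nlinarith [mul_nonneg this (show (0:ℝ) ≤ 4 + 4 * (1 / ε) by positivity)]
      calc _ ≤ Real.log ((2 * B / k + 1) * (2 + 1 / ε) ^ 2) :=
            Real.log_le_log (by positivity) h2
        _ = Real.log (2 * B / k + 1) + 2 * Λ := by
            rw [Real.log_mul (by positivity) (by positivity), Real.log_pow, Nat.cast_ofNat, ← hΛ]
        _ ≤ Real.log (2 * B / k + 1) / Real.log 2 * Λ + 2 * Λ := by
            gcongr
            rw [div_mul_eq_mul_div, le_div_iff₀ hl2]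
            gcongr
        _ = _ := by rw [hC₂]; ring
    have h3 : 48 * (m * Real.log (2 * B / (k * ε ^ 2) + 1)) / n ≤ c / 2 * ε ^ 2 := by
      rw [div_le_iff₀ hn']
      calc _ ≤ 48 * (m * (C₂ * Λ)) := by gcongr
        _ = c / 2 * ε ^ 2 * (96 * C₂ / c * m / ε ^ 2 * Λ) := by field_simp; ring
        _ ≤ _ := by gcongr
    have h4 : 32 * (BL * (k * ε ^ 2)) ≤ c / 2 * ε ^ 2 := by
      have := mul_le_mul_of_nonneg_right hk1 (sq_nonneg ε)
      linarith
    linarith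

/-- The total number of samples. -/
theorem exists_total_const {R cη CN Cn : ℝ} (hR : 0 < R) (hcη : 0 < cη) (hCN : 0 < CN)
    (hCn : 0 < Cn) :
    ∃ C : ℝ, 0 < C ∧ ∀ ε : ℝ, 0 < ε → ∀ D : ℝ, 0 ≤ D → D ≤ R → ∀ m : ℕ, 1 ≤ m →
      (⌈1 / (cη * ε ^ 2) * Real.log (D / ε)⌉₊ : ℝ) *
          ((⌈CN / ε ^ 2⌉₊ : ℝ) + (⌈Cn * m / ε ^ 2 * Real.log (2 + 1 / ε)⌉₊ : ℝ))
        ≤ C * m / ε ^ 4 * Real.log (2 + 1 / ε) ^ 2 := by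
  have hl2 : 0 < Real.log 2 := Real.log_pos one_lt_two
  have hlR : 0 ≤ Real.log (R + 1) := Real.log_nonneg (by linarith)
  set C₃ : ℝ := Real.log (R + 1) / Real.log 2 + 1 with hC₃
  have hC₃0 : 0 < C₃ := by positivity
  set CT : ℝ := C₃ / cη + R ^ 2 / Real.log 2 with hCT
  set CS : ℝ := (CN + R ^ 2) / Real.log 2 + (Cn + R ^ 2 / Real.log 2) with hCS
  have hCT0 : 0 < CT := by positivity
  have hCS0 : 0 < CS := by positivity
  refine ⟨CT * CS, by positivity, fun ε hε D hD hDR m hm => ?_⟩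
  have hL := log_two_le_log hε
  set Λ := Real.log (2 + 1 / ε) with hΛ
  have hΛ0 : 0 < Λ := hl2.trans_le hL
  have hm' : (1 : ℝ) ≤ m := by exact_mod_cast hm
  rcases le_or_gt D ε with hDε | hDε
  · have : Real.log (D / ε) ≤ 0 :=
      Real.log_nonpos (by positivity) ((div_le_one hε).2 hDε)
    rw [Nat.ceil_eq_zero.2 (mul_nonpos_of_nonneg_of_nonpos (by positivity) this)]
    simp only [Nat.cast_zero, zero_mul]
    positivity
  · have hεR : ε ≤ R := hDε.le.trans hDR
    have hD0 : 0 < D := hε.trans hDε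
    -- Since `ε ≤ R` here, the `+1` of each ceiling is absorbed into a multiple of `ε⁻²`.
    have hone : 1 ≤ R ^ 2 / ε ^ 2 := (one_le_div (by positivity)).2 (by gcongr)
    have hΛ1 : 1 ≤ Λ / Real.log 2 := (one_le_div hl2).2 hL
    have hlog : Real.log (D / ε) ≤ C₃ * Λ := by
      calc _ ≤ Real.log ((R + 1) * (2 + 1 / ε)) := by
            refine Real.log_le_log (by positivity) ?_
            have : D / ε = D * (1 / ε) := by ring
            rw [this]
            exact mul_le_mul (by linarith) (by linarith) (by positivity) (by positivity)
        _ = Real.log (R + 1) * 1 + Λ := by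
            rw [Real.log_mul (by positivity) (by positivity), mul_one]
        _ ≤ Real.log (R + 1) * (Λ / Real.log 2) + Λ := by gcongr
        _ = _ := by rw [hC₃]; ring
    have hlog0 : 0 ≤ Real.log (D / ε) := Real.log_nonneg ((one_le_div hε).2 hDε.le)
    have hT : (⌈1 / (cη * ε ^ 2) * Real.log (D / ε)⌉₊ : ℝ) ≤ CT * Λ / ε ^ 2 := by
      refine (Nat.ceil_lt_add_one (by positivity)).le.trans ?_
      calc _ ≤ 1 / (cη * ε ^ 2) * (C₃ * Λ) + R ^ 2 / ε ^ 2 * (Λ / Real.log 2) := by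
            gcongr
            exact one_le_mul_of_one_le_of_one_le hone hΛ1
        _ = _ := by rw [hCT]; field_simp
    have hN : (⌈CN / ε ^ 2⌉₊ : ℝ) ≤ (CN + R ^ 2) / Real.log 2 * (m * Λ) / ε ^ 2 := by
      refine (Nat.ceil_lt_add_one (by positivity)).le.trans ?_
      calc _ ≤ CN / ε ^ 2 + R ^ 2 / ε ^ 2 := by gcongr
        _ = (CN + R ^ 2) / ε ^ 2 * 1 := by ring
        _ ≤ (CN + R ^ 2) / ε ^ 2 * (m * (Λ / Real.log 2)) := by
            gcongr
            exact one_le_mul_of_one_le_of_one_le hm' hΛ1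
        _ = _ := by ring
    have hn : (⌈Cn * m / ε ^ 2 * Λ⌉₊ : ℝ) ≤ (Cn + R ^ 2 / Real.log 2) * (m * Λ) / ε ^ 2 := by
      refine (Nat.ceil_lt_add_one (by positivity)).le.trans ?_
      calc _ ≤ Cn * m / ε ^ 2 * Λ + R ^ 2 / ε ^ 2 * (m * (Λ / Real.log 2)) := by
            gcongr
            exact one_le_mul_of_one_le_of_one_le hone (one_le_mul_of_one_le_of_one_le hm' hΛ1)
        _ = _ := by ring
    calc _ ≤ CT * Λ / ε ^ 2 * ((CN + R ^ 2) / Real.log 2 * (m * Λ) / ε ^ 2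
          + (Cn + R ^ 2 / Real.log 2) * (m * Λ) / ε ^ 2) := by gcongr
      _ = _ := by rw [hCS]; field_simp

/-- The number of iterations suffices for a contraction at twice the nominal rate. -/
theorem contraction_le {ε η D : ℝ} (hε : 0 < ε) (hη : 0 < η) (hη1 : 2 * η ≤ 1) (hD : ε < D)
    {T : ℕ} (hT : 1 / η * Real.log (D / ε) ≤ T) :
    (1 - 2 * η) ^ T * D + (1 - (1 - 2 * η) ^ T) * (ε / 2) ≤ ε := by
  have hD0 : 0 < D := hε.trans hD
  -- The nominal rate would give only `ε / D`, which leaves the total above `ε` as soon as `D > ε`;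
  -- the doubled rate squares it.
  have hq : (1 - 2 * η) ^ T ≤ (ε / D) ^ 2 := by
    have h1 : Real.log (D / ε) ≤ T * η := by
      rwa [one_div_mul_eq_div, div_le_iff₀ hη] at hT
    calc (1 - 2 * η) ^ T ≤ Real.exp (-(2 * η)) ^ T := by
          gcongr
          exact Real.one_sub_le_exp_neg _
      _ = Real.exp (-(T * η)) ^ 2 := by
          rw [← Real.exp_nat_mul, ← Real.exp_nat_mul]
          congr 1
          push_cast; ring
      _ ≤ Real.exp (-Real.log (D / ε)) ^ 2 := by gcongr
      _ = (ε / D) ^ 2 := by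
          rw [Real.exp_neg, Real.exp_log (by positivity), inv_div]
  -- After clearing denominators this is `(D - ε)² ≥ 0`.
  have h2 : (ε / D) ^ 2 * (D - ε / 2) ≤ ε / 2 := by
    rw [div_pow, div_mul_eq_mul_div, div_le_iff₀ (by positivity)]
    nlinarith [mul_nonneg hε.le (sq_nonneg (D - ε))]
  have h3 := mul_le_mul_of_nonneg_right hq (show 0 ≤ D - ε / 2 by linarith)
  linarith

end Constants

end PGOMA

end

/-! ### The main theorem -/

theorem corollary2 (γ lψ Lψ lF LF ηbar Bω BL : ℝ) (l : NNReal)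
    (hγ0 : 0 < γ) (hγ1 : γ < 1) (hlψ : 0 < lψ) (hLψ : 0 < Lψ) (hlF : 0 < lF) (hLF : 0 < LF)
    (hl : 0 < l) (hηbar : 0 < ηbar) (hBω : 0 ≤ Bω) (hBL : 0 ≤ BL) :
    -- constants that depend only on the parameters above
    ∃ cα cη CN Cn CH C : ℝ, 0 < cα ∧ 0 < cη ∧ 0 < CN ∧ 0 < Cn ∧ 0 < CH ∧ 0 < C ∧
      ∀ (S : Type*) (A : Type*) [Fintype S] [Fintype A] [Nonempty A]
        (M : PGOMA.MDP S A) (d m : ℕ) (_hm : 1 ≤ m)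
        (ψ : S → A → PGOMA.Param d → ℝ) (_hψ : PGOMA.SoftmaxRegular ψ lψ Lψ)
        (Ω : Set (Fin m → ℝ)) (p : (Fin m → ℝ) → S → ℝ)
        (_hclass : PGOMA.ClassRegular M γ ψ Ω p Bω BL)
        (F : PGOMA.SAVec S A → ℝ)
        (_hsmooth : PGOMA.UtilitySmooth F (PGOMA.jointClass ψ Ω p) lF LF)
        (_hconc : PGOMA.ConcaveWithin F (PGOMA.jointClass ψ Ω p))
        (lam : PGOMA.Param d → PGOMA.SAVec S A)
        (_hlam : ∀ θ, lam θ = PGOMA.occ M γ (PGOMA.softmaxPolicy ψ θ))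
        -- an optimal parameter
        (θs : PGOMA.Param d) (_hθs : ∀ θ, F (lam θ) ≤ F (lam θs))
        (Θ : Set (PGOMA.Param d)) (_hover : PGOMA.Overparam lam Θ θs l ηbar)
        (θ₀ : PGOMA.Param d) (_hθ₀ : θ₀ ∈ Θ)
        (ε : ℝ) (_hε : 0 < ε)
        (α η : ℝ) (T N n H : ℕ)
        (_hα : α = cα * ε) (_hη : η = cη * ε ^ 2)
        (_hT : T = ⌈1 / η * Real.log ((F (lam θs) - F (lam θ₀)) / ε)⌉₊)
        (_hN : N = ⌈CN / ε ^ 2⌉₊)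
        (_hn : n = ⌈Cn * m / ε ^ 2 * Real.log (2 + 1 / ε)⌉₊)
        (_hH : CH * Real.log (2 + 1 / ε) ≤ H)
        (mle : ℕ → PGOMA.Param d → (Fin n → S) → (Fin m → ℝ))
        (_hmle : ∀ t θ x, PGOMA.IsMLE Ω p x (mle t θ x)),
        -- if the iterates stay in `Θ` almost surely (automatic when `Θ` is everything)
        ((∀ ω : Fin T → PGOMA.IterData S A n N H,
            PGOMA.runProb M γ ψ F p mle α θ₀ ω ≠ 0 →
            ∀ t < T, PGOMA.iterate γ ψ F p mle α θ₀ ω t ∈ Θ) →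
          PGOMA.runExp M γ ψ F p mle α θ₀ (fun ω : Fin T → PGOMA.IterData S A n N H =>
            F (lam θs) - F (lam (PGOMA.iterate γ ψ F p mle α θ₀ ω T))) ≤ ε) ∧
        -- in general, on the event that the iterates stay in `Θ`
        PGOMA.runExp M γ ψ F p mle α θ₀
          (Set.indicator {ω : Fin T → PGOMA.IterData S A n N H |
              ∀ t < T, PGOMA.iterate γ ψ F p mle α θ₀ ω t ∈ Θ}
            (fun ω => F (lam θs) - F (lam (PGOMA.iterate γ ψ F p mle α θ₀ ω T)))) ≤ ε ∧
        -- total sample complexity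
        (T : ℝ) * (N + n) ≤ C * m / ε ^ 4 * Real.log (2 + 1 / ε) ^ 2 := by
  classical
  have hγ0' := hγ0.le
  set β : ℝ := √γ with hβ
  have hβ2 : β ^ 2 = γ := Real.sq_sqrt hγ0'
  have hβ0 : 0 < β := Real.sqrt_pos.2 hγ0
  have hβ1 : β < 1 := by
    rw [hβ, Real.sqrt_lt' one_pos, one_pow]
    exact hγ1
  set L := PGOMA.smoothConst γ lψ Lψ lF LF with hL_def
  have hL : 0 ≤ L := PGOMA.smoothConst_nonneg hγ0' hLψ.le hlF.le hLF.le
  have hl' : (0 : ℝ) < l := by exact_mod_cast hl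
  have h1γ : 0 < 1 - γ := by linarith
  set ca : ℝ := 1 / (8 * lF * (L + 1)) with hca
  have hca0 : 0 < ca := by positivity
  set cη : ℝ := min (ca / (32 * l ^ 2)) (min ηbar 1 / (8 * lF ^ 2)) with hcη
  have hmin : 0 < min ηbar 1 := lt_min hηbar one_pos
  have hcη0 : 0 < cη := lt_min (by positivity) (by positivity)
  -- `ca` ensures `a * L ≤ 1/4` once `ε ≤ 2 lF`. In `cη`, the first bound makes the proximity term
  -- `(2l · 2η)² / a` at most `2η · ε/4`, the second makes `2η` admissible in the
  -- overparametrization condition.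
  have hcη1 : cη * (32 * (l : ℝ) ^ 2) ≤ ca := by
    rw [← le_div_iff₀ (by positivity)]
    exact min_le_left _ _
  have hcη2 : cη * (8 * lF ^ 2) ≤ min ηbar 1 := by
    rw [← le_div_iff₀ (by positivity)]
    exact min_le_right _ _
  -- the admissible mean square error of the gradient estimate is `κ ε²`
  set κ : ℝ := cη / (4 * ca) with hκ
  have hκ0 : 0 < κ := by positivity
  set K : ℝ := 2 * lψ * (1 - γ)⁻¹ ^ 2 with hK
  have hK0 : 0 < K := by positivity
  -- Each of the three error terms is allotted `κ ε² / 9`, as their sum is multiplied by 3.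
  set CN : ℝ := 9 * (K * lF) ^ 2 / κ with hCN
  have hCN0 : 0 < CN := by positivity
  set Cb : ℝ := PGOMA.quadGeom β * (2 * lψ) * lF with hCb
  have hCb0 : 0 ≤ Cb := by
    have := PGOMA.quadGeom_nonneg hβ0.le
    positivity
  -- The bias enters squared, hence `√κ / 3`; `Cb + 1` replaces `Cb`, which is only known to be
  -- nonnegative.
  obtain ⟨CH, hCH0, hCH⟩ := PGOMA.exists_horizon_const hβ0 hβ1
    (c := √κ / (3 * (Cb + 1))) (by positivity)
  obtain ⟨Cn, hCn0, hCn⟩ := PGOMA.exists_sample_const hBω hBL (R := 2 * lF) (by positivity)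
    (c := κ / (9 * (K ^ 2 * LF ^ 2))) (by positivity)
  obtain ⟨C, hC0, hC⟩ := PGOMA.exists_total_const (R := 2 * lF) (by positivity) hcη0 hCN0 hCn0
  refine ⟨(1 - γ) * ca, cη, CN, Cn, CH, C, by positivity, hcη0, hCN0, hCn0, hCH0, hC0, ?_⟩
  intro S A _ _ _ M d m hm ψ hψ Ω p hclass F hsmooth hconc lam hlam θs hθs Θ hover θ₀ hθ₀ ε hε
    α η T N n H hα hη hT hN hn hH mle hmle
  set D : PGOMA.Param d → ℝ := fun θ => F (lam θs) - F (lam θ) with hD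
  have hD0 : ∀ θ, 0 ≤ D θ := fun θ => sub_nonneg.2 (hθs θ)
  have hDR : D θ₀ ≤ 2 * lF := PGOMA.suboptimality_le hγ0' hγ1 hlF.le hclass hsmooth hconc hlam hηbar
    hover hθ₀
  have hgen : PGOMA.runExp M γ ψ F p mle α θ₀
      (Set.indicator {ω : Fin T → PGOMA.IterData S A n N H |
          ∀ t < T, PGOMA.iterate γ ψ F p mle α θ₀ ω t ∈ Θ}
        (fun ω => D (PGOMA.iterate γ ψ F p mle α θ₀ ω T))) ≤ ε := by
    rcases le_or_gt (D θ₀) ε with hDε | hDε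
    · have hlog : Real.log (D θ₀ / ε) ≤ 0 :=
        Real.log_nonpos (div_nonneg (hD0 θ₀) hε.le) ((div_le_one hε).2 hDε)
      have hη0 : 0 < η := by rw [hη]; positivity
      obtain rfl : T = 0 := by
        rw [hT]
        exact Nat.ceil_eq_zero.2 (mul_nonpos_of_nonneg_of_nonpos (by positivity) hlog)
      rw [PGOMA.runExp_zero]
      simpa [PGOMA.iterate] using hDε
    · have hεR : ε ≤ 2 * lF := hDε.le.trans hDR
      have hε2 : ε ^ 2 ≤ 4 * lF ^ 2 := by
        calc ε ^ 2 ≤ (2 * lF) ^ 2 := by gcongr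
          _ = _ := by ring
      have hη0 : 0 < η := by rw [hη]; positivity
      have hη2 : 2 * η ≤ min ηbar 1 := by
        refine le_trans ?_ hcη2
        rw [hη]
        nlinarith
      have hη1 : 2 * η ≤ 1 := hη2.trans (min_le_right _ _)
      have hN0 : 0 < N := by
        rw [hN]
        exact Nat.ceil_pos.2 (by positivity)
      have hNle : CN / ε ^ 2 ≤ N := by
        rw [hN]
        exact Nat.le_ceil _
      have hN' : (0 : ℝ) < N := by exact_mod_cast hN0
      obtain ⟨hn0, δ, hδ0, hδ1, hδ⟩ := hCn ε hε hεR m n hm (by rw [hn]; exact Nat.le_ceil _)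
      set a : ℝ := ca * ε with ha
      have ha0 : 0 < a := by positivity
      have haL : a * L ≤ 1 / 4 := by
        calc a * L ≤ ca * (2 * lF) * (L + 1) := by
              rw [ha]
              gcongr
              linarith
          _ = 1 / 4 := by rw [hca]; field_simp; norm_num
      have hαa : α = (1 - γ) * a := by rw [hα, ha]; ring
      have hstep : ∀ θ ∈ Θ, ∀ sel : (Fin n → S) → (Fin m → ℝ),
          (∀ x, PGOMA.IsMLE Ω p x (sel x)) →
          ∑ z : PGOMA.IterData S A n N H, PGOMA.iterProb M γ ψ θ z *
            D (PGOMA.update γ ψ F p α (sel z.1) θ z) ≤ (1 - 2 * η) * D θ + 2 * η * (ε / 2) := by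
        intro θ hθ sel hsel
        have herr : ∑ z : PGOMA.IterData S A n N H, PGOMA.iterProb M γ ψ θ z *
            ‖PGOMA.valueGrad M γ ψ θ (gradient F (lam θ)) - (N : ℝ)⁻¹ • ∑ i,
              PGOMA.pgEstimate γ ψ (z.2 i) θ
                (gradient F (PGOMA.joint (p (sel z.1)) (PGOMA.softmaxPolicy ψ θ)))‖ ^ 2
            ≤ κ * ε ^ 2 := by
          have hclass' : PGOMA.ClassRegular M (β ^ 2) ψ Ω p Bω BL := by rwa [hβ2]
          have h := PGOMA.sum_iterProb_mul_sq_mle_error_le (N := N) (H := H) hβ0.le hβ1 hψ hlψ.le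
            hLF.le hBω hBL hclass' hsmooth hN0 hn0 hδ0 hδ1 θ sel hsel
          rw [hβ2, ← hlam, ← hK, ← hCb] at h
          refine h.trans ?_
          have b1 : (β ^ H * Cb) ^ 2 ≤ κ * ε ^ 2 / 9 := by
            have h1 : β ^ H * Cb ≤ √κ * ε / 3 := by
              calc β ^ H * Cb ≤ √κ / (3 * (Cb + 1)) * ε * (Cb + 1) := by
                    gcongr
                    · exact hCH ε hε H hH
                    · linarith
                _ = _ := by field_simp
            calc _ ≤ (√κ * ε / 3) ^ 2 := by gcongr
              _ = √κ ^ 2 * ε ^ 2 / 9 := by ring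
              _ = _ := by rw [Real.sq_sqrt hκ0.le]
          have b2 : (K * lF) ^ 2 / N ≤ κ * ε ^ 2 / 9 := by
            rw [div_le_iff₀ hN']
            calc (K * lF) ^ 2 = κ * ε ^ 2 / 9 * (CN / ε ^ 2) := by rw [hCN]; field_simp
              _ ≤ _ := by gcongr
          have b3 : K ^ 2 * (LF ^ 2 * (48 * (m * Real.log (2 * Bω / δ + 1)) / n + 32 * (BL * δ)))
              ≤ κ * ε ^ 2 / 9 := by
            calc _ ≤ K ^ 2 * (LF ^ 2 * (κ / (9 * (K ^ 2 * LF ^ 2)) * ε ^ 2)) := by gcongr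
              _ = _ := by field_simp
          linarith
        have h := PGOMA.sum_iterProb_mul_suboptimality_le hγ0' hγ1 hψ hlψ.le hLψ.le hlF.le hLF.le
          hclass hsmooth hconc hlam hover hθ (show 0 < 2 * η by positivity)
          (hη2.trans (min_le_left _ _)) hη1 ha0 haL sel herr
        rw [← hαa] at h
        refine h.trans ?_
        have c1 : (2 * l * (2 * η)) ^ 2 / a ≤ 2 * η * (ε / 4) := by
          rw [div_le_iff₀ ha0, ha, hη]
          have := mul_le_mul_of_nonneg_right hcη1 (show 0 ≤ cη * ε ^ 4 / 2 by positivity)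
          linarith
        -- The definition of `κ` makes the gradient error term equal to the allowance of the
        -- proximity term.
        have c2 : 2 * a * (κ * ε ^ 2) = 2 * η * (ε / 4) := by
          rw [ha, hκ, hη]
          field_simp
        linarith
      have hTle : 1 / η * Real.log (D θ₀ / ε) ≤ T := by
        rw [hT]
        exact Nat.le_ceil _
      exact (PGOMA.runExp_indicator_le hγ0' hγ1 hD0 (show 0 ≤ 2 * η by positivity) hη1
        (show 0 ≤ ε / 2 by positivity) hstep T mle hmle θ₀).trans
        (PGOMA.contraction_le hε hη0 hη1 hDε hTle)
  refine ⟨fun has => ?_, hgen, ?_⟩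
  · rw [PGOMA.runExp_eq_indicator has]
    exact hgen
  · rw [hT, hN, hn, hη]
    exact hC ε hε (D θ₀) (hD0 θ₀) hDR m hm
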